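/- **Setting.** For a complex-valued function $q(x,t)$ and real $\rho$ consider the reverse space-time equation $$\begin{aligned}&\mathrm i q_t+\mathrm i q_{xxx}-3\big[q\,q(-x,-t)\,q_x+\tfrac12\mathrm i q^3q^2(-x,-t)\big]_x+\big[2q_{xx}-3q^3q^2(-x,-t)\big]\rho\\&\quad+\big[-2\mathrm i q^2q_x(-x,-t)+10\mathrm i\,q\,q(-x,-t)q_x\big]\rho+\big[4q^2q(-x,-t)+4\mathrm i q_x-8q\big]\rho^2+8q\rho^3=0,\end{aligned}\tag{E}$$ where $q_x(-x,-t)$ means: differentiate in $x$, then replace $(x,t)$ by $(-x,-t)$. Let $a,c,\rho\in\mathbb R$ with $c\neq0$, $a\ne2\rho$, $c^2+2a-4\rho\neq0$, and let $$b=a^3+3a^2c^2+\tfrac32ac^4-2a^2\rho-3c^4\rho-8ac^2\rho+(4c^2-4a-8)\rho^2+8\rho^3 .$$ Then the seed $q(x,t)=c\,e^{\mathrm i(ax+bt)}$ solves (E) on $\mathbb R^2$. For $\lambda\neq0$ let $H$ be a square root of $D(\lambda)=-4-(a-2\rho)^2\lambda^4+(-4c^2-4a+8\rho)\lambda^2$,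 put $$E=\tfrac14\Big(\big[(-3c^4-6ac^2+4c^2\rho-2a^2+8\rho^2)\lambda^4+4(c^2+a+2\rho)\lambda^2-8\big]t-2\lambda^4x\Big)\lambda^{-6}H,\quad K_\pm=\frac{2\mathrm i+\mathrm i(a-2\rho)\lambda^2\pm H}{2\lambda c},\quad\theta=ax+bt,$$ $$f=\big(c_1e^{E}+c_2e^{-E}\big)e^{\mathrm i\theta/2},\qquad g=\big(c_1K_-e^{E}+c_2K_+e^{-E}\big)e^{-\mathrm i\theta/2},$$ and define the superposed eigenfunction by $\phi_1=f+g(-x,-t)$, $\phi_2=g+f(-x,-t)$. Let $$\lambda_{2j-1}=\lambda_{2j}^*=\frac{\sqrt{2\left(-c^2+\sqrt{c^4+2ac^2-4c^2\rho}-a+2\rho\right)}}{a-2\rho}\qquad(j=1,2,\dots),$$ with any choice of the two complex square roots (the same choice for all $j$). Near $\varepsilon=0$ analytic branches of $H(\lambda_1+\varepsilon^2)$ and $H(\lambda_2+\varepsilon^2)$, as functions of $\varepsilon$, exist; fix any two such branches, and use the first one for all odd and the second one for all even indices. Put $c_1=1/\varepsilon$, $c_2=-1/\varepsilon$ in the eigenfunctions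 at these shifted parameters. **Expansion.** For $k=1,2$, every index $j$, every integer $m\ge0$ and all real $(x,t)$, for small $\varepsilon\ne0$, $$(\lambda_j+\varepsilon^2)^m\phi_{k}(\lambda_j+\varepsilon^2)=\sum_{n\ge0}\phi^{[m]}_{k,j}[n]\,\varepsilon^{2n},$$ where $\phi^{[m]}_{k,j}[n]$ is $\frac1{(2n)!}$ times the $2n$-th $\varepsilon$-derivative at $\varepsilon=0$ of the left-hand side (whose singularity at $0$ is removable). **$N$-order rogue wave.** Let $N\ge1$. Let $B'_{12}$ be the $2N\times2N$ matrix whose rows $2r+1$ and $2r+2$ ($0\le r\le N-1$) are, for $j=2r+1$ and $j=2r+2$ respectively, $$\big(\phi^{[2N-2]}_{1,j}[r],\ \phi^{[2N-1]}_{2,j}[r],\ \phi^{[2N-4]}_{1,j}[r],\ \phi^{[2N-3]}_{2,j}[r],\dots,\phi^{[0]}_{1,j}[r],\ \phi^{[1]}_{2,j}[r]\big),$$ and let $B'_{11}$ be $B'_{12}$ with its second column replaced by the column of the $-\phi^{[2N]}_{1,j}[r]$. Put $A'_{2,N-1}=|B'_{11}|/|B'_{12}|$ and $$q[N]=q-2\mathrm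 i\rho A'_{2,N-1}+\partial_xA'_{2,N-1}.\tag{gb1}$$ Then 1. $|B'_{12}|\ne0$ at the origin, and $q[N]$ is a smooth solution of (E) on the open set of all $(x,t)$ such that $|B'_{12}|$ vanishes neither at $(x,t)$ nor at $(-x,-t)$; 2. there are polynomials $P,Q$ in $(x,t)$ with complex coefficients such that $|B'_{12}|=Q$ for all $(x,t)$, and $q[N]=e^{\mathrm i(ax+bt)}P/Q^2$ wherever $Q\neq0$; 3. wherever $|B'_{12}|\neq0$, $A'_{2,N-1}$ is the limit of the coefficient $A_{2,N-1}=|B_{11}|/|B_{12}|$ of the $N$-fold Darboux transformation with the $2N$ spectral parameters $\lambda_j+\varepsilon_j^2$, as $(\varepsilon_1,\dots,\varepsilon_{2N})\to0$ with all $\varepsilon_j\ne0$ and $\varepsilon_i^2\ne\varepsilon_j^2$ for $i\neq j$ of the same parity. Here row $j$ of $B_{12}$ is $(\mu^{2N-2}\phi_1,\mu^{2N-1}\phi_2,\mu^{2N-4}\phi_1,\mu^{2N-3}\phi_2,\dots,\phi_1,\mu\phi_2)$, where $\mu=\lambda_j+\varepsilon_j^2$ and $(\phi_1,\phi_2)$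 is the superposed eigenfunction at $\mu$ with $c_1=1/\varepsilon_j$, $c_2=-1/\varepsilon_j$, and $B_{11}$ has second column $-\mu^{2N}\phi_1$ instead. **Interaction solutions.** Let $1\le n<N$. Keep $\lambda_1,\dots,\lambda_{2n}$ as above, and for $2n<j\le2N$ let $\lambda_j\neq0$ be arbitrary, with any square root $H_j$ of $D(\lambda_j)$, any constants $c_{1},c_{2}\in\mathbb C$ (which may depend on $j$), and $(\phi_{1,j},\phi_{2,j})$ the superposed eigenfunction with these data. Let $B''_{12}$ have as first $2n$ rows the rows above ($0\le r\le n-1$) and as rows $j=2n+1,\dots,2N$ the rows $(\lambda_j^{2N-2}\phi_{1,j},\lambda_j^{2N-1}\phi_{2,j},\dots,\phi_{1,j},\lambda_j\phi_{2,j})$; let $B''_{11}$ be $B''_{12}$ with second column replaced by the column with entries $-\phi^{[2N]}_{1,j}[r]$ in the first $2n$ rows and $-\lambda_j^{2N}\phi_{1,j}$ in the others. With $A''_{2,N-1}=|B''_{11}|/|B''_{12}|$, $$q[N]=q-2\mathrm i\rho A''_{2,N-1}+\partial_xA''_{2,N-1}\tag{gb2}$$ is a smooth solution of (E) on the open set of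 all $(x,t)$ such that $|B''_{12}|$ vanishes neither at $(x,t)$ nor at $(-x,-t)$, and wherever $|B''_{12}|\ne0$, $A''_{2,N-1}$ is the limit, as in 3, of the $N$-fold Darboux transformation coefficients in which only the first $2n$ rows are shifted. If moreover $\lambda_{2n+1},\dots,\lambda_{2N}$ are pairwise distinct and different from $\lambda_1,\lambda_2$, and none of the eigenfunctions $(\phi_{1,j},\phi_{2,j})$, $j>2n$, vanishes identically, then $|B''_{12}|\neq0$ at the origin. -/

import Mathlib

open Filter Topology
open scoped ContDiff ComplexConjugate

noncomputable section

namespace NonlocalNLS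

/-- The partial derivative in the space variable. -/
def dx (f : ℝ → ℝ → ℂ) : ℝ → ℝ → ℂ := fun x t => deriv (fun y => f y t) x

/-- The partial derivative in the time variable. -/
def dt (f : ℝ → ℝ → ℂ) : ℝ → ℝ → ℂ := fun x t => deriv (fun s => f x s) t

/-- The reverse space-time reflection `f(-x,-t)`. -/
def refl (f : ℝ → ℝ → ℂ) : ℝ → ℝ → ℂ := fun x t => f (-x) (-t)

/-- The left-hand side of the reverse space-time higher-order modified self-steepening
nonlinear Schrödinger equation. The term `refl (dx q)` is `q_x(-x,-t)`: first differentiate,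
then reflect. -/
def equationLHS (ρ : ℝ) (q : ℝ → ℝ → ℂ) (x t : ℝ) : ℂ :=
  Complex.I * dt q x t + Complex.I * dx (dx (dx q)) x t
    - 3 * dx (fun y s => q y s * refl q y s * dx q y s
        + 1 / 2 * Complex.I * q y s ^ 3 * refl q y s ^ 2) x t
    + (2 * dx (dx q) x t - 3 * q x t ^ 3 * refl q x t ^ 2) * ρ
    + (-2 * Complex.I * q x t ^ 2 * refl (dx q) x t
        + 10 * Complex.I * q x t * refl q x t * dx q x t) * ρ
    + (4 * q x t ^ 2 * refl q x t + 4 * Complex.I * dx q x t - 8 * q x t) * ρ ^ 2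
    + 8 * q x t * ρ ^ 3

/-- `q` is a (classical, smooth) solution of the nonlocal equation on `Ω`, an open subset of the
`(x,t)`-plane that is symmetric under `(x,t) ↦ (-x,-t)`. -/
def IsSolutionOn (ρ : ℝ) (Ω : Set (ℝ × ℝ)) (q : ℝ → ℝ → ℂ) : Prop :=
  IsOpen Ω ∧ (∀ z ∈ Ω, -z ∈ Ω) ∧ ContDiffOn ℝ ∞ (fun z : ℝ × ℝ => q z.1 z.2) Ω ∧
    ∀ z ∈ Ω, equationLHS ρ q z.1 z.2 = 0

/-- The plane wave seed `c e^{i(ax+bt)}`. -/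
def seed (a b c : ℝ) (x t : ℝ) : ℂ := c * Complex.exp (Complex.I * (a * x + b * t))

/-- The frequency `b` for which the plane wave seed solves the equation. -/
def seedFrequency (a c ρ : ℝ) : ℝ :=
  a ^ 3 + 3 * a ^ 2 * c ^ 2 + 3 / 2 * a * c ^ 4 - 2 * a ^ 2 * ρ - 3 * c ^ 4 * ρ
    - 8 * a * c ^ 2 * ρ + (4 * c ^ 2 - 4 * a - 8) * ρ ^ 2 + 8 * ρ ^ 3

/-- The radicand of `H_k`, as a function of the spectral parameter `l`. -/
def radicand (a c ρ : ℝ) (l : ℂ) : ℂ :=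
  -4 - (a - 2 * ρ) ^ 2 * l ^ 4 + (-4 * c ^ 2 - 4 * a + 8 * ρ) * l ^ 2

/-- The exponent of the first eigenfunction (without the plane wave part); `h` is a square root
of the radicand at `l`. -/
def phase (a c ρ : ℝ) (l h : ℂ) (x t : ℝ) : ℂ :=
  1 / 4 * (((-3 * c ^ 4 - 6 * a * c ^ 2 + 4 * c ^ 2 * ρ - 2 * a ^ 2 + 8 * ρ ^ 2) * l ^ 4
    + 4 * (c ^ 2 + a + 2 * ρ) * l ^ 2 - 8) * t - 2 * l ^ 4 * x) / l ^ 6 * h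

/-- First component of `c₁Φ₁ + c₂Φ₂`, i.e. `ψ₁ + ψ₃`. -/
def psiFst (a b c ρ : ℝ) (l h c₁ c₂ : ℂ) (x t : ℝ) : ℂ :=
  c₁ * Complex.exp (phase a c ρ l h x t + 1 / 2 * Complex.I * (a * x + b * t))
    + c₂ * Complex.exp (-phase a c ρ l h x t + 1 / 2 * Complex.I * (a * x + b * t))

/-- Second component of `c₁Φ₁ + c₂Φ₂`, i.e. `ψ₂ + ψ₄`. -/
def psiSnd (a b c ρ : ℝ) (l h c₁ c₂ : ℂ) (x t : ℝ) : ℂ :=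
  c₁ * ((2 * Complex.I + Complex.I * (a - 2 * ρ) * l ^ 2 - h) / (2 * l * c))
      * Complex.exp (phase a c ρ l h x t - 1 / 2 * Complex.I * (a * x + b * t))
    + c₂ * ((2 * Complex.I + Complex.I * (a - 2 * ρ) * l ^ 2 + h) / (2 * l * c))
      * Complex.exp (-phase a c ρ l h x t - 1 / 2 * Complex.I * (a * x + b * t))

/-- The superposed eigenfunction `(φ₁, φ₂)`; index `0` is `φ₁` and index `1` is `φ₂`. -/
def eigenfunction (a b c ρ : ℝ) (l h c₁ c₂ : ℂ) (x t : ℝ) : Fin 2 → ℂ :=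
  ![psiFst a b c ρ l h c₁ c₂ x t + psiSnd a b c ρ l h c₁ c₂ (-x) (-t),
    psiSnd a b c ρ l h c₁ c₂ x t + psiFst a b c ρ l h c₁ c₂ (-x) (-t)]

/-- `l` is a critical value
`√(2(-c² + √(c⁴ + 2ac² - 4c²ρ) - a + 2ρ)) / (a - 2ρ)`,
for some choice `s`, `w` of the two complex square roots. -/
def IsCriticalValue (a c ρ : ℝ) (l : ℂ) : Prop :=
  ∃ s w : ℂ, s ^ 2 = c ^ 4 + 2 * a * c ^ 2 - 4 * c ^ 2 * ρ ∧
    w ^ 2 = 2 * (-c ^ 2 + s - a + 2 * ρ) ∧ l = w / (a - 2 * ρ)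

/-- The pair `(λ₁, λ₂)` with `λ₂ = λ₁^*`. -/
def conjPair (l : ℂ) : Fin 2 → ℂ := ![l, conj l]

/-- `H` is, near `ε = 0`, an analytic branch of the square root of the radicand at the shifted
spectral parameter `l + ε²`. -/
def IsRootBranch (a c ρ : ℝ) (l : ℂ) (H : ℂ → ℂ) : Prop :=
  AnalyticAt ℂ H 0 ∧ ∀ᶠ ε in 𝓝 (0 : ℂ), H ε ^ 2 = radicand a c ρ (l + ε ^ 2)

/-- `(l + ε²)^m φ_k(l + ε²)` with `c₁ = 1/ε`, `c₂ = -1/ε`, as a function of `ε`. -/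
def shifted (a b c ρ : ℝ) (l : ℂ) (H : ℂ → ℂ) (x t : ℝ) (k : Fin 2) (m : ℕ) (ε : ℂ) : ℂ :=
  (l + ε ^ 2) ^ m * eigenfunction a b c ρ (l + ε ^ 2) (H ε) (1 / ε) (-1 / ε) x t k

/-- `1/(2n)!` times the `2n`-th derivative at `0` of `f`, where the value of `f` at `0` is
replaced by the limit of `f` there (the singularity at `0` being removable). -/
def evenTaylorCoeff (f : ℂ → ℂ) (n : ℕ) : ℂ :=
  iteratedDeriv (2 * n) (Function.update f 0 (limUnder (𝓝[≠] (0 : ℂ)) f)) 0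
    / ((2 * n).factorial : ℂ)

/-- The Taylor coefficient `φ_k^{[m]}[n]` at the spectral parameter `l`. -/
def taylorPhi (a b c ρ : ℝ) (l : ℂ) (H : ℂ → ℂ) (x t : ℝ) (k : Fin 2) (m n : ℕ) : ℂ :=
  evenTaylorCoeff (shifted a b c ρ l H x t k m) n

/-- The denominator matrix of the `N`-fold Darboux transformation. Here `row i k m` stands for
`λ_i^m φ_{k,i}`, so that the `i`-th row is
`(λ^{2N-2}φ₁, λ^{2N-1}φ₂, λ^{2N-4}φ₁, λ^{2N-3}φ₂, …, φ₁, λφ₂)`. -/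
def denMatrix (N : ℕ) (row : Fin (2 * N) → Fin 2 → ℕ → ℂ) :
    Matrix (Fin (2 * N)) (Fin (2 * N)) ℂ :=
  Matrix.of fun i j =>
    if Even (j : ℕ) then row i 0 (2 * N - 2 - j) else row i 1 (2 * N - j)

/-- The numerator matrix: the second column of `denMatrix` is replaced by `-λ_i^{2N} φ_{1,i}`. -/
def numMatrix (N : ℕ) (row : Fin (2 * N) → Fin 2 → ℕ → ℂ) :
    Matrix (Fin (2 * N)) (Fin (2 * N)) ℂ :=
  Matrix.of fun i j => if (j : ℕ) = 1 then -row i 0 (2 * N) else denMatrix N row i j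

/-- The quotient of determinants `A_{2,N-1}`. -/
def darbouxA (N : ℕ) (row : Fin (2 * N) → Fin 2 → ℕ → ℂ) : ℂ :=
  (numMatrix N row).det / (denMatrix N row).det

/-- The dressed field `q[N] = q - 2iρA + A_x`. -/
def dressed (ρ : ℝ) (q A : ℝ → ℝ → ℂ) : ℝ → ℝ → ℂ :=
  fun x t => q x t - 2 * Complex.I * ρ * A x t + dx A x t

/-- The points at which the denominator `D` vanishes neither at `(x,t)` nor at `(-x,-t)`. -/
def regularSet (D : ℝ → ℝ → ℂ) : Set (ℝ × ℝ) :=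
  {z | D z.1 z.2 ≠ 0 ∧ D (-z.1) (-z.2) ≠ 0}

/-- Rows of the degenerate Darboux transformation: with rows counted from `0`, row `i` consists
of the Taylor coefficients of order `⌊i/2⌋` at `λ₁` for even `i` and at `λ₂` for odd `i`. -/
def rogueRow (a b c ρ : ℝ) (lam : Fin 2 → ℂ) (H : Fin 2 → ℂ → ℂ) (x t : ℝ)
    (i : ℕ) (k : Fin 2) (m : ℕ) : ℂ :=
  taylorPhi a b c ρ (lam (Fin.ofNat 2 i)) (H (Fin.ofNat 2 i)) x t k m (i / 2)

/-- Rows before degeneration: in row `i` the spectral parameter is `λ₁ + ε_i²` for even `i`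
and `λ₂ + ε_i²` for odd `i`. -/
def shiftedRow (a b c ρ : ℝ) (lam : Fin 2 → ℂ) (H : Fin 2 → ℂ → ℂ) (x t : ℝ)
    (i : ℕ) (ε : ℂ) (k : Fin 2) (m : ℕ) : ℂ :=
  shifted a b c ρ (lam (Fin.ofNat 2 i)) (H (Fin.ofNat 2 i)) x t k m ε

/-- Spectral parameters, values of `H_i`, and coefficients of the eigenfunctions that generate
the other localized waves; only the entries with index `i ≥ 2n` are used. -/
structure WaveData (N : ℕ) where
  l : Fin (2 * N) → ℂ
  h : Fin (2 * N) → ℂ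
  c₁ : Fin (2 * N) → ℂ
  c₂ : Fin (2 * N) → ℂ

/-- Each other spectral parameter is nonzero and `h i` is a square root of the radicand there. -/
def WaveData.Admissible {N : ℕ} (W : WaveData N) (a c ρ : ℝ) (n : ℕ) : Prop :=
  ∀ i : Fin (2 * N), 2 * n ≤ (i : ℕ) → W.l i ≠ 0 ∧ W.h i ^ 2 = radicand a c ρ (W.l i)

/-- The `i`-th superposed eigenfunction of the other localized waves. -/
def WaveData.phi {N : ℕ} (W : WaveData N) (a b c ρ : ℝ) (i : Fin (2 * N)) (x t : ℝ) :
    Fin 2 → ℂ :=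
  eigenfunction a b c ρ (W.l i) (W.h i) (W.c₁ i) (W.c₂ i) x t

/-- The rows of the degenerate transformation (all `2N` rows are rogue wave rows). -/
def degenerateRows (a b c ρ : ℝ) (lam : Fin 2 → ℂ) (H : Fin 2 → ℂ → ℂ) (N : ℕ) (x t : ℝ)
    (i : Fin (2 * N)) : Fin 2 → ℕ → ℂ :=
  rogueRow a b c ρ lam H x t i

/-- The rows of the semi-degenerate transformation: `2n` rogue wave rows, followed by the
rows `λ_i^m φ_{k,i}` of the other localized waves. -/
def semiDegenerateRows (a b c ρ : ℝ) (lam : Fin 2 → ℂ) (H : Fin 2 → ℂ → ℂ) (N n : ℕ)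
    (W : WaveData N) (x t : ℝ) (i : Fin (2 * N)) (k : Fin 2) (m : ℕ) : ℂ :=
  if (i : ℕ) < 2 * n then rogueRow a b c ρ lam H x t i k m
  else W.l i ^ m * W.phi a b c ρ i x t k

/-- The rows of the `N`-fold transformation that degenerates to `degenerateRows`. -/
def perturbedRows (a b c ρ : ℝ) (lam : Fin 2 → ℂ) (H : Fin 2 → ℂ → ℂ) (N : ℕ)
    (ε : Fin (2 * N) → ℂ) (x t : ℝ) (i : Fin (2 * N)) : Fin 2 → ℕ → ℂ :=
  shiftedRow a b c ρ lam H x t i (ε i)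

/-- The rows of the `N`-fold transformation that degenerates to `semiDegenerateRows`. -/
def semiPerturbedRows (a b c ρ : ℝ) (lam : Fin 2 → ℂ) (H : Fin 2 → ℂ → ℂ) (N n : ℕ)
    (W : WaveData N) (ε : Fin (2 * N) → ℂ) (x t : ℝ) (i : Fin (2 * N)) (k : Fin 2) (m : ℕ) : ℂ :=
  if (i : ℕ) < 2 * n then shiftedRow a b c ρ lam H x t i (ε i) k m
  else W.l i ^ m * W.phi a b c ρ i x t k

/-- Shifts for the first `2n` rows that are nonzero and give pairwise different spectral
parameters at `λ₁` (even rows) and at `λ₂` (odd rows). -/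
def genericShifts (N n : ℕ) : Set (Fin (2 * N) → ℂ) :=
  {ε | (∀ i : Fin (2 * N), (i : ℕ) < 2 * n → ε i ≠ 0) ∧
    ∀ i j : Fin (2 * N), (i : ℕ) < 2 * n → (j : ℕ) < 2 * n → i ≠ j →
      (i : ℕ) % 2 = (j : ℕ) % 2 → ε i ^ 2 ≠ ε j ^ 2}

/-- The denominator `|B'₁₂|` of the `N`-order rogue wave. -/
def rogueDen (a b c ρ : ℝ) (lam : Fin 2 → ℂ) (H : Fin 2 → ℂ → ℂ) (N : ℕ) (x t : ℝ) : ℂ :=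
  (denMatrix N (degenerateRows a b c ρ lam H N x t)).det

/-- The ratio `A'_{2,N-1} = |B'₁₁| / |B'₁₂|`. -/
def rogueA (a b c ρ : ℝ) (lam : Fin 2 → ℂ) (H : Fin 2 → ℂ → ℂ) (N : ℕ) (x t : ℝ) : ℂ :=
  darbouxA N (degenerateRows a b c ρ lam H N x t)

/-- The `N`-order rogue wave `q[N] = q - 2iρA' + A'_x`. -/
def rogueWave (a b c ρ : ℝ) (lam : Fin 2 → ℂ) (H : Fin 2 → ℂ → ℂ) (N : ℕ) : ℝ → ℝ → ℂ :=
  dressed ρ (seed a b c) (rogueA a b c ρ lam H N)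

/-- The denominator `|B''₁₂|` of the interaction solution. -/
def interactionDen (a b c ρ : ℝ) (lam : Fin 2 → ℂ) (H : Fin 2 → ℂ → ℂ) (N n : ℕ)
    (W : WaveData N) (x t : ℝ) : ℂ :=
  (denMatrix N (semiDegenerateRows a b c ρ lam H N n W x t)).det

/-- The ratio `A''_{2,N-1} = |B''₁₁| / |B''₁₂|`. -/
def interactionA (a b c ρ : ℝ) (lam : Fin 2 → ℂ) (H : Fin 2 → ℂ → ℂ) (N n : ℕ)
    (W : WaveData N) (x t : ℝ) : ℂ :=
  darbouxA N (semiDegenerateRows a b c ρ lam H N n W x t)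

/-- The interaction solution `q[N] = q - 2iρA'' + A''_x`. -/
def interactionWave (a b c ρ : ℝ) (lam : Fin 2 → ℂ) (H : Fin 2 → ℂ → ℂ) (N n : ℕ)
    (W : WaveData N) : ℝ → ℝ → ℂ :=
  dressed ρ (seed a b c) (interactionA a b c ρ lam H N n W)

end NonlocalNLS

end

/-!
The equation is one flow of a hierarchy with a `2 × 2` Lax pair whose second component is the
reflection `(x,t) ↦ (-x,-t)` of the first. If `r = -q(-x,-t)`, the space part is
`U = [[-iλ⁻² + iρ, qλ⁻¹], [rλ⁻¹, iλ⁻² - iρ]]`, and the time part is built from the first coefficients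
of the formal solution `M` of `M_x = [U, M]`, `M² = 1`. The equation then reads
`q_t = F_x - 2iρF - 8iρ²q` for a flux `F` (`equationLHS_eq`).

**Solutions.** The spectral parameter is allowed to be an invertible matrix `S` and the eigenfunction
a vector `Φ` (`LaxVector`): a diagonal `S` gives the ordinary `N`-fold Darboux transformation, and
Jordan blocks give the Taylor coefficients of the degenerate one, since multiplication by `λ + ε²` acts
on the even coefficients of a function of `ε` as a Jordan block. Both transformations are therefore
one and the same statement, `LaxVector.isSolutionOn`. In it the two determinants are Cramer's rule for
the first row `(p(λ²), λ s(λ²))` of a Darboux matrix `T` that annihilates `(Φ, Φ(-x,-t))` at `λ = S`,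
the second row being the reflection. Where the denominator does not vanish, a combination of the
columns with polynomial coefficients of degree less than `N` in `λ²` that annihilates
`(Φ, Φ(-x,-t))` is zero. Applied to `T_x + TU - ŨT` this uniqueness gives the space part of the Lax
pair of the dressed field (`DarbouxCoeffs.space`). The space part implies that `T` intertwines the
matrices `M` of the two fields to the order that occurs in the time part (`DarbouxCoeffs.offDiag₀` to
`DarbouxCoeffs.offDiag₂`), and so the same uniqueness applies to `T_t + TV - ṼT`; its leading
coefficient is the time evolution of `A` (`DarbouxCoeffs.dt_β_top`), which turns the equation for `q`
into the equation for the dressed field.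

**Expansions.** The critical values are simple, nonreal roots of the radicand, so that every branch
of `H` is `ε` times an even function (`IsRootBranch.exists_eq_mul`). Hence `ε` times the shifted
eigenfunction is an odd analytic function of `ε`, and `φ[n]` is its Taylor coefficient of order
`2n + 1` (`BranchData.taylorPhi_zero`). The phase vanishes at the critical values, which makes these
coefficients `e^{±iθ/2}` times polynomials in `(x,t)` (`expPoly`); the exponentials cancel in the
denominator and leave `e^{iθ}` in the numerator (`BranchData.rogueWave_rational`).

**Origin.** At the origin both components of an eigenfunction agree. A vanishing combination of the
columns is therefore a polynomial of degree less than `2N` that vanishes to order `n` at each of the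
two critical values and at the other `2N - 2n` spectral parameters, hence is zero
(`BranchData.interactionDen_origin_ne_zero`).

**Limits.** The rows at distinct shifted parameters are, by Newton interpolation in the variable
`ε²`, invertible lower triangular combinations of rows of divided differences. As contour integrals,
these tend to the Taylor coefficients (`tendsto_evenDivDiff`), and quotients of determinants do not
feel invertible row operations (`BranchData.tendsto_interactionA`).
-/

noncomputable section

namespace NonlocalNLS

/-! ### Smooth functions of two real variables -/

/-- Smoothness on `Ω` of a function given in curried form. -/
def SmoothOn (Ω : Set (ℝ × ℝ)) (f : ℝ → ℝ → ℂ) : Prop :=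
  ContDiffOn ℝ ∞ (fun z : ℝ × ℝ => f z.1 z.2) Ω

section Smooth

variable {Ω : Set (ℝ × ℝ)} {f g : ℝ → ℝ → ℂ} {x t : ℝ}

theorem SmoothOn.differentiableAt (hf : SmoothOn Ω f) (hΩ : IsOpen Ω) {z : ℝ × ℝ} (hz : z ∈ Ω) :
    DifferentiableAt ℝ (fun z : ℝ × ℝ => f z.1 z.2) z :=
  (hf.contDiffAt (hΩ.mem_nhds hz)).differentiableAt (by simp)

theorem SmoothOn.hasDerivAt_dx_fderiv (hf : SmoothOn Ω f) (hΩ : IsOpen Ω) (hz : (x, t) ∈ Ω) :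
    HasDerivAt (fun y => f y t) (fderiv ℝ (fun z : ℝ × ℝ => f z.1 z.2) (x, t) (1, 0)) x := by
  have h := (hf.differentiableAt hΩ hz).hasFDerivAt
  exact h.comp_hasDerivAt (f := fun y : ℝ => (y, t)) x
    ((hasDerivAt_id x).prodMk (hasDerivAt_const x t))

theorem SmoothOn.hasDerivAt_dt_fderiv (hf : SmoothOn Ω f) (hΩ : IsOpen Ω) (hz : (x, t) ∈ Ω) :
    HasDerivAt (fun s => f x s) (fderiv ℝ (fun z : ℝ × ℝ => f z.1 z.2) (x, t) (0, 1)) t := by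
  have h := (hf.differentiableAt hΩ hz).hasFDerivAt
  exact h.comp_hasDerivAt (f := fun s : ℝ => (x, s)) t
    ((hasDerivAt_const t x).prodMk (hasDerivAt_id t))

theorem SmoothOn.hasDerivAt_dx (hf : SmoothOn Ω f) (hΩ : IsOpen Ω) (hz : (x, t) ∈ Ω) :
    HasDerivAt (fun y => f y t) (dx f x t) x :=
  (hf.hasDerivAt_dx_fderiv hΩ hz).differentiableAt.hasDerivAt

theorem SmoothOn.hasDerivAt_dt (hf : SmoothOn Ω f) (hΩ : IsOpen Ω) (hz : (x, t) ∈ Ω) :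
    HasDerivAt (fun s => f x s) (dt f x t) t :=
  (hf.hasDerivAt_dt_fderiv hΩ hz).differentiableAt.hasDerivAt

theorem SmoothOn.congr' (hf : SmoothOn Ω f) (h : ∀ x t, (x, t) ∈ Ω → g x t = f x t) :
    SmoothOn Ω g :=
  ContDiffOn.congr hf fun z hz => h z.1 z.2 hz

theorem SmoothOn.fderiv_apply (hf : SmoothOn Ω f) (hΩ : IsOpen Ω) (v : ℝ × ℝ) :
    ContDiffOn ℝ ∞ (fun z => fderiv ℝ (fun z : ℝ × ℝ => f z.1 z.2) z v) Ω :=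
  (ContDiffOn.fderiv_of_isOpen hf hΩ (by simp)).clm_apply contDiffOn_const

theorem SmoothOn.dx (hf : SmoothOn Ω f) (hΩ : IsOpen Ω) : SmoothOn Ω (dx f) :=
  ContDiffOn.congr (hf.fderiv_apply hΩ (1, 0)) fun _ hz => (hf.hasDerivAt_dx_fderiv hΩ hz).deriv

theorem eventually_dx_slice (hΩ : IsOpen Ω) (hz : (x, t) ∈ Ω) : ∀ᶠ y in 𝓝 x, (y, t) ∈ Ω :=
  (Continuous.prodMk_left t).continuousAt.eventually (hΩ.mem_nhds hz)

theorem eventually_dt_slice (hΩ : IsOpen Ω) (hz : (x, t) ∈ Ω) : ∀ᶠ s in 𝓝 t, (x, s) ∈ Ω :=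
  (Continuous.prodMk_right x).continuousAt.eventually (hΩ.mem_nhds hz)

theorem dx_congr (hΩ : IsOpen Ω) (h : ∀ x t, (x, t) ∈ Ω → f x t = g x t) (hz : (x, t) ∈ Ω) :
    dx f x t = dx g x t :=
  Filter.EventuallyEq.deriv_eq ((eventually_dx_slice hΩ hz).mono fun y hy => h y t hy)

theorem dt_congr (hΩ : IsOpen Ω) (h : ∀ x t, (x, t) ∈ Ω → f x t = g x t) (hz : (x, t) ∈ Ω) :
    dt f x t = dt g x t :=
  Filter.EventuallyEq.deriv_eq ((eventually_dt_slice hΩ hz).mono fun y hy => h x y hy)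

theorem dx_dt_comm (hf : SmoothOn Ω f) (hΩ : IsOpen Ω) (hz : (x, t) ∈ Ω) :
    dx (dt f) x t = dt (dx f) x t := by
  set F : ℝ × ℝ → ℂ := fun z => f z.1 z.2 with hF
  have hsymm : IsSymmSndFDerivAt ℝ F (x, t) :=
    (hf.contDiffAt (hΩ.mem_nhds hz)).isSymmSndFDerivAt
      (by
        rw [minSmoothness_of_isRCLikeNormedField]
        exact WithTop.coe_le_coe.2 (le_top (a := (2 : ℕ∞))))
  have h2 : DifferentiableAt ℝ (fderiv ℝ F) (x, t) :=
    (((ContDiffOn.fderiv_of_isOpen hf hΩ (m := ∞) (by simp)).contDiffAt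
      (hΩ.mem_nhds hz)).differentiableAt (by simp))
  have e1 : dx (dt f) x t = fderiv ℝ (fderiv ℝ F) (x, t) (1, 0) (0, 1) := by
    rw [dx_congr (f := NonlocalNLS.dt f) (g := fun x t => fderiv ℝ F (x, t) (0, 1)) hΩ
      (fun x t h => (hf.hasDerivAt_dt_fderiv hΩ h).deriv) hz]
    have := (h2.hasFDerivAt.comp_hasDerivAt (f := fun y : ℝ => (y, t)) x
      ((hasDerivAt_id x).prodMk (hasDerivAt_const x t)))
    exact (this.clm_apply (hasDerivAt_const x ((0 : ℝ), (1 : ℝ)))).deriv.trans (by simp)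
  have e2 : dt (dx f) x t = fderiv ℝ (fderiv ℝ F) (x, t) (0, 1) (1, 0) := by
    rw [dt_congr (f := NonlocalNLS.dx f) (g := fun x t => fderiv ℝ F (x, t) (1, 0)) hΩ
      (fun x t h => (hf.hasDerivAt_dx_fderiv hΩ h).deriv) hz]
    have := (h2.hasFDerivAt.comp_hasDerivAt (f := fun s : ℝ => (x, s)) t
      ((hasDerivAt_const t x).prodMk (hasDerivAt_id t)))
    exact (this.clm_apply (hasDerivAt_const t ((1 : ℝ), (0 : ℝ)))).deriv.trans (by simp)
  rw [e1, e2]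
  exact hsymm (1, 0) (0, 1)

theorem SmoothOn.add (hf : SmoothOn Ω f) (hg : SmoothOn Ω g) :
    SmoothOn Ω (fun x t => f x t + g x t) := ContDiffOn.add hf hg

theorem SmoothOn.sub (hf : SmoothOn Ω f) (hg : SmoothOn Ω g) :
    SmoothOn Ω (fun x t => f x t - g x t) := ContDiffOn.sub hf hg

theorem SmoothOn.mul (hf : SmoothOn Ω f) (hg : SmoothOn Ω g) :
    SmoothOn Ω (fun x t => f x t * g x t) := ContDiffOn.mul hf hg

theorem SmoothOn.neg (hf : SmoothOn Ω f) : SmoothOn Ω (fun x t => -f x t) := ContDiffOn.neg hf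

theorem SmoothOn.pow (hf : SmoothOn Ω f) (n : ℕ) : SmoothOn Ω (fun x t => f x t ^ n) :=
  ContDiffOn.pow hf n

theorem SmoothOn.const (w : ℂ) : SmoothOn Ω (fun _ _ => w) := contDiffOn_const

theorem SmoothOn.refl (hf : SmoothOn Ω f) (hs : ∀ z ∈ Ω, -z ∈ Ω) : SmoothOn Ω (refl f) :=
  ContDiffOn.comp (g := fun z : ℝ × ℝ => f z.1 z.2) hf contDiff_neg.contDiffOn hs

theorem dx_refl : dx (refl f) x t = -refl (dx f) x t := by
  simp only [dx, refl]
  exact deriv_comp_neg (fun y => f y (-t)) x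

end Smooth

/-! ### The equation as a flow of the hierarchy -/

/-- The field `r = -q(-x,-t)` in the lower left corner of the spectral problem. -/
def dualField (q : ℝ → ℝ → ℂ) : ℝ → ℝ → ℂ := fun x t => -refl q x t

/-- The matrix `M = [[d, λn], [λo, -d]]` with `M_x = [U, M]` and `M² = 1` has the expansion
`d = 1 + d₁λ² + d₂λ⁴ + …`, `n = iq + n₁λ² + n₂λ⁴ + …`, `o = -n(-x,-t)`; this is `d₁`. -/
def resD₁ (q : ℝ → ℝ → ℂ) : ℝ → ℝ → ℂ := fun x t => q x t * dualField q x t / 2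

/-- The coefficient `n₁` of the expansion described at `resD₁`. -/
def resN₁ (ρ : ℝ) (q : ℝ → ℝ → ℂ) : ℝ → ℝ → ℂ := fun x t =>
  Complex.I / 2 * (Complex.I * dx q x t + 2 * ρ * q x t + q x t ^ 2 * dualField q x t)

/-- The coefficient `o₁` of the expansion described at `resD₁`. -/
def resO₁ (ρ : ℝ) (q : ℝ → ℝ → ℂ) : ℝ → ℝ → ℂ := fun x t => -refl (resN₁ ρ q) x t

/-- The coefficient `d₂` of the expansion described at `resD₁`. -/
def resD₂ (ρ : ℝ) (q : ℝ → ℝ → ℂ) : ℝ → ℝ → ℂ := fun x t =>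
  -(1 / 2) * (resD₁ q x t ^ 2 + Complex.I * q x t * resO₁ ρ q x t
    + Complex.I * dualField q x t * resN₁ ρ q x t)

/-- The coefficient `n₂` of the expansion described at `resD₁`. -/
def resN₂ (ρ : ℝ) (q : ℝ → ℝ → ℂ) : ℝ → ℝ → ℂ := fun x t =>
  Complex.I / 2 * (dx (resN₁ ρ q) x t - 2 * Complex.I * ρ * resN₁ ρ q x t
    + 2 * q x t * resD₂ ρ q x t)

/-- The flux: the coefficient of `λ⁻¹` in the upper right corner of the time part
`λ⁻⁶(-4i + 8iρλ²)M` of the Lax pair. -/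
def flux (ρ : ℝ) (q : ℝ → ℝ → ℂ) : ℝ → ℝ → ℂ := fun x t =>
  -4 * Complex.I * resN₂ ρ q x t + 8 * Complex.I * ρ * resN₁ ρ q x t

section Flow

theorem I_pow_five : Complex.I ^ 5 = Complex.I := by
  rw [pow_succ, Complex.I_pow_four, one_mul]

variable {Ω : Set (ℝ × ℝ)} {ρ : ℝ} {q : ℝ → ℝ → ℂ} {x t : ℝ}

theorem SmoothOn.dualField (hq : SmoothOn Ω q) (hs : ∀ z ∈ Ω, -z ∈ Ω) :
    SmoothOn Ω (dualField q) := (hq.refl hs).neg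

theorem SmoothOn.resN₁ (hq : SmoothOn Ω q) (hΩ : IsOpen Ω) (hs : ∀ z ∈ Ω, -z ∈ Ω) :
    SmoothOn Ω (resN₁ ρ q) :=
  (SmoothOn.const _).mul ((((SmoothOn.const _).mul (hq.dx hΩ)).add
    ((SmoothOn.const _).mul hq)).add ((hq.pow 2).mul (hq.dualField hs)))

theorem SmoothOn.resD₂ (hq : SmoothOn Ω q) (hΩ : IsOpen Ω) (hs : ∀ z ∈ Ω, -z ∈ Ω) :
    SmoothOn Ω (resD₂ ρ q) := by
  have hn := hq.resN₁ (ρ := ρ) hΩ hs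
  have hd : SmoothOn Ω (resD₁ q) :=
    ((hq.mul (hq.dualField hs)).mul (SmoothOn.const 2⁻¹)).congr'
      fun x t _ => by simp [resD₁, div_eq_mul_inv]
  exact (SmoothOn.const _).mul (((hd.pow 2).add (((SmoothOn.const _).mul hq).mul
    (hn.refl hs).neg)).add (((SmoothOn.const _).mul (hq.dualField hs)).mul hn))

theorem SmoothOn.flux (hq : SmoothOn Ω q) (hΩ : IsOpen Ω) (hs : ∀ z ∈ Ω, -z ∈ Ω) :
    SmoothOn Ω (flux ρ q) := by
  have hn := hq.resN₁ (ρ := ρ) hΩ hs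
  exact ((SmoothOn.const _).mul ((SmoothOn.const _).mul
    (((hn.dx hΩ).sub ((SmoothOn.const _).mul hn)).add
      (((SmoothOn.const _).mul hq).mul (hq.resD₂ hΩ hs))))).add ((SmoothOn.const _).mul hn)

theorem refl_resD₁ : resD₁ q (-x) (-t) = resD₁ q x t := by
  simp [resD₁, dualField, refl]; ring

theorem refl_resD₂ : resD₂ ρ q (-x) (-t) = resD₂ ρ q x t := by
  simp only [resD₂, refl_resD₁, resO₁, dualField, refl, neg_neg]; ring

theorem dx_dualField : dx (dualField q) x t = refl (dx q) x t := by
  have : dx (dualField q) x t = -dx (refl q) x t := by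
    simp only [dx, dualField]; exact deriv.fun_neg
  rw [this, dx_refl, neg_neg]

theorem resO₁_eq : resO₁ ρ q x t = -(Complex.I / 2) * (Complex.I * refl (dx q) x t
    - 2 * ρ * dualField q x t - dualField q x t ^ 2 * q x t) := by
  simp only [resO₁, resN₁, refl, dualField, neg_neg]; ring

/-- The explicit form of the flux. -/
theorem flux_eq (hΩ : IsOpen Ω) (hs : ∀ z ∈ Ω, -z ∈ Ω) (hq : SmoothOn Ω q) (hz : (x, t) ∈ Ω) :
    flux ρ q x t = -(dx (dx q) x t - 4 * Complex.I * ρ * dx q x t - 4 * ρ ^ 2 * q x t)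
      - 4 * Complex.I * ρ * (dx q x t - 2 * Complex.I * ρ * q x t)
      + 3 * Complex.I * q x t * dualField q x t * dx q x t
      + 3 / 2 * q x t ^ 3 * dualField q x t ^ 2
      + 2 * ρ * q x t ^ 2 * dualField q x t := by
  have h1 := hq.hasDerivAt_dx hΩ hz
  have h2 := (hq.dx hΩ).hasDerivAt_dx hΩ hz
  have h3 := (hq.dualField hs).hasDerivAt_dx hΩ hz
  rw [dx_dualField] at h3
  have h4 : dx (resN₁ ρ q) x t = _ := (HasDerivAt.const_mul (Complex.I / 2)
    (((h2.const_mul Complex.I).add (h1.const_mul (2 * (ρ : ℂ)))).add ((h1.pow 2).mul h3))).deriv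
  simp only [flux, resN₂, h4, resD₂, resO₁_eq, resD₁, resN₁]
  simp only [Nat.cast_ofNat, Nat.add_one_sub_one, pow_one, Pi.pow_apply]
  ring_nf
  simp only [Complex.I_sq, Complex.I_pow_three, Complex.I_pow_four, I_pow_five]
  ring_nf

/-- The equation in conservation form. -/
theorem equationLHS_eq (hΩ : IsOpen Ω) (hs : ∀ z ∈ Ω, -z ∈ Ω) (hq : SmoothOn Ω q)
    (hz : (x, t) ∈ Ω) :
    equationLHS ρ q x t = Complex.I * (dt q x t - dx (flux ρ q) x t
      + 2 * Complex.I * ρ * flux ρ q x t + 8 * Complex.I * ρ ^ 2 * q x t) := by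
  have h1 := hq.hasDerivAt_dx hΩ hz
  have h2 := (hq.dx hΩ).hasDerivAt_dx hΩ hz
  have h4 := ((hq.dx hΩ).dx hΩ).hasDerivAt_dx hΩ hz
  have h3 := (hq.dualField hs).hasDerivAt_dx hΩ hz
  rw [dx_dualField] at h3
  have hflux : dx (flux ρ q) x t = _ := (dx_congr hΩ (fun x t h => flux_eq hΩ hs hq h) hz).trans
    (((((((h4.sub (h2.const_mul (4 * Complex.I * ρ))).sub (h1.const_mul (4 * (ρ : ℂ) ^ 2))).neg).sub
      (HasDerivAt.const_mul (4 * Complex.I * ρ) (h2.sub (h1.const_mul (2 * Complex.I * ρ))))).add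
      (((h1.const_mul (3 * Complex.I)).mul h3).mul h2)).add
      (((h1.pow 3).const_mul (3 / 2)).mul (h3.pow 2))).add
      (((h1.pow 2).const_mul (2 * (ρ : ℂ))).mul h3)).deriv
  have hE : (fun y s => q y s * refl q y s * dx q y s
      + 1 / 2 * Complex.I * q y s ^ 3 * refl q y s ^ 2)
      = fun y s => -(q y s * dualField q y s * dx q y s)
        + 1 / 2 * Complex.I * (q y s ^ 3 * dualField q y s ^ 2) := by
    funext y s; simp only [dualField]; ring
  have hE' : dx (fun y s => -(q y s * dualField q y s * dx q y s)
        + 1 / 2 * Complex.I * (q y s ^ 3 * dualField q y s ^ 2)) x t = _ :=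
    ((((h1.mul h3).mul h2).neg).add
      (((h1.pow 3).mul (h3.pow 2)).const_mul (1 / 2 * Complex.I))).deriv
  have hr : refl q x t = -dualField q x t := by simp [dualField]
  rw [equationLHS, hE, hE', hflux, flux_eq hΩ hs hq hz, hr]
  simp only [Nat.cast_ofNat, Nat.add_one_sub_one, pow_one, Pi.pow_apply, Pi.mul_apply]
  ring_nf
  simp only [Complex.I_sq, Complex.I_pow_three, Complex.I_pow_four]
  ring_nf

end Flow

/-! ### Algebra of the Darboux relation -/

section

open Polynomial Matrix

section Algebra

variable {R M : Type*} [CommRing R] [AddCommGroup M] [Module R M]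

/-- The derivative of the relation `pφ + sψ = 0` along the space part of the Lax pair, in the module
of vectors over polynomials in `y = λ²`. The coefficients in the conclusion are the first row of
`λ²(T_x + TU - ŨT)`; here `(λ²s', p')` is the second row of the Darboux matrix `T` (its first entry
multiplied by `λ`), and `Q` is the new field. -/
theorem space_residual {y p s p' s' px sx i ρ q r Q : R} {φ ψ φx ψx : M}
    (hφ : y • φx = (-i + i * ρ * y) • φ + q • ψ)
    (hψ : y • ψx = (r * y) • φ + (i - i * ρ * y) • ψ)
    (h1 : p • φ + s • ψ = 0) (h2 : (y * s') • φ + p' • ψ = 0)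
    (h3 : px • φ + p • φx + (sx • ψ + s • ψx) = 0) :
    (y * (px + r * s - Q * s')) • φ
      + (y * sx + q * p - Q * p' + 2 * i * s - 2 * i * ρ * (y * s)) • ψ = 0 := by
  linear_combination (norm := module)
    y • h3 - p • hφ - s • hψ - (-i + i * ρ * y) • h1 - Q • h2

/-- The derivative of the relation `pφ + sψ = 0` along the time part of the Lax pair; the
coefficients in the conclusion are the first row of `λ⁶(T_t + TV - ṼT)`. The scalar `v` is the part of
the time flow that is proportional to the constant diagonal matrix, and primes on `vd`, `vn` refer to
the new field. -/
theorem time_residual {y p s p' s' pt st vd vn vo vd' vn' v : R} {φ ψ φt ψt : M}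
    (hφ : y ^ 3 • φt = (vd + v * y ^ 3) • φ + vn • ψ)
    (hψ : y ^ 3 • ψt = (y * vo) • φ - (vd + v * y ^ 3) • ψ)
    (h1 : p • φ + s • ψ = 0) (h2 : (y * s') • φ + p' • ψ = 0)
    (h3 : pt • φ + p • φt + (st • ψ + s • ψt) = 0) :
    (y ^ 3 * pt + (vd - vd') * p + y * (s * vo - vn' * s')) • φ
      + (y ^ 3 * st + p * vn - s * (vd + vd') - 2 * v * (y ^ 3 * s) - vn' * p') • ψ = 0 := by
  linear_combination (norm := module)
    y ^ 3 • h3 - p • hφ - s • hψ - (vd' + v * y ^ 3) • h1 - vn' • h2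

end Algebra

/-! ### The determinants as a linear system -/

theorem sum_range_two_mul (f : ℕ → ℂ) (N : ℕ) :
    ∑ j ∈ Finset.range (2 * N), f j = ∑ u ∈ Finset.range N, (f (2 * u) + f (2 * u + 1)) := by
  induction N with
  | zero => simp
  | succ n ih => rw [Finset.sum_range_succ, ← ih, mul_add, mul_one, Finset.sum_range_succ,
      Finset.sum_range_succ, add_assoc]

/-- The columns of the denominator matrix, listed by increasing powers of the spectral parameter. -/
theorem denMatrix_mulVec {N : ℕ} (row : Fin (2 * N) → Fin 2 → ℕ → ℂ) (u v : ℕ → ℂ)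
    (i : Fin (2 * N)) :
    (denMatrix N row *ᵥ fun j => if Even (j : ℕ) then u (N - 1 - (j : ℕ) / 2)
      else v (N - 1 - (j : ℕ) / 2)) i
      = ∑ k ∈ Finset.range N, (u k * row i 0 (2 * k) + v k * row i 1 (2 * k + 1)) := by
  have h1 : (denMatrix N row *ᵥ fun j => if Even (j : ℕ) then u (N - 1 - (j : ℕ) / 2)
      else v (N - 1 - (j : ℕ) / 2)) i = ∑ j ∈ Finset.range (2 * N),
        (if Even j then row i 0 (2 * N - 2 - j) else row i 1 (2 * N - j)) *
          (if Even j then u (N - 1 - j / 2) else v (N - 1 - j / 2)) := by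
    rw [← Fin.sum_univ_eq_sum_range]
    rfl
  rw [h1, sum_range_two_mul, ← Finset.sum_range_reflect]
  refine Finset.sum_congr rfl fun k hk => ?_
  have hk' := Finset.mem_range.1 hk
  have e1 : ¬ Even (2 * (N - 1 - k) + 1) := by simp
  have e2 : Even (2 * (N - 1 - k)) := by simp
  rw [if_pos e2, if_pos e2, if_neg e1, if_neg e1]
  rw [show 2 * N - 2 - 2 * (N - 1 - k) = 2 * k by omega,
    show 2 * N - (2 * (N - 1 - k) + 1) = 2 * k + 1 by omega,
    show N - 1 - 2 * (N - 1 - k) / 2 = k by omega,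
    show N - 1 - (2 * (N - 1 - k) + 1) / 2 = k by omega]
  ring

/-- Uniqueness: a combination of the columns that vanishes is trivial. -/
theorem eq_zero_of_denMatrix {N : ℕ} {row : Fin (2 * N) → Fin 2 → ℕ → ℂ}
    (h : (denMatrix N row).det ≠ 0) {u v : ℕ → ℂ}
    (huv : ∀ i, ∑ k ∈ Finset.range N, (u k * row i 0 (2 * k) + v k * row i 1 (2 * k + 1)) = 0)
    {k : ℕ} (hk : k < N) : u k = 0 ∧ v k = 0 := by
  have := Matrix.eq_zero_of_mulVec_eq_zero h
    (funext fun i => (denMatrix_mulVec row u v i).trans (huv i))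
  constructor
  · have := congrFun this ⟨2 * (N - 1 - k), by omega⟩
    simpa [show N - 1 - (N - 1 - k) = k by omega] using this
  · have := congrFun this ⟨2 * (N - 1 - k) + 1, by omega⟩
    simpa [show N - 1 - (2 * (N - 1 - k) + 1) / 2 = k by omega] using this

/-- The solution of the linear system given by Cramer's rule. -/
def cramerSol (N : ℕ) (row : Fin (2 * N) → Fin 2 → ℕ → ℂ) (j : Fin (2 * N)) : ℂ :=
  ((denMatrix N row).updateCol j fun i => -row i 0 (2 * N)).det / (denMatrix N row).det

theorem cramerSol_one {N : ℕ} (hN : 1 < 2 * N) (row : Fin (2 * N) → Fin 2 → ℕ → ℂ) :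
    cramerSol N row ⟨1, hN⟩ = darbouxA N row := by
  have : (denMatrix N row).updateCol ⟨1, hN⟩ (fun i => -row i 0 (2 * N)) = numMatrix N row := by
    ext i j
    by_cases hj : (j : ℕ) = 1
    · have : j = ⟨1, hN⟩ := Fin.ext hj
      subst this
      simp [numMatrix]
    · have : j ≠ ⟨1, hN⟩ := fun h => hj (congrArg Fin.val h)
      simp [numMatrix, this, hj]
  rw [cramerSol, darbouxA, this]

theorem denMatrix_mulVec_cramerSol {N : ℕ} {row : Fin (2 * N) → Fin 2 → ℕ → ℂ}
    (h : (denMatrix N row).det ≠ 0) (i : Fin (2 * N)) :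
    (denMatrix N row *ᵥ cramerSol N row) i = -row i 0 (2 * N) := by
  have e : cramerSol N row = (denMatrix N row).det⁻¹ •
      (denMatrix N row).cramer fun i => -row i 0 (2 * N) := by
    ext j
    simp [cramerSol, Matrix.cramer_apply, div_eq_inv_mul]
  rw [e, Matrix.mulVec_smul, Matrix.mulVec_cramer, smul_smul, inv_mul_cancel₀ h, one_smul]

/-- The coefficient of `λ^{2k}` in the upper left corner of the Darboux matrix. -/
def darbouxP (N : ℕ) (row : Fin (2 * N) → Fin 2 → ℕ → ℂ) (k : ℕ) : ℂ :=
  if h : k < N then cramerSol N row ⟨2 * (N - 1 - k), by omega⟩ else if k = N then 1 else 0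

/-- The coefficient of `λ^{2k+1}` in the upper right corner of the Darboux matrix. -/
def darbouxS (N : ℕ) (row : Fin (2 * N) → Fin 2 → ℕ → ℂ) (k : ℕ) : ℂ :=
  if h : k < N then cramerSol N row ⟨2 * (N - 1 - k) + 1, by omega⟩ else 0

theorem darbouxS_top {N : ℕ} (hN : 1 ≤ N) (row : Fin (2 * N) → Fin 2 → ℕ → ℂ) :
    darbouxS N row (N - 1) = darbouxA N row := by
  rw [← cramerSol_one (by omega), darbouxS, dif_pos (by omega)]
  congr 2; omega

/-- The first row of the Darboux matrix annihilates the eigenfunctions. -/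
theorem darboux_relation {N : ℕ} {row : Fin (2 * N) → Fin 2 → ℕ → ℂ}
    (h : (denMatrix N row).det ≠ 0) (i : Fin (2 * N)) :
    ∑ k ∈ Finset.range (N + 1), darbouxP N row k * row i 0 (2 * k)
      + ∑ k ∈ Finset.range N, darbouxS N row k * row i 1 (2 * k + 1) = 0 := by
  have h1 := denMatrix_mulVec_cramerSol h i
  have h2 : cramerSol N row = fun j : Fin (2 * N) =>
      if Even (j : ℕ) then darbouxP N row (N - 1 - (j : ℕ) / 2)
        else darbouxS N row (N - 1 - (j : ℕ) / 2) := by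
    ext j
    have hj := j.2
    have hlt : N - 1 - (j : ℕ) / 2 < N := by omega
    split_ifs with he
    · rw [darbouxP, dif_pos hlt]
      congr 1
      obtain ⟨m, hm⟩ := he
      exact Fin.ext (by simp only; omega)
    · rw [darbouxS, dif_pos hlt]
      congr 1
      obtain ⟨m, hm⟩ := Nat.not_even_iff_odd.1 he
      exact Fin.ext (by simp only; omega)
  rw [h2, denMatrix_mulVec, Finset.sum_add_distrib] at h1
  rw [Finset.sum_range_succ]
  have h3 : darbouxP N row N = 1 := by simp [darbouxP]
  rw [h3]
  linear_combination h1

theorem SmoothOn.det {n : ℕ} {Ω : Set (ℝ × ℝ)} {B : ℝ → ℝ → Matrix (Fin n) (Fin n) ℂ}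
    (h : ∀ i j, SmoothOn Ω (fun x t => B x t i j)) : SmoothOn Ω (fun x t => (B x t).det) := by
  have : (fun z : ℝ × ℝ => (B z.1 z.2).det) = fun z => ∑ σ : Equiv.Perm (Fin n),
      ((Equiv.Perm.sign σ : ℤ) : ℂ) * ∏ i, B z.1 z.2 (σ i) i := by
    funext z; rw [Matrix.det_apply']
  rw [SmoothOn, this]
  exact ContDiffOn.sum fun σ _ => contDiffOn_const.mul (contDiffOn_prod fun i _ => h _ _)

theorem SmoothOn.div {Ω : Set (ℝ × ℝ)} {f g : ℝ → ℝ → ℂ} (hf : SmoothOn Ω f)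
    (hg : SmoothOn Ω g) (h : ∀ x t, (x, t) ∈ Ω → g x t ≠ 0) :
    SmoothOn Ω (fun x t => f x t / g x t) :=
  ContDiffOn.congr (ContDiffOn.mul hf (ContDiffOn.inv hg fun z hz => h z.1 z.2 hz))
    fun _ _ => div_eq_mul_inv _ _

section SmoothSol

variable {N : ℕ} {Ω : Set (ℝ × ℝ)} {row : ℝ → ℝ → Fin (2 * N) → Fin 2 → ℕ → ℂ}

theorem SmoothOn.denMatrix (hrow : ∀ i k m, SmoothOn Ω (fun x t => row x t i k m)) (i j) :
    SmoothOn Ω (fun x t => denMatrix N (row x t) i j) := by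
  by_cases h : Even (j : ℕ) <;> simp only [NonlocalNLS.denMatrix, Matrix.of_apply, h, if_true,
    if_false] <;> exact hrow _ _ _

theorem SmoothOn.cramerSol (hrow : ∀ i k m, SmoothOn Ω (fun x t => row x t i k m))
    (h : ∀ x t, (x, t) ∈ Ω → (NonlocalNLS.denMatrix N (row x t)).det ≠ 0) (j : Fin (2 * N)) :
    SmoothOn Ω (fun x t => cramerSol N (row x t) j) := by
  refine SmoothOn.div (SmoothOn.det fun i j' => ?_) (SmoothOn.det (SmoothOn.denMatrix hrow)) h
  by_cases hj : j' = j
  · subst hj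
    simpa using (hrow i 0 (2 * N)).neg
  · simpa [hj] using SmoothOn.denMatrix hrow i j'

theorem SmoothOn.darbouxP (hrow : ∀ i k m, SmoothOn Ω (fun x t => row x t i k m))
    (h : ∀ x t, (x, t) ∈ Ω → (NonlocalNLS.denMatrix N (row x t)).det ≠ 0) (k : ℕ) :
    SmoothOn Ω (fun x t => darbouxP N (row x t) k) := by
  unfold NonlocalNLS.darbouxP
  split_ifs
  exacts [SmoothOn.cramerSol hrow h _, SmoothOn.const _, SmoothOn.const _]

theorem SmoothOn.darbouxS (hrow : ∀ i k m, SmoothOn Ω (fun x t => row x t i k m))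
    (h : ∀ x t, (x, t) ∈ Ω → (NonlocalNLS.denMatrix N (row x t)).det ≠ 0) (k : ℕ) :
    SmoothOn Ω (fun x t => darbouxS N (row x t) k) := by
  unfold NonlocalNLS.darbouxS
  split_ifs
  exacts [SmoothOn.cramerSol hrow h _, SmoothOn.const _]

end SmoothSol

end

/-! ### Lax pairs with a matrix spectral parameter -/

section

open Polynomial Matrix

section MatrixSpectral

theorem hasDerivAt_mulVec {κ : Type*} [Fintype κ] (A : Matrix κ κ ℂ)
    {φ : ℝ → κ → ℂ} {φ' : κ → ℂ} {x : ℝ}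
    (h : HasDerivAt φ φ' x) : HasDerivAt (fun y => A *ᵥ φ y) (A *ᵥ φ') x :=
  (((Matrix.mulVecLin A).restrictScalars ℝ).toContinuousLinearMap.hasFDerivAt).comp_hasDerivAt x h

variable {ι : Type*} [Fintype ι] [DecidableEq ι]

/-- Vectors as a module over the polynomials in `λ²`, where `λ` is the matrix `S`. -/
abbrev sqModule (S : Matrix ι ι ℂ) : Module ℂ[X] (ι → ℂ) :=
  Module.compHom (ι → ℂ) (aeval (R := ℂ) (Matrix.toLin' (S ^ 2))).toRingHom

/-- The value of the polynomial `P` in `λ²` at `λ = S`, applied to a vector. -/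
def act (S : Matrix ι ι ℂ) (P : ℂ[X]) (v : ι → ℂ) : ι → ℂ :=
  aeval (R := ℂ) (Matrix.toLin' (S ^ 2)) P v

/-- The polynomial with coefficients `u 0, …, u (n - 1)`. -/
def polyOf (n : ℕ) (u : ℕ → ℂ) : ℂ[X] := ∑ k ∈ Finset.range n, C (u k) * X ^ k

theorem coeff_polyOf {n : ℕ} {u : ℕ → ℂ} (h : ∀ k, n ≤ k → u k = 0) (m : ℕ) :
    (polyOf n u).coeff m = u m := by
  simp only [polyOf, finsetSum_coeff, coeff_C_mul, coeff_X_pow]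
  by_cases hm : m < n
  · rw [Finset.sum_eq_single m] <;> simp +contextual [hm, eq_comm]
  · rw [h m (not_lt.1 hm)]
    refine Finset.sum_eq_zero fun k hk => ?_
    rw [if_neg, mul_zero]
    have := Finset.mem_range.1 hk
    omega

variable (S : Matrix ι ι ℂ)

theorem act_C (c : ℂ) (v : ι → ℂ) : act S (C c) v = c • v := by
  simp [act, Module.algebraMap_end_apply]

theorem act_X (v : ι → ℂ) : act S X v = S ^ 2 *ᵥ v := by
  rw [act, aeval_X, Matrix.toLin'_apply]

theorem act_mul (P Q : ℂ[X]) (v : ι → ℂ) : act S (P * Q) v = act S P (act S Q v) := by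
  simp [act]

theorem act_add (P Q : ℂ[X]) (v : ι → ℂ) : act S (P + Q) v = act S P v + act S Q v := by
  simp [act]

theorem act_X_pow (k : ℕ) (v : ι → ℂ) : act S (X ^ k) v = S ^ (2 * k) *ᵥ v := by
  induction k with
  | zero => simp [act]
  | succ n ih => rw [pow_succ', act_mul, ih, act_X, Matrix.mulVec_mulVec, ← pow_add]; ring_nf

theorem act_mulVec (P : ℂ[X]) (v : ι → ℂ) : act S P (S *ᵥ v) = S *ᵥ act S P v := by
  induction P using Polynomial.induction_on' with
  | add P Q hP hQ => rw [act_add, act_add, hP, hQ, Matrix.mulVec_add]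
  | monomial n a =>
    rw [← C_mul_X_pow_eq_monomial, act_mul, act_mul, act_C, act_C, act_X_pow, act_X_pow,
      Matrix.mulVec_smul, Matrix.mulVec_mulVec, Matrix.mulVec_mulVec, ← pow_succ, ← pow_succ']

theorem act_polyOf (n : ℕ) (u : ℕ → ℂ) (v : ι → ℂ) :
    act S (polyOf n u) v = ∑ k ∈ Finset.range n, u k • (S ^ (2 * k) *ᵥ v) := by
  rw [polyOf, act, map_sum, LinearMap.sum_apply]
  refine Finset.sum_congr rfl fun k _ => ?_
  change act S _ v = _
  rw [act_mul, act_C, act_X_pow]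

theorem hasDerivAt_act_polyOf {n : ℕ} {u : ℕ → ℝ → ℂ} {u' : ℕ → ℂ} {φ : ℝ → ι → ℂ}
    {φ' : ι → ℂ} {x : ℝ} (hu : ∀ k, HasDerivAt (u k) (u' k) x) (hφ : HasDerivAt φ φ' x) :
    HasDerivAt (fun y => act S (polyOf n fun k => u k y) (φ y))
      (act S (polyOf n u') (φ x) + act S (polyOf n fun k => u k x) φ') x := by
  simp only [act_polyOf, ← Finset.sum_add_distrib]
  refine HasDerivAt.fun_sum fun k _ => ?_
  have := (hu k).smul (hasDerivAt_mulVec (S ^ (2 * k)) hφ)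
  rwa [add_comm] at this

/-- `Φ` is the first component of a solution `(Φ, Φ(-x,-t))` of the Lax pair of `q` in which the
spectral parameter `λ` is the matrix `S`. For a diagonal `S` the entries of `Φ` are
eigenfunctions at the diagonal entries of `S`; a Jordan block in `S` yields the successive
derivatives of an eigenfunction with respect to the spectral parameter. Negative powers of the
spectral parameter have been cleared. -/
structure LaxVector (ρ : ℝ) (q : ℝ → ℝ → ℂ) (S : Matrix ι ι ℂ) (Φ : ℝ → ℝ → ι → ℂ) : Prop where
  smooth : ∀ i, SmoothOn Set.univ (fun x t => Φ x t i)
  lax_x : ∀ x t, S ^ 2 *ᵥ (fun i => dx (fun x t => Φ x t i) x t) =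
    (-Complex.I) • Φ x t + (Complex.I * ρ) • (S ^ 2 *ᵥ Φ x t) + q x t • (S *ᵥ Φ (-x) (-t))
  lax_t : ∀ x t, S ^ 6 *ᵥ (fun i => dt (fun x t => Φ x t i) x t) =
    (-4 * Complex.I) • Φ x t
    + (-4 * Complex.I * resD₁ q x t + 8 * Complex.I * ρ) • (S ^ 2 *ᵥ Φ x t)
    + (-4 * Complex.I * resD₂ ρ q x t + 8 * Complex.I * ρ * resD₁ q x t) • (S ^ 4 *ᵥ Φ x t)
    + (-4 * Complex.I * ρ ^ 2) • (S ^ 6 *ᵥ Φ x t)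
    + (4 * q x t) • (S *ᵥ Φ (-x) (-t))
    + (-4 * Complex.I * resN₁ ρ q x t - 8 * ρ * q x t) • (S ^ 3 *ᵥ Φ (-x) (-t))
    + flux ρ q x t • (S ^ 5 *ᵥ Φ (-x) (-t))

/-- The rows `λ^m φ_k` for the matrix spectral parameter `S`. -/
def matrixRow (S : Matrix ι ι ℂ) (Φ : ℝ → ℝ → ι → ℂ) (x t : ℝ) (i : ι) (k : Fin 2) (m : ℕ) : ℂ :=
  (S ^ m *ᵥ (![Φ x t, Φ (-x) (-t)] k)) i

variable {S} {ρ : ℝ} {q : ℝ → ℝ → ℂ} {Φ : ℝ → ℝ → ι → ℂ}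

namespace LaxVector

/-- The vector of `x`-derivatives. -/
def vdx (Φ : ℝ → ℝ → ι → ℂ) (x t : ℝ) : ι → ℂ := fun i => dx (fun x t => Φ x t i) x t

/-- The vector of `t`-derivatives. -/
def vdt (Φ : ℝ → ℝ → ι → ℂ) (x t : ℝ) : ι → ℂ := fun i => dt (fun x t => Φ x t i) x t

theorem hasDerivAt_x (h : LaxVector ρ q S Φ) (x t : ℝ) :
    HasDerivAt (fun y => Φ y t) (vdx Φ x t) x :=
  hasDerivAt_pi.2 fun i => (h.smooth i).hasDerivAt_dx isOpen_univ (Set.mem_univ _)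

theorem hasDerivAt_t (h : LaxVector ρ q S Φ) (x t : ℝ) :
    HasDerivAt (fun s => Φ x s) (vdt Φ x t) t :=
  hasDerivAt_pi.2 fun i => (h.smooth i).hasDerivAt_dt isOpen_univ (Set.mem_univ _)

theorem hasDerivAt_dual_x (h : LaxVector ρ q S Φ) (x t : ℝ) :
    HasDerivAt (fun y => S *ᵥ Φ (-y) (-t)) (-(S *ᵥ vdx Φ (-x) (-t))) x := by
  have := hasDerivAt_mulVec S
    ((h.hasDerivAt_x (-x) (-t)).scomp x (hasDerivAt_neg x))
  simpa [Matrix.mulVec_neg] using this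

theorem hasDerivAt_dual_t (h : LaxVector ρ q S Φ) (x t : ℝ) :
    HasDerivAt (fun s => S *ᵥ Φ (-x) (-s)) (-(S *ᵥ vdt Φ (-x) (-t))) t := by
  have := hasDerivAt_mulVec S
    ((h.hasDerivAt_t (-x) (-t)).scomp t (hasDerivAt_neg t))
  simpa [Matrix.mulVec_neg] using this

/-- The space part of the Lax pair for the first component; `act_dual_x` is the one for the
second component `S Φ(-x,-t)`. -/
theorem act_x (h : LaxVector ρ q S Φ) (x t : ℝ) : act S X (vdx Φ x t)
    = act S (-C Complex.I + C Complex.I * C (ρ : ℂ) * X) (Φ x t)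
      + act S (C (q x t)) (S *ᵥ Φ (-x) (-t)) := by
  rw [act_X, show S ^ 2 *ᵥ vdx Φ x t = _ from h.lax_x x t, act_add, act_mul, act_mul, act_X,
    act_C, act_C, act_C, ← C_neg, act_C]
  simp only [smul_smul]

theorem act_dual_x (h : LaxVector ρ q S Φ) (x t : ℝ) : act S X (-(S *ᵥ vdx Φ (-x) (-t)))
    = act S (C (dualField q x t) * X) (Φ x t)
      + act S (C Complex.I - C Complex.I * C (ρ : ℂ) * X) (S *ᵥ Φ (-x) (-t)) := by
  have h1 : act S X (-(S *ᵥ vdx Φ (-x) (-t))) = -(S *ᵥ (act S X (vdx Φ (-x) (-t)))) := by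
    rw [← act_mulVec]; simp [act]
  rw [h1, h.act_x, neg_neg, neg_neg, Matrix.mulVec_add, ← act_mulVec, ← act_mulVec,
    Matrix.mulVec_mulVec, ← pow_two, ← act_X, ← act_mul]
  simp only [dualField, refl]
  let := sqModule S
  change -((_ : ℂ[X]) • (_ : ι → ℂ) + (_ : ℂ[X]) • _) = (_ : ℂ[X]) • _ + (_ : ℂ[X]) • _
  rw [C_neg]
  module

/-- The time part of the Lax pair for the first component; `act_dual_t` is the one for the
second component `S Φ(-x,-t)`. -/
theorem act_t (h : LaxVector ρ q S Φ) (x t : ℝ) : act S (X ^ 3) (vdt Φ x t)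
    = act S ((C (-4 * Complex.I) + C (-4 * Complex.I * resD₁ q x t + 8 * Complex.I * ρ) * X
        + C (-4 * Complex.I * resD₂ ρ q x t + 8 * Complex.I * ρ * resD₁ q x t) * X ^ 2)
        + C (-4 * Complex.I * ρ ^ 2) * X ^ 3) (Φ x t)
      + act S (C (4 * q x t) + C (-4 * Complex.I * resN₁ ρ q x t - 8 * ρ * q x t) * X
        + C (flux ρ q x t) * X ^ 2) (S *ᵥ Φ (-x) (-t)) := by
  simp only [act_add, act_mul, act_C, act_X_pow, act_X, Matrix.mulVec_mulVec, ← pow_succ]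
  norm_num only
  rw [show S ^ 6 *ᵥ vdt Φ x t = _ from h.lax_t x t]
  abel

theorem act_dual_t (h : LaxVector ρ q S Φ) (x t : ℝ) : act S (X ^ 3) (-(S *ᵥ vdt Φ (-x) (-t)))
    = act S (X * (C (4 * dualField q x t)
        + C (-4 * Complex.I * resO₁ ρ q x t - 8 * ρ * dualField q x t) * X
        + C (-refl (flux ρ q) x t) * X ^ 2)) (Φ x t)
      - act S ((C (-4 * Complex.I) + C (-4 * Complex.I * resD₁ q x t + 8 * Complex.I * ρ) * X
        + C (-4 * Complex.I * resD₂ ρ q x t + 8 * Complex.I * ρ * resD₁ q x t) * X ^ 2)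
        + C (-4 * Complex.I * ρ ^ 2) * X ^ 3) (S *ᵥ Φ (-x) (-t)) := by
  have h1 : act S (X ^ 3) (-(S *ᵥ vdt Φ (-x) (-t)))
      = -(S *ᵥ (act S (X ^ 3) (vdt Φ (-x) (-t)))) := by
    rw [← act_mulVec]; simp [act]
  rw [h1, h.act_t, neg_neg, neg_neg, Matrix.mulVec_add, ← act_mulVec, ← act_mulVec,
    Matrix.mulVec_mulVec, ← pow_two, ← act_X, ← act_mul, refl_resD₁, refl_resD₂]
  have e1 : (4 : ℂ) * q (-x) (-t) = -(4 * dualField q x t) := by simp [dualField, refl]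
  have e2 : -4 * Complex.I * resN₁ ρ q (-x) (-t) - 8 * ρ * q (-x) (-t)
      = -(-4 * Complex.I * resO₁ ρ q x t - 8 * ρ * dualField q x t) := by
    simp only [resO₁, dualField, refl]; ring
  have e3 : flux ρ q (-x) (-t) = -(-refl (flux ρ q) x t) := by simp [refl]
  rw [e1, e2, e3]
  let := sqModule S
  change -((_ : ℂ[X]) • (_ : ι → ℂ) + (_ : ℂ[X]) • _) = (_ : ℂ[X]) • _ - (_ : ℂ[X]) • _
  simp only [C_neg]
  module

end LaxVector

end MatrixSpectral

end

/-! ### The Darboux transformation with a matrix spectral parameter -/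

section

open Polynomial Matrix

section Darboux

variable {ι : Type*} [Fintype ι] [DecidableEq ι]

/-- The first row `(∑ α_k λ^{2k}, ∑ β_k λ^{2k+1})` of a Darboux matrix of degree `2N` that
annihilates `(Φ, Φ(-x,-t))` at `λ = S`; the second row is its reflection. By the last field it
is unique on `Ω`. -/
structure DarbouxCoeffs (N : ℕ) (S : Matrix ι ι ℂ) (Φ : ℝ → ℝ → ι → ℂ) (Ω : Set (ℝ × ℝ))
    (α β : ℕ → ℝ → ℝ → ℂ) : Prop where
  one_le : 1 ≤ N
  det : IsUnit S.det
  isOpen : IsOpen Ω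
  symm : ∀ z ∈ Ω, -z ∈ Ω
  smooth_α : ∀ k, SmoothOn Ω (α k)
  smooth_β : ∀ k, SmoothOn Ω (β k)
  α_top : α N = fun _ _ => 1
  α_zero : ∀ k, N < k → α k = fun _ _ => 0
  β_zero : ∀ k, N ≤ k → β k = fun _ _ => 0
  rel : ∀ x t, (x, t) ∈ Ω → act S (polyOf (N + 1) fun k => α k x t) (Φ x t)
    + act S (polyOf N fun k => β k x t) (S *ᵥ Φ (-x) (-t)) = 0
  indep : ∀ x t, (x, t) ∈ Ω → ∀ P Q : ℂ[X], P.degree < N → Q.degree < N →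
    act S P (Φ x t) + act S Q (S *ᵥ Φ (-x) (-t)) = 0 → P = 0 ∧ Q = 0

variable {N : ℕ} {S : Matrix ι ι ℂ} {ρ : ℝ} {q : ℝ → ℝ → ℂ} {Φ : ℝ → ℝ → ι → ℂ}
  {Ω : Set (ℝ × ℝ)} {α β : ℕ → ℝ → ℝ → ℂ} {x t : ℝ}

namespace DarbouxCoeffs

theorem mem_neg (h : DarbouxCoeffs N S Φ Ω α β) (hz : (x, t) ∈ Ω) : (-x, -t) ∈ Ω :=
  h.symm _ hz

theorem coeff_α (h : DarbouxCoeffs N S Φ Ω α β) (x t : ℝ) (m : ℕ) :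
    (polyOf (N + 1) fun k => α k x t).coeff m = α m x t :=
  coeff_polyOf (fun k hk => by rw [h.α_zero k hk]) m

theorem coeff_β (h : DarbouxCoeffs N S Φ Ω α β) (x t : ℝ) (m : ℕ) :
    (polyOf N fun k => β k x t).coeff m = β m x t :=
  coeff_polyOf (fun k hk => by rw [h.β_zero k hk]) m

theorem dx_α_zero (h : DarbouxCoeffs N S Φ Ω α β) {k : ℕ} (hk : N ≤ k) :
    dx (α k) x t = 0 := by
  rcases hk.eq_or_lt with rfl | hk
  · simp [h.α_top, dx]
  · simp [h.α_zero k hk, dx]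

theorem dt_α_zero (h : DarbouxCoeffs N S Φ Ω α β) {k : ℕ} (hk : N ≤ k) :
    dt (α k) x t = 0 := by
  rcases hk.eq_or_lt with rfl | hk
  · simp [h.α_top, dt]
  · simp [h.α_zero k hk, dt]

theorem dx_β_zero (h : DarbouxCoeffs N S Φ Ω α β) {k : ℕ} (hk : N ≤ k) :
    dx (β k) x t = 0 := by
  simp [h.β_zero k hk, dx]

theorem dt_β_zero (h : DarbouxCoeffs N S Φ Ω α β) {k : ℕ} (hk : N ≤ k) :
    dt (β k) x t = 0 := by
  simp [h.β_zero k hk, dt]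

theorem coeff_dxα (h : DarbouxCoeffs N S Φ Ω α β) (x t : ℝ) (m : ℕ) :
    (polyOf (N + 1) fun k => dx (α k) x t).coeff m = dx (α m) x t :=
  coeff_polyOf (fun k hk => h.dx_α_zero (by omega)) m

theorem coeff_dtα (h : DarbouxCoeffs N S Φ Ω α β) (x t : ℝ) (m : ℕ) :
    (polyOf (N + 1) fun k => dt (α k) x t).coeff m = dt (α m) x t :=
  coeff_polyOf (fun k hk => h.dt_α_zero (by omega)) m

theorem coeff_dxβ (h : DarbouxCoeffs N S Φ Ω α β) (x t : ℝ) (m : ℕ) :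
    (polyOf N fun k => dx (β k) x t).coeff m = dx (β m) x t :=
  coeff_polyOf (fun _ hk => h.dx_β_zero hk) m

theorem coeff_dtβ (h : DarbouxCoeffs N S Φ Ω α β) (x t : ℝ) (m : ℕ) :
    (polyOf N fun k => dt (β k) x t).coeff m = dt (β m) x t :=
  coeff_polyOf (fun _ hk => h.dt_β_zero hk) m

/-- The relation for the second row of the Darboux matrix, multiplied by `λ`. -/
theorem rel_dual (h : DarbouxCoeffs N S Φ Ω α β) (hz : (x, t) ∈ Ω) :
    act S (X * polyOf N fun k => β k (-x) (-t)) (Φ x t)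
      + act S (polyOf (N + 1) fun k => α k (-x) (-t)) (S *ᵥ Φ (-x) (-t)) = 0 := by
  have h1 := congrArg (S *ᵥ ·) (h.rel _ _ (h.mem_neg hz))
  simp only [neg_neg, Matrix.mulVec_add, Matrix.mulVec_zero, ← act_mulVec] at h1
  rw [Matrix.mulVec_mulVec, ← pow_two, ← act_X, ← act_mul, mul_comm, add_comm] at h1
  exact h1

theorem rel_dx (h : DarbouxCoeffs N S Φ Ω α β) (hL : LaxVector ρ q S Φ) (hz : (x, t) ∈ Ω) :
    act S (polyOf (N + 1) fun k => dx (α k) x t) (Φ x t)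
      + act S (polyOf (N + 1) fun k => α k x t) (LaxVector.vdx Φ x t)
      + (act S (polyOf N fun k => dx (β k) x t) (S *ᵥ Φ (-x) (-t))
        + act S (polyOf N fun k => β k x t) (-(S *ᵥ LaxVector.vdx Φ (-x) (-t)))) = 0 := by
  have h1 := (hasDerivAt_act_polyOf (n := N + 1) S
      (fun k => (h.smooth_α k).hasDerivAt_dx h.isOpen hz) (hL.hasDerivAt_x x t)).add
    (hasDerivAt_act_polyOf (n := N) S
      (fun k => (h.smooth_β k).hasDerivAt_dx h.isOpen hz) (hL.hasDerivAt_dual_x x t))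
  refine h1.unique ((hasDerivAt_const x 0).congr_of_eventuallyEq ?_)
  exact (eventually_dx_slice h.isOpen hz).mono fun y hy => h.rel y t hy

theorem rel_dt (h : DarbouxCoeffs N S Φ Ω α β) (hL : LaxVector ρ q S Φ) (hz : (x, t) ∈ Ω) :
    act S (polyOf (N + 1) fun k => dt (α k) x t) (Φ x t)
      + act S (polyOf (N + 1) fun k => α k x t) (LaxVector.vdt Φ x t)
      + (act S (polyOf N fun k => dt (β k) x t) (S *ᵥ Φ (-x) (-t))
        + act S (polyOf N fun k => β k x t) (-(S *ᵥ LaxVector.vdt Φ (-x) (-t)))) = 0 := by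
  have h1 := (hasDerivAt_act_polyOf (n := N + 1) S
      (fun k => (h.smooth_α k).hasDerivAt_dt h.isOpen hz) (hL.hasDerivAt_t x t)).add
    (hasDerivAt_act_polyOf (n := N) S
      (fun k => (h.smooth_β k).hasDerivAt_dt h.isOpen hz) (hL.hasDerivAt_dual_t x t))
  refine h1.unique ((hasDerivAt_const t 0).congr_of_eventuallyEq ?_)
  exact (eventually_dt_slice h.isOpen hz).mono fun y hy => h.rel x y hy

/-- Uniqueness for combinations of the shape of the second row. -/
theorem indep_dual (h : DarbouxCoeffs N S Φ Ω α β) (hz : (x, t) ∈ Ω) {P Q : ℂ[X]}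
    (hP : P.degree < N) (hQ : Q.degree < N)
    (hPQ : act S (X * P) (Φ x t) + act S Q (S *ᵥ Φ (-x) (-t)) = 0) : P = 0 ∧ Q = 0 := by
  refine (h.indep _ _ (h.mem_neg hz) Q P hQ hP ?_).symm
  have hinj : Function.Injective (S *ᵥ ·) :=
    Matrix.mulVec_injective_of_isUnit ((Matrix.isUnit_iff_isUnit_det S).2 h.det)
  refine hinj ?_
  simp only [neg_neg, Matrix.mulVec_add, Matrix.mulVec_zero, ← act_mulVec]
  rw [Matrix.mulVec_mulVec, ← pow_two, ← act_X, ← act_mul, mul_comm, add_comm]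
  exact hPQ

/-- The field produced by the Darboux transformation. -/
def field (N : ℕ) (ρ : ℝ) (q : ℝ → ℝ → ℂ) (β : ℕ → ℝ → ℝ → ℂ) : ℝ → ℝ → ℂ :=
  dressed ρ q (β (N - 1))

theorem smooth_field (h : DarbouxCoeffs N S Φ Ω α β) (hq : SmoothOn Set.univ q) :
    SmoothOn Ω (field N ρ q β) :=
  ((ContDiffOn.mono hq (Set.subset_univ _) : SmoothOn Ω q).sub ((SmoothOn.const _).mul
    (h.smooth_β _))).add ((h.smooth_β _).dx h.isOpen)

/-- The Darboux matrix intertwines the space parts of the Lax pairs of `q` and of the new field,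
because the difference of both sides is a combination covered by uniqueness. -/
theorem space (h : DarbouxCoeffs N S Φ Ω α β) (hL : LaxVector ρ q S Φ) (hz : (x, t) ∈ Ω) :
    (∀ k, dx (α k) x t = field N ρ q β x t * β k (-x) (-t) - dualField q x t * β k x t) ∧
    (field N ρ q β x t * α 0 (-x) (-t) - q x t * α 0 x t - 2 * Complex.I * β 0 x t = 0) ∧
    (∀ k, dx (β k) x t = field N ρ q β x t * α (k + 1) (-x) (-t) - q x t * α (k + 1) x t
      - 2 * Complex.I * β (k + 1) x t + 2 * Complex.I * ρ * β k x t) := by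
  have hN := h.one_le
  set Q := field N ρ q β x t with hQ
  have hres : act S (X * ((polyOf (N + 1) fun k => dx (α k) x t)
        + C (dualField q x t) * (polyOf N fun k => β k x t)
        - C Q * (polyOf N fun k => β k (-x) (-t)))) (Φ x t)
      + act S (X * (polyOf N fun k => dx (β k) x t)
        + C (q x t) * (polyOf (N + 1) fun k => α k x t)
        - C Q * (polyOf (N + 1) fun k => α k (-x) (-t))
        + 2 * C Complex.I * (polyOf N fun k => β k x t)
        - 2 * C Complex.I * C (ρ : ℂ) * (X * (polyOf N fun k => β k x t)))
        (S *ᵥ Φ (-x) (-t)) = 0 := by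
    let _ := sqModule S
    exact space_residual (R := ℂ[X]) (M := ι → ℂ) (hL.act_x x t) (hL.act_dual_x x t)
      (h.rel x t hz) (h.rel_dual hz) (h.rel_dx hL hz)
  have hc1 : ∀ m, ((polyOf (N + 1) fun k => dx (α k) x t)
        + C (dualField q x t) * (polyOf N fun k => β k x t)
        - C Q * (polyOf N fun k => β k (-x) (-t))).coeff m
      = dx (α m) x t + dualField q x t * β m x t - Q * β m (-x) (-t) := by
    intro m
    simp only [coeff_add, coeff_sub, coeff_C_mul, h.coeff_dxα, h.coeff_β]
  have hc2 : ∀ m, (X * (polyOf N fun k => dx (β k) x t)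
        + C (q x t) * (polyOf (N + 1) fun k => α k x t)
        - C Q * (polyOf (N + 1) fun k => α k (-x) (-t))
        + 2 * C Complex.I * (polyOf N fun k => β k x t)
        - 2 * C Complex.I * C (ρ : ℂ) * (X * (polyOf N fun k => β k x t))).coeff m
      = (X * (polyOf N fun k => dx (β k) x t)).coeff m + q x t * α m x t - Q * α m (-x) (-t)
        + 2 * Complex.I * β m x t
        - 2 * Complex.I * ρ * (X * (polyOf N fun k => β k x t)).coeff m := by
    intro m
    rw [show (2 : ℂ[X]) = C 2 from rfl, ← C_mul, ← C_mul]
    simp only [coeff_add, coeff_sub, coeff_C_mul, h.coeff_α, h.coeff_β]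
  obtain ⟨h1, h2⟩ := h.indep_dual hz
    ((degree_lt_iff_coeff_zero _ _).2 fun m hm => by
      rw [hc1, h.dx_α_zero hm, h.β_zero m hm]; simp)
    ((degree_lt_iff_coeff_zero _ _).2 fun m hm => by
      obtain ⟨k, rfl⟩ : ∃ k, m = k + 1 := ⟨m - 1, by omega⟩
      rw [hc2, coeff_X_mul, coeff_X_mul, h.coeff_dxβ, h.coeff_β, h.β_zero (k + 1) hm]
      rcases hm.eq_or_lt with hm | hm
      · -- the definition of the new field is the vanishing of this coefficient
        have hk : k = N - 1 := by omega
        rw [← hm, h.α_top, hQ, field, dressed, ← hk]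
        ring
      · rw [h.α_zero _ hm, h.β_zero k (by omega)]
        simp [dx]) hres
  refine ⟨fun k => ?_, ?_, fun k => ?_⟩
  · have := hc1 k
    rw [h1, coeff_zero] at this
    linear_combination -this
  · have := hc2 0
    rw [h2, coeff_zero, mul_comm X, mul_comm X, coeff_mul_X_zero, coeff_mul_X_zero] at this
    linear_combination this
  · have := hc2 (k + 1)
    rw [h2, coeff_zero, coeff_X_mul, coeff_X_mul, h.coeff_dxβ, h.coeff_β] at this
    linear_combination -this

end DarbouxCoeffs

end Darboux

end

/-! ### Intertwining of the formal solutions `M` -/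

section

open Polynomial Matrix

section Darboux

variable {ι : Type*} [Fintype ι] [DecidableEq ι]
variable {N : ℕ} {S : Matrix ι ι ℂ} {ρ : ℝ} {q : ℝ → ℝ → ℂ} {Φ : ℝ → ℝ → ι → ℂ}
  {Ω : Set (ℝ × ℝ)} {α β : ℕ → ℝ → ℝ → ℂ} {x t : ℝ}

namespace DarbouxCoeffs

theorem neg_apply_dualField (f : ℝ → ℝ → ℂ) (x t : ℝ) : f (-x) (-t) = -dualField f x t := by
  simp [dualField, refl]

theorem dualField_neg_apply (f : ℝ → ℝ → ℂ) (x t : ℝ) : dualField f (-x) (-t) = -f x t := by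
  simp [dualField, refl]

theorem hasDerivAt_α_neg (h : DarbouxCoeffs N S Φ Ω α β) (hL : LaxVector ρ q S Φ)
    (hz : (x, t) ∈ Ω) (k : ℕ) : HasDerivAt (fun y => α k (-y) (-t))
      (dualField (field N ρ q β) x t * β k x t - q x t * β k (-x) (-t)) x := by
  have h1 := ((h.smooth_α k).hasDerivAt_dx h.isOpen (h.mem_neg hz)).scomp x (hasDerivAt_neg x)
  rw [(h.space hL (h.mem_neg hz)).1, neg_apply_dualField (field N ρ q β), dualField_neg_apply q,
    neg_neg, neg_neg] at h1
  refine h1.congr_deriv ?_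
  rw [neg_smul, one_smul]
  ring

theorem hasDerivAt_α (h : DarbouxCoeffs N S Φ Ω α β) (hL : LaxVector ρ q S Φ)
    (hz : (x, t) ∈ Ω) (k : ℕ) : HasDerivAt (fun y => α k y t)
      (field N ρ q β x t * β k (-x) (-t) - dualField q x t * β k x t) x := by
  rw [← (h.space hL hz).1]
  exact (h.smooth_α k).hasDerivAt_dx h.isOpen hz

theorem hasDerivAt_β (h : DarbouxCoeffs N S Φ Ω α β) (hL : LaxVector ρ q S Φ)
    (hz : (x, t) ∈ Ω) (k : ℕ) : HasDerivAt (fun y => β k y t)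
      (field N ρ q β x t * α (k + 1) (-x) (-t) - q x t * α (k + 1) x t
      - 2 * Complex.I * β (k + 1) x t + 2 * Complex.I * ρ * β k x t) x := by
  rw [← (h.space hL hz).2.2]
  exact (h.smooth_β k).hasDerivAt_dx h.isOpen hz

/-- Let `M` and `M̃` be the formal solutions described at `resD₁` for `q` and for the new field, and
`T` the Darboux matrix. The left-hand sides of `offDiag₀`, `diag₁`, `offDiag₁`, `diag₂`, `offDiag₂` are
the first coefficients of the entries in the upper row of `M̃T - TM`, in increasing powers of `λ`. This
one is the lowest coefficient of the space part. -/
theorem offDiag₀ (h : DarbouxCoeffs N S Φ Ω α β) (hL : LaxVector ρ q S Φ) (hz : (x, t) ∈ Ω) :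
    2 * β 0 x t + Complex.I * field N ρ q β x t * α 0 (-x) (-t)
      - Complex.I * q x t * α 0 x t = 0 := by
  linear_combination (norm := skip) Complex.I * (h.space hL hz).2.1
  ring_nf
  simp only [Complex.I_sq]
  ring

/-- A combination of `offDiag₀` at the points `(x,t)` and `(-x,-t)`: since `M² = 1`, the lower
off-diagonal entries determine the diagonal ones. -/
theorem diag₁ (h : DarbouxCoeffs N S Φ Ω α β) (hL : LaxVector ρ q S Φ) (hz : (x, t) ∈ Ω) :
    (resD₁ (field N ρ q β) x t - resD₁ q x t) * α 0 x t
      + Complex.I * field N ρ q β x t * β 0 (-x) (-t)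
      - Complex.I * dualField q x t * β 0 x t = 0 := by
  have h1 := h.offDiag₀ hL hz
  have h2 := h.offDiag₀ hL (h.mem_neg hz)
  rw [neg_apply_dualField (field N ρ q β), neg_apply_dualField q, neg_neg, neg_neg] at h2
  simp only [resD₁]
  linear_combination (norm := skip) Complex.I / 2 * field N ρ q β x t * h2
    - Complex.I / 2 * dualField q x t * h1
  ring_nf
  simp only [Complex.I_sq]
  ring

/-- The `x`-derivative of `offDiag₀`, simplified by the lower coefficients. -/
theorem offDiag₁ (h : DarbouxCoeffs N S Φ Ω α β) (hL : LaxVector ρ q S Φ)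
    (hq : SmoothOn Set.univ q) (hz : (x, t) ∈ Ω) :
    2 * β 1 x t + (resD₁ (field N ρ q β) x t + resD₁ q x t) * β 0 x t
      + Complex.I * field N ρ q β x t * α 1 (-x) (-t)
      + resN₁ ρ (field N ρ q β) x t * α 0 (-x) (-t)
      - Complex.I * q x t * α 1 x t - resN₁ ρ q x t * α 0 x t = 0 := by
  set Q := field N ρ q β with hQ
  have hα := h.hasDerivAt_α hL hz 0
  have hα' := h.hasDerivAt_α_neg hL hz 0
  have hβ := h.hasDerivAt_β hL hz 0
  have hQx := (h.smooth_field (ρ := ρ) hq).hasDerivAt_dx h.isOpen hz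
  have hqx := hq.hasDerivAt_dx isOpen_univ (Set.mem_univ (x, t))
  have hd := ((hβ.const_mul 2).add ((hQx.const_mul Complex.I).mul hα')).sub
    ((hqx.const_mul Complex.I).mul hα)
  have hd0 := hd.unique ((hasDerivAt_const x 0).congr_of_eventuallyEq
    ((eventually_dx_slice h.isOpen hz).mono fun y hy => h.offDiag₀ hL hy))
  have h0 := h.offDiag₀ hL hz
  have h1 := h.diag₁ hL hz
  have h1' := h.diag₁ hL (h.mem_neg hz)
  rw [refl_resD₁, refl_resD₁, neg_apply_dualField (field N ρ q β), dualField_neg_apply q,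
    neg_neg, neg_neg] at h1'
  rw [← hQ] at h0 h1 h1' hd0
  simp only [resN₁]
  simp only [resD₁] at h1 h1' ⊢
  linear_combination (norm := skip) Complex.I / 2 * hd0 + ρ * h0
    + Complex.I / 2 * Q x t * h1' + Complex.I / 2 * q x t * h1
    + (Q x t * dualField Q x t + q x t * dualField q x t) / 4 * h0
  ring_nf
  simp only [Complex.I_sq]
  ring

/-- A combination of the off-diagonal coefficients at the points `(x,t)` and `(-x,-t)`, as for
`diag₁`. -/
theorem diag₂ (h : DarbouxCoeffs N S Φ Ω α β) (hL : LaxVector ρ q S Φ)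
    (hq : SmoothOn Set.univ q) (hz : (x, t) ∈ Ω) :
    (resD₁ (field N ρ q β) x t - resD₁ q x t) * α 1 x t
      + (resD₂ ρ (field N ρ q β) x t - resD₂ ρ q x t) * α 0 x t
      + Complex.I * field N ρ q β x t * β 1 (-x) (-t)
      + resN₁ ρ (field N ρ q β) x t * β 0 (-x) (-t)
      - Complex.I * dualField q x t * β 1 x t - resO₁ ρ q x t * β 0 x t = 0 := by
  have h0 := h.offDiag₀ hL hz
  have h0' := h.offDiag₀ hL (h.mem_neg hz)
  have h1 := h.diag₁ hL hz
  have h2 := h.offDiag₁ hL hq hz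
  have h2' := h.offDiag₁ hL hq (h.mem_neg hz)
  rw [refl_resD₁, refl_resD₁] at h2'
  have e1 : ∀ f, resN₁ ρ f (-x) (-t) = -resO₁ ρ f x t := fun f => by simp [resO₁, refl]
  rw [e1, e1] at h2'
  rw [neg_apply_dualField (field N ρ q β), neg_apply_dualField q, neg_neg, neg_neg] at h0' h2'
  set Q := field N ρ q β with hQ
  simp only [resD₂]
  simp only [resD₁] at *
  linear_combination (norm := skip) -(Q x t * dualField Q x t / 2 + q x t * dualField q x t / 2)
      / 2 * h1 + Complex.I / 2 * Q x t * h2' + resN₁ ρ Q x t / 2 * h0'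
    - Complex.I / 2 * dualField q x t * h2 - resO₁ ρ q x t / 2 * h0
  ring_nf
  simp only [Complex.I_sq]
  ring

/-- The `x`-derivative of `offDiag₁`, simplified by the lower coefficients. -/
theorem offDiag₂ (h : DarbouxCoeffs N S Φ Ω α β) (hL : LaxVector ρ q S Φ)
    (hq : SmoothOn Set.univ q) (hz : (x, t) ∈ Ω) :
    2 * β 2 x t + (resD₁ (field N ρ q β) x t + resD₁ q x t) * β 1 x t
      + (resD₂ ρ (field N ρ q β) x t + resD₂ ρ q x t) * β 0 x t
      + Complex.I * field N ρ q β x t * α 2 (-x) (-t)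
      + resN₁ ρ (field N ρ q β) x t * α 1 (-x) (-t)
      + resN₂ ρ (field N ρ q β) x t * α 0 (-x) (-t)
      - Complex.I * q x t * α 2 x t - resN₁ ρ q x t * α 1 x t - resN₂ ρ q x t * α 0 x t = 0 := by
  set Q := field N ρ q β with hQ
  have hsQ : SmoothOn Ω Q := h.smooth_field hq
  have hu : ∀ z ∈ (Set.univ : Set (ℝ × ℝ)), -z ∈ Set.univ := fun _ _ => Set.mem_univ _
  have hm : (x, t) ∈ Set.univ := Set.mem_univ _
  have hα0 := h.hasDerivAt_α hL hz 0
  have hα0' := h.hasDerivAt_α_neg hL hz 0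
  have hα1 := h.hasDerivAt_α hL hz 1
  have hα1' := h.hasDerivAt_α_neg hL hz 1
  have hβ0 := h.hasDerivAt_β hL hz 0
  have hβ1 := h.hasDerivAt_β hL hz 1
  have hQx := hsQ.hasDerivAt_dx h.isOpen hz
  have hqx := hq.hasDerivAt_dx isOpen_univ hm
  have hRx := (hsQ.dualField h.symm).hasDerivAt_dx h.isOpen hz
  have hrx := (hq.dualField hu).hasDerivAt_dx isOpen_univ hm
  rw [dx_dualField] at hRx hrx
  have hN := (hsQ.resN₁ (ρ := ρ) h.isOpen h.symm).hasDerivAt_dx h.isOpen hz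
  have hn := (hq.resN₁ (ρ := ρ) isOpen_univ hu).hasDerivAt_dx isOpen_univ hm
  have hD : HasDerivAt (fun y => resD₁ Q y t)
      (Q x t * resO₁ ρ Q x t - resN₁ ρ Q x t * dualField Q x t) x := by
    refine ((hQx.mul hRx).div_const 2).congr_deriv ?_
    rw [resO₁_eq]
    simp only [resN₁]
    ring_nf
    simp only [Complex.I_sq]
    ring
  have hd : HasDerivAt (fun y => resD₁ q y t)
      (q x t * resO₁ ρ q x t - resN₁ ρ q x t * dualField q x t) x := by
    refine ((hqx.mul hrx).div_const 2).congr_deriv ?_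
    rw [resO₁_eq]
    simp only [resN₁]
    ring_nf
    simp only [Complex.I_sq]
    ring
  have hd0 := (((((hβ1.const_mul 2).add ((hD.add hd).mul hβ0)).add
    ((hQx.const_mul Complex.I).mul hα1')).add (hN.mul hα0')).sub
    ((hqx.const_mul Complex.I).mul hα1)).sub (hn.mul hα0)
  have hd1 := hd0.unique ((hasDerivAt_const x 0).congr_of_eventuallyEq
    ((eventually_dx_slice h.isOpen hz).mono fun y hy => h.offDiag₁ hL hq hy))
  have h0 := h.offDiag₀ hL hz
  have h1 := h.offDiag₁ hL hq hz
  have h2 := h.diag₂ hL hq hz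
  have h2' := h.diag₂ hL hq (h.mem_neg hz)
  have e1 : ∀ f, resN₁ ρ f (-x) (-t) = -resO₁ ρ f x t := fun f => by simp [resO₁, refl]
  have e2 : ∀ f, resO₁ ρ f (-x) (-t) = -resN₁ ρ f x t := fun f => by simp [resO₁, refl]
  rw [refl_resD₁, refl_resD₁, refl_resD₂, refl_resD₂, e1, e2,
    neg_apply_dualField (field N ρ q β), dualField_neg_apply q, neg_neg, neg_neg] at h2'
  have en : ∀ f, dx (resN₁ ρ f) x t = -2 * Complex.I * resN₂ ρ f x t
      + 2 * Complex.I * ρ * resN₁ ρ f x t - 2 * f x t * resD₂ ρ f x t := fun f => by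
    simp only [resN₂]
    ring_nf
    simp only [Complex.I_sq, Complex.I_pow_three]
    ring
  rw [← hQ] at h0 h1 h2 h2' hd1
  rw [en, en] at hd1
  simp only [Pi.add_apply] at hd1
  linear_combination (norm := skip) Complex.I / 2 * hd1 + ρ * h1
    + Complex.I / 2 * Q x t * h2' + Complex.I / 2 * q x t * h2
    + (resD₂ ρ Q x t + resD₂ ρ q x t) / 2 * h0
  simp only [resN₁, resD₁]
  ring_nf
  simp only [Complex.I_sq, Complex.I_pow_three, Complex.I_pow_four]
  ring

end DarbouxCoeffs

end Darboux

end

/-! ### The time part and the dressed field -/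

section

open Polynomial Matrix

section Darboux

variable {ι : Type*} [Fintype ι] [DecidableEq ι]
variable {N : ℕ} {S : Matrix ι ι ℂ} {ρ : ℝ} {q : ℝ → ℝ → ℂ} {Φ : ℝ → ℝ → ι → ℂ}
  {Ω : Set (ℝ × ℝ)} {α β : ℕ → ℝ → ℝ → ℂ} {x t : ℝ}

/-- A polynomial with vanishing coefficients up to degree `2` and from degree `N + 3` on. -/
theorem exists_eq_X_pow_three_mul {K : ℂ[X]} {N : ℕ} (h0 : K.coeff 0 = 0) (h1 : K.coeff 1 = 0)
    (h2 : K.coeff 2 = 0) (hN : ∀ m, N ≤ m → K.coeff (m + 3) = 0) :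
    ∃ k : ℂ[X], K = X ^ 3 * k ∧ k.degree < N := by
  obtain ⟨k, hk⟩ := X_pow_dvd_iff.2 (fun d hd => by
    interval_cases d <;> assumption : ∀ d < 3, K.coeff d = 0)
  refine ⟨k, hk, (degree_lt_iff_coeff_zero _ _).2 fun m hm => ?_⟩
  rw [← hN m hm, hk, coeff_X_pow_mul]

namespace DarbouxCoeffs

/-- The time evolution of the coefficient that enters the dressed field. The difference of the
two sides of `T_t + TV = ṼT` is a combination covered by uniqueness: its low order coefficients
vanish because the Darboux matrix intertwines the matrices `M` of `q` and of the new field. -/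
theorem dt_β_top (h : DarbouxCoeffs N S Φ Ω α β) (hL : LaxVector ρ q S Φ)
    (hq : SmoothOn Set.univ q) (hz : (x, t) ∈ Ω) :
    dt (β (N - 1)) x t = flux ρ (field N ρ q β) x t - flux ρ q x t
      - 8 * Complex.I * ρ ^ 2 * β (N - 1) x t := by
  have hN := h.one_le
  set Q := field N ρ q β with hQ
  set d1 : ℂ := -4 * Complex.I * resD₁ q x t + 8 * Complex.I * ρ with hd1
  set d2 : ℂ := -4 * Complex.I * resD₂ ρ q x t + 8 * Complex.I * ρ * resD₁ q x t with hd2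
  set D1 : ℂ := -4 * Complex.I * resD₁ Q x t + 8 * Complex.I * ρ with hD1
  set D2 : ℂ := -4 * Complex.I * resD₂ ρ Q x t + 8 * Complex.I * ρ * resD₁ Q x t with hD2
  set n1 : ℂ := -4 * Complex.I * resN₁ ρ q x t - 8 * ρ * q x t with hn1
  set N1 : ℂ := -4 * Complex.I * resN₁ ρ Q x t - 8 * ρ * Q x t with hN1
  set o1 : ℂ := -4 * Complex.I * resO₁ ρ q x t - 8 * ρ * dualField q x t with ho1
  set n2 : ℂ := flux ρ q x t with hn2
  set N2 : ℂ := flux ρ Q x t with hN2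
  set o2 : ℂ := -refl (flux ρ q) x t with ho2
  set p := polyOf (N + 1) fun k => α k x t with hp
  set s := polyOf N fun k => β k x t with hs
  set p' := polyOf (N + 1) fun k => α k (-x) (-t) with hp'
  set s' := polyOf N fun k => β k (-x) (-t) with hs'
  set pt := polyOf (N + 1) fun k => dt (α k) x t with hpt
  set st := polyOf N fun k => dt (β k) x t with hst
  set v : ℂ := -4 * Complex.I * ρ ^ 2 with hv
  have hres := by
    let _ := sqModule S
    exact time_residual (R := ℂ[X]) (M := ι → ℂ)
      (vd' := C (-4 * Complex.I) + C D1 * X + C D2 * X ^ 2)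
      (vn' := C (4 * Q x t) + C N1 * X + C N2 * X ^ 2) (hL.act_t x t) (hL.act_dual_t x t)
      (h.rel x t hz) (h.rel_dual hz) (h.rel_dt hL hz)
  set K₁ := X ^ 3 * pt + (C (-4 * Complex.I) + C d1 * X + C d2 * X ^ 2
      - (C (-4 * Complex.I) + C D1 * X + C D2 * X ^ 2)) * p
      + X * (s * (C (4 * dualField q x t) + C o1 * X + C o2 * X ^ 2)
        - (C (4 * Q x t) + C N1 * X + C N2 * X ^ 2) * s') with hK₁
  set K₂ := X ^ 3 * st + p * (C (4 * q x t) + C n1 * X + C n2 * X ^ 2)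
      - s * (C (-4 * Complex.I) + C d1 * X + C d2 * X ^ 2
        + (C (-4 * Complex.I) + C D1 * X + C D2 * X ^ 2)) - 2 * C v * (X ^ 3 * s)
      - (C (4 * Q x t) + C N1 * X + C N2 * X ^ 2) * p' with hK₂
  clear_value d1 d2 D1 D2 n1 N1 o1 n2 N2 o2
  have e₁ : K₁ = X ^ 3 * pt + X * (C (d1 - D1) * p) + X ^ 2 * (C (d2 - D2) * p)
      + X * (C (4 * dualField q x t) * s) + X ^ 2 * (C o1 * s) + X ^ 3 * (C o2 * s)
      - X * (C (4 * Q x t) * s') - X ^ 2 * (C N1 * s') - X ^ 3 * (C N2 * s') := by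
    rw [hK₁, C_sub, C_sub]; ring
  have e₂ : K₂ = X ^ 3 * st + C (4 * q x t) * p + X * (C n1 * p) + X ^ 2 * (C n2 * p)
      - C (-8 * Complex.I) * s - X * (C (d1 + D1) * s) - X ^ 2 * (C (d2 + D2) * s)
      - X ^ 3 * (C (2 * v) * s) - C (4 * Q x t) * p' - X * (C N1 * p') - X ^ 2 * (C N2 * p') := by
    rw [hK₂, C_add, C_add, show (-8 * Complex.I : ℂ) = -4 * Complex.I + -4 * Complex.I by ring,
      C_add, C_mul (a := 2), show (C 2 : ℂ[X]) = 2 from rfl]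
    ring
  -- the coefficients of `λ⁰`, `λ²`, `λ⁴` in both entries are combinations of these identities
  have z0 := h.offDiag₀ hL hz
  have z1 := h.diag₁ hL hz
  have z2 := h.offDiag₁ hL hq hz
  have z3 := h.diag₂ hL hq hz
  have z4 := h.offDiag₂ hL hq hz
  rw [← hQ] at z0 z1 z2 z3 z4
  have c0 : ∀ P : ℂ[X], (X * P).coeff 0 = 0 := fun P => by simp
  have c1 : ∀ (P : ℂ[X]) m, (X * P).coeff (m + 1) = P.coeff m := fun P m => coeff_X_mul P m
  obtain ⟨k₁, hk₁, hdeg₁⟩ := exists_eq_X_pow_three_mul (K := K₁) (N := N)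
    (by rw [e₁]; simp only [pow_succ, pow_zero, one_mul, mul_assoc, coeff_add, coeff_sub, c0]; ring)
    (by
      rw [e₁]
      simp only [pow_succ, pow_zero, one_mul, mul_assoc, coeff_add, coeff_sub, c0, c1 _ 0,
        coeff_C_mul, hp, hs, hs', h.coeff_α, h.coeff_β, hd1, hD1]
      linear_combination (norm := skip) 4 * Complex.I * z1
      ring_nf
      simp only [Complex.I_sq]
      ring)
    (by
      rw [e₁]
      simp only [pow_succ, pow_zero, one_mul, mul_assoc, coeff_add, coeff_sub, c0, c1 _ 0, c1 _ 1,
        coeff_C_mul, hp, hs, hs', h.coeff_α, h.coeff_β, hd1, hD1, hd2, hD2, ho1, hN1]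
      linear_combination (norm := skip) 4 * Complex.I * z3 - 8 * Complex.I * ρ * z1
      ring_nf
      simp only [Complex.I_sq]
      ring)
    (fun m hm => by
      rw [e₁]
      simp only [pow_succ, pow_zero, one_mul, mul_assoc, coeff_add, coeff_sub, c1,
        coeff_C_mul, hp, hs, hs', hpt, h.coeff_α, h.coeff_β, h.coeff_dtα]
      rw [h.dt_α_zero hm, h.α_zero (m + 1) (by omega), h.α_zero (m + 2) (by omega),
        h.β_zero m hm, h.β_zero (m + 1) (by omega), h.β_zero (m + 2) (by omega)]
      ring)
  obtain ⟨k₂, hk₂, hdeg₂⟩ := exists_eq_X_pow_three_mul (K := K₂) (N := N)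
    (by
      rw [e₂]
      simp only [pow_succ, pow_zero, one_mul, mul_assoc, coeff_add, coeff_sub, c0,
        coeff_C_mul, hp, hs, hp', h.coeff_α, h.coeff_β]
      linear_combination (norm := skip) 4 * Complex.I * z0
      ring_nf
      simp only [Complex.I_sq]
      ring)
    (by
      rw [e₂]
      simp only [pow_succ, pow_zero, one_mul, mul_assoc, coeff_add, coeff_sub, c0, c1 _ 0,
        coeff_C_mul, hp, hs, hp', h.coeff_α, h.coeff_β, hd1, hD1, hn1, hN1]
      linear_combination (norm := skip) 4 * Complex.I * z2 - 8 * Complex.I * ρ * z0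
      ring_nf
      simp only [Complex.I_sq]
      ring)
    (by
      rw [e₂]
      simp only [pow_succ, pow_zero, one_mul, mul_assoc, coeff_add, coeff_sub, c0, c1 _ 0, c1 _ 1,
        coeff_C_mul, hp, hs, hp', h.coeff_α, h.coeff_β, hd1, hD1, hd2, hD2, hn1, hN1, hn2, hN2,
        flux]
      linear_combination (norm := skip) 4 * Complex.I * z4 - 8 * Complex.I * ρ * z2
      ring_nf
      simp only [Complex.I_sq]
      ring)
    (fun m hm => by
      rw [e₂]
      simp only [pow_succ, pow_zero, one_mul, mul_assoc, coeff_add, coeff_sub, c1,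
        coeff_C_mul, hp, hs, hp', hst, h.coeff_α, h.coeff_β, h.coeff_dtβ]
      rw [h.dt_β_zero hm, h.α_zero (m + 1) (by omega), h.α_zero (m + 2) (by omega),
        h.α_zero (m + 3) (by omega),
        h.β_zero m hm, h.β_zero (m + 1) (by omega), h.β_zero (m + 2) (by omega),
        h.β_zero (m + 3) (by omega)]
      ring)
  have hinj : Function.Injective (S ^ 6 *ᵥ ·) :=
    Matrix.mulVec_injective_of_isUnit (((Matrix.isUnit_iff_isUnit_det S).2 h.det).pow 6)
  have hzero : act S k₁ (Φ x t) + act S k₂ (S *ᵥ Φ (-x) (-t)) = 0 := by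
    apply hinj
    simp only [Matrix.mulVec_add, Matrix.mulVec_zero]
    rw [show 6 = 2 * 3 from rfl, ← act_X_pow, ← act_X_pow, ← act_mul, ← act_mul, ← hk₁, ← hk₂]
    exact hres
  obtain ⟨-, hk0⟩ := h.indep x t hz k₁ k₂ hdeg₁ hdeg₂ hzero
  -- the evolution of `β (N - 1)` is the coefficient of `K₂` of order `N + 2`, which vanishes since
  -- `k₂ = 0`
  have htop : K₂.coeff (N - 1 + 3) = 0 := by rw [hk₂, hk0, mul_zero, coeff_zero]
  rw [e₂] at htop
  simp only [pow_succ, pow_zero, one_mul, mul_assoc, coeff_add, coeff_sub, c1,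
    coeff_C_mul, hp, hs, hp', hst, h.coeff_α, h.coeff_β, h.coeff_dtβ] at htop
  rw [show N - 1 + 1 = N by omega, show N - 1 + 2 = N + 1 by omega,
    show N - 1 + 3 = N + 2 by omega, h.α_top, h.α_zero (N + 1) (by omega),
    h.α_zero (N + 2) (by omega), h.β_zero N le_rfl, h.β_zero (N + 1) (by omega),
    h.β_zero (N + 2) (by omega)] at htop
  rw [hv] at htop
  linear_combination htop

/-- The dressed field solves the equation. -/
theorem isSolutionOn (h : DarbouxCoeffs N S Φ Ω α β) (hL : LaxVector ρ q S Φ)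
    (hq : IsSolutionOn ρ Set.univ q) : IsSolutionOn ρ Ω (field N ρ q β) := by
  obtain ⟨-, -, hqs, hqe⟩ := hq
  have hqs : SmoothOn Set.univ q := hqs
  have hu : ∀ z ∈ (Set.univ : Set (ℝ × ℝ)), -z ∈ Set.univ := fun _ _ => Set.mem_univ _
  have hsQ : SmoothOn Ω (field N ρ q β) := h.smooth_field hqs
  refine ⟨h.isOpen, h.symm, hsQ, ?_⟩
  rintro ⟨x, t⟩ hz
  have hm : (x, t) ∈ Set.univ := Set.mem_univ _
  have e0 := hqe (x, t) hm
  simp only [equationLHS_eq isOpen_univ hu hqs hm, mul_eq_zero, Complex.I_ne_zero,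
    false_or] at e0
  simp only [equationLHS_eq h.isOpen h.symm hsQ hz, mul_eq_zero, Complex.I_ne_zero, false_or]
  have hA := h.smooth_β (N - 1)
  have hAt := hA.hasDerivAt_dt h.isOpen hz
  have hAx := hA.hasDerivAt_dx h.isOpen hz
  have hAxt := (hA.dx h.isOpen).hasDerivAt_dt h.isOpen hz
  have hqt := hqs.hasDerivAt_dt isOpen_univ hm
  have e1 : dt (field N ρ q β) x t = _ :=
    ((hqt.sub (hAt.const_mul (2 * Complex.I * ρ))).add hAxt).deriv
  have e2 := h.dt_β_top hL hqs hz
  have e3 : dx (dt (β (N - 1))) x t = _ := (dx_congr h.isOpen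
    (fun x t hz => h.dt_β_top hL hqs hz) hz).trans
    ((((hsQ.flux (ρ := ρ) h.isOpen h.symm).hasDerivAt_dx h.isOpen hz).sub
      ((hqs.flux (ρ := ρ) isOpen_univ hu).hasDerivAt_dx isOpen_univ hm)).sub
      (hAx.const_mul (8 * Complex.I * ρ ^ 2))).deriv
  rw [dx_dt_comm hA h.isOpen hz] at e3
  rw [e1, e3, e2]
  have e4 : field N ρ q β x t
      = q x t - 2 * Complex.I * ρ * β (N - 1) x t + dx (β (N - 1)) x t := rfl
  rw [e4]
  linear_combination e0

end DarbouxCoeffs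

theorem matrixRow_zero (S : Matrix ι ι ℂ) (i : ι) (k : ℕ) :
    matrixRow S Φ x t i 0 (2 * k) = act S (X ^ k) (Φ x t) i := by
  rw [act_X_pow]; rfl

theorem matrixRow_one (S : Matrix ι ι ℂ) (i : ι) (k : ℕ) :
    matrixRow S Φ x t i 1 (2 * k + 1) = act S (X ^ k) (S *ᵥ Φ (-x) (-t)) i := by
  rw [act_X_pow, Matrix.mulVec_mulVec, ← pow_succ]; rfl

theorem act_polyOf_apply (S : Matrix ι ι ℂ) (n : ℕ) (u : ℕ → ℂ) (v : ι → ℂ) (i : ι) :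
    act S (polyOf n u) v i = ∑ k ∈ Finset.range n, u k * act S (X ^ k) v i := by
  simp [act_polyOf, act_X_pow, Finset.sum_apply]

theorem polyOf_coeff {P : ℂ[X]} {N : ℕ} (hP : P.degree < N) : polyOf N P.coeff = P := by
  ext m
  exact coeff_polyOf (fun k hk => (degree_lt_iff_coeff_zero _ _).1 hP k hk) m

end Darboux

section Main

variable {N : ℕ} {S : Matrix (Fin (2 * N)) (Fin (2 * N)) ℂ} {ρ : ℝ} {q : ℝ → ℝ → ℂ}
  {Φ : ℝ → ℝ → Fin (2 * N) → ℂ}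

theorem LaxVector.smooth_matrixRow (hL : LaxVector ρ q S Φ) (i : Fin (2 * N)) (k : Fin 2)
    (m : ℕ) : SmoothOn Set.univ (fun x t => matrixRow S Φ x t i k m) := by
  have h0 : ∀ j, SmoothOn Set.univ (fun x t => ![Φ x t, Φ (-x) (-t)] k j) := fun j => by
    fin_cases k
    · exact hL.smooth j
    · exact (hL.smooth j).refl fun _ _ => Set.mem_univ _
  simp only [matrixRow, Matrix.mulVec, dotProduct]
  exact ContDiffOn.sum fun j _ => contDiffOn_const.mul (h0 j)

theorem regularSet_symm (D : ℝ → ℝ → ℂ) (z : ℝ × ℝ) (hz : z ∈ regularSet D) :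
    -z ∈ regularSet D := by
  obtain ⟨h1, h2⟩ := hz
  exact ⟨h2, by simpa using h1⟩

theorem isOpen_regularSet {D : ℝ → ℝ → ℂ} (hD : SmoothOn Set.univ D) :
    IsOpen (regularSet D) := by
  have hc : Continuous fun z : ℝ × ℝ => D z.1 z.2 :=
    (contDiffOn_univ.1 hD).continuous
  exact (isOpen_ne.preimage hc).inter (isOpen_ne.preimage (hc.comp continuous_neg))

/-- The `N`-fold Darboux transformation with a matrix spectral parameter. -/
theorem LaxVector.isSolutionOn (hN : 1 ≤ N) (hS : IsUnit S.det) (hL : LaxVector ρ q S Φ)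
    (hq : IsSolutionOn ρ Set.univ q) :
    IsSolutionOn ρ (regularSet fun x t => (denMatrix N (matrixRow S Φ x t)).det)
      (dressed ρ q fun x t => darbouxA N (matrixRow S Φ x t)) := by
  set Ω := regularSet fun x t => (denMatrix N (matrixRow S Φ x t)).det with hΩ
  have hdet : ∀ x t, (x, t) ∈ Ω → (denMatrix N (matrixRow S Φ x t)).det ≠ 0 :=
    fun x t hz => hz.1
  have hrow : ∀ i k m, SmoothOn Ω (fun x t => matrixRow S Φ x t i k m) := fun i k m =>
    ContDiffOn.mono (hL.smooth_matrixRow i k m) (Set.subset_univ _)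
  have hc : DarbouxCoeffs N S Φ Ω (fun k x t => darbouxP N (matrixRow S Φ x t) k)
      (fun k x t => darbouxS N (matrixRow S Φ x t) k) :=
    { one_le := hN
      det := hS
      isOpen := isOpen_regularSet
        (SmoothOn.det (SmoothOn.denMatrix fun i k m => hL.smooth_matrixRow i k m))
      symm := regularSet_symm _
      smooth_α := fun k => SmoothOn.darbouxP hrow hdet k
      smooth_β := fun k => SmoothOn.darbouxS hrow hdet k
      α_top := by simp [darbouxP]
      α_zero := fun k hk => by
        simp only [darbouxP, dif_neg (show ¬ k < N by omega), if_neg (show ¬ k = N by omega)]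
      β_zero := fun k hk => by simp only [darbouxS, dif_neg (show ¬ k < N by omega)]
      rel := fun x t hz => by
        ext i
        have := darboux_relation (hdet x t hz) i
        simp only [matrixRow_zero, matrixRow_one] at this
        rw [Pi.add_apply, act_polyOf_apply, act_polyOf_apply, this, Pi.zero_apply]
      indep := fun x t hz P Q hP hQ hPQ => by
        have h0 : ∀ i, ∑ k ∈ Finset.range N, (P.coeff k * matrixRow S Φ x t i 0 (2 * k)
            + Q.coeff k * matrixRow S Φ x t i 1 (2 * k + 1)) = 0 := fun i => by
          have := congrFun hPQ i
          rw [← polyOf_coeff hP, ← polyOf_coeff hQ, Pi.add_apply, act_polyOf_apply,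
            act_polyOf_apply, ← Finset.sum_add_distrib] at this
          simpa only [matrixRow_zero, matrixRow_one, Pi.zero_apply] using this
        have h1 : ∀ k, k < N → P.coeff k = 0 ∧ Q.coeff k = 0 := fun k hk =>
          eq_zero_of_denMatrix (hdet x t hz) h0 hk
        constructor
        · rw [← polyOf_coeff hP]
          exact Finset.sum_eq_zero fun k hk => by simp [(h1 k (Finset.mem_range.1 hk)).1]
        · rw [← polyOf_coeff hQ]
          exact Finset.sum_eq_zero fun k hk => by simp [(h1 k (Finset.mem_range.1 hk)).2] }
  have := hc.isSolutionOn hL hq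
  simpa only [DarbouxCoeffs.field, darbouxS_top hN] using this

end Main

end

/-! ### Taylor coefficients at the origin -/

/-- The `n`-th Taylor coefficient of `f` at the origin. -/
def taylorCoeff (f : ℂ → ℂ) (n : ℕ) : ℂ := iteratedDeriv n f 0 / (n.factorial : ℂ)

/-- The Taylor series of `f` at the origin. -/
def taylorSeries (f : ℂ → ℂ) : PowerSeries ℂ := PowerSeries.mk (taylorCoeff f)

section Taylor

variable {f g : ℂ → ℂ} {n : ℕ}

@[simp] theorem coeff_taylorSeries : PowerSeries.coeff n (taylorSeries f) = taylorCoeff f n :=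
  PowerSeries.coeff_mk _ _

theorem taylorCoeff_congr (h : f =ᶠ[𝓝 0] g) (n : ℕ) : taylorCoeff f n = taylorCoeff g n := by
  rw [taylorCoeff, taylorCoeff, h.iteratedDeriv_eq]

theorem taylorCoeff_zero (f : ℂ → ℂ) : taylorCoeff f 0 = f 0 := by simp [taylorCoeff]

theorem taylorCoeff_add (hf : AnalyticAt ℂ f 0) (hg : AnalyticAt ℂ g 0) (n : ℕ) :
    taylorCoeff (fun z => f z + g z) n = taylorCoeff f n + taylorCoeff g n := by
  rw [taylorCoeff, iteratedDeriv_fun_add hf.contDiffAt hg.contDiffAt, add_div]; rfl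

theorem taylorCoeff_const_mul (w : ℂ) (f : ℂ → ℂ) (n : ℕ) :
    taylorCoeff (fun z => w * f z) n = w * taylorCoeff f n := by
  rw [taylorCoeff, iteratedDeriv_const_mul_field, mul_div_assoc]; rfl

theorem taylorSeries_mul (hf : AnalyticAt ℂ f 0) (hg : AnalyticAt ℂ g 0) :
    taylorSeries (fun z => f z * g z) = taylorSeries f * taylorSeries g := by
  ext n
  rw [PowerSeries.coeff_mul, coeff_taylorSeries, taylorCoeff,
    iteratedDeriv_fun_mul hf.contDiffAt hg.contDiffAt,
    Finset.Nat.sum_antidiagonal_eq_sum_range_succ_mk, Finset.sum_div]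
  refine Finset.sum_congr rfl fun i hi => ?_
  have hi' : i ≤ n := Nat.lt_succ_iff.1 (Finset.mem_range.1 hi)
  simp only [coeff_taylorSeries, taylorCoeff]
  rw [Nat.cast_choose ℂ hi']
  have h1 : (n.factorial : ℂ) ≠ 0 := Nat.cast_ne_zero.2 n.factorial_ne_zero
  field_simp

theorem taylorSeries_id : taylorSeries (fun z => z) = PowerSeries.X := by
  ext n
  rw [coeff_taylorSeries, taylorCoeff, PowerSeries.coeff_X]
  rcases n with _ | _ | n
  · simp
  · simp [iteratedDeriv_one]
  · have : iteratedDeriv (n + 1 + 1) (fun z : ℂ => z) = 0 := by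
      rw [iteratedDeriv_succ', iteratedDeriv_succ']
      funext z
      simp
    simp [this]

theorem taylorSeries_pow (hf : AnalyticAt ℂ f 0) (n : ℕ) :
    taylorSeries (fun z => f z ^ n) = taylorSeries f ^ n := by
  induction n with
  | zero =>
    ext m
    rw [pow_zero, coeff_taylorSeries, PowerSeries.coeff_one]
    simp only [pow_zero, taylorCoeff, iteratedDeriv_const]
    by_cases hm : m = 0 <;> simp [hm]
  | succ n ih =>
    simp only [pow_succ]
    rw [taylorSeries_mul (hf.fun_pow n) hf, ih]

theorem taylorCoeff_pow_mul_of_lt (hg : AnalyticAt ℂ g 0) {m : ℕ} (h : n < m) :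
    taylorCoeff (fun z => z ^ m * g z) n = 0 := by
  have hid : AnalyticAt ℂ (fun z : ℂ => z) 0 := analyticAt_id
  rw [← coeff_taylorSeries, taylorSeries_mul (hid.fun_pow m) hg, taylorSeries_pow hid,
    taylorSeries_id, PowerSeries.coeff_X_pow_mul', if_neg (not_le.2 h)]

theorem taylorCoeff_pow_mul_add (hg : AnalyticAt ℂ g 0) (m n : ℕ) :
    taylorCoeff (fun z => z ^ m * g z) (n + m) = taylorCoeff g n := by
  have hid : AnalyticAt ℂ (fun z : ℂ => z) 0 := analyticAt_id
  rw [← coeff_taylorSeries, taylorSeries_mul (hid.fun_pow m) hg, taylorSeries_pow hid,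
    taylorSeries_id, PowerSeries.coeff_X_pow_mul, coeff_taylorSeries]

theorem exists_eq_mul_of_zero (hf : AnalyticAt ℂ f 0) (h0 : f 0 = 0) :
    ∃ g, AnalyticAt ℂ g 0 ∧ ∀ z, f z = z * g z := by
  obtain ⟨g, hg, h⟩ := hf.exists_eq_sum_add_pow_mul 1
  exact ⟨g, hg, fun z => by simpa [h0] using h z⟩

/-- A product with a sufficiently high power of a function that vanishes at the origin does not
contribute to a Taylor coefficient. -/
theorem taylorCoeff_pow_mul_of_zero (hf : AnalyticAt ℂ f 0) (h0 : f 0 = 0)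
    (hg : AnalyticAt ℂ g 0) {m : ℕ} (h : n < m) : taylorCoeff (fun z => f z ^ m * g z) n = 0 := by
  obtain ⟨k, hk, hfk⟩ := exists_eq_mul_of_zero hf h0
  have : (fun z => f z ^ m * g z) = fun z => z ^ m * (k z ^ m * g z) := by
    funext z; rw [hfk]; ring
  rw [this]
  exact taylorCoeff_pow_mul_of_lt ((hk.fun_pow m).mul hg) h

theorem taylorCoeff_sum {ι : Type*} (s : Finset ι) {F : ι → ℂ → ℂ}
    (hF : ∀ i ∈ s, AnalyticAt ℂ (F i) 0) (n : ℕ) :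
    taylorCoeff (fun z => ∑ i ∈ s, F i z) n = ∑ i ∈ s, taylorCoeff (F i) n := by
  classical
  induction s using Finset.induction_on with
  | empty => simp [taylorCoeff]
  | insert a s ha ih =>
    simp only [Finset.sum_insert ha]
    rw [taylorCoeff_add (hF a (Finset.mem_insert_self a s))
      (Finset.analyticAt_fun_sum _ fun i hi => hF i (Finset.mem_insert_of_mem hi)),
      ih fun i hi => hF i (Finset.mem_insert_of_mem hi)]

/-- The Taylor coefficients of `A e^{wg}` with `g(0) = 0` are polynomials in `w`. -/
theorem taylorCoeff_mul_exp {A g : ℂ → ℂ} (hA : AnalyticAt ℂ A 0) (hg : AnalyticAt ℂ g 0)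
    (h0 : g 0 = 0) (w : ℂ) (n : ℕ) :
    taylorCoeff (fun z => A z * Complex.exp (w * g z)) n
      = ∑ i ∈ Finset.range (n + 1), taylorCoeff (fun z => A z * g z ^ i) n / i.factorial * w ^ i := by
  have hexp0 : AnalyticAt ℂ (fun z : ℂ => Complex.exp z) 0 := analyticAt_cexp
  obtain ⟨F, hF, h⟩ := hexp0.exists_eq_sum_add_pow_mul (n + 1)
  have hexp : ∀ i, iteratedDeriv i (fun z : ℂ => Complex.exp z) 0 = 1 := fun i => by
    have := iteratedDeriv_cexp_const_mul i 1
    simpa using congrFun this 0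
  have hFg : AnalyticAt ℂ (fun z => F (w * g z)) 0 := by
    have h1 : AnalyticAt ℂ (fun z => w * g z) 0 := analyticAt_const.mul hg
    exact AnalyticAt.comp (g := F) (f := fun z => w * g z) (by simpa [h0] using hF) h1
  have e : (fun z => A z * Complex.exp (w * g z)) = fun z =>
      (∑ i ∈ Finset.range (n + 1), (w ^ i / i.factorial) * (A z * g z ^ i))
        + g z ^ (n + 1) * (w ^ (n + 1) * A z * F (w * g z)) := by
    funext z
    rw [h (w * g z), mul_add, Finset.mul_sum]
    congr 1
    · refine Finset.sum_congr rfl fun i _ => ?_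
      rw [hexp, smul_eq_mul]; ring
    · rw [smul_eq_mul]; ring
  have hterm : ∀ i ∈ Finset.range (n + 1),
      AnalyticAt ℂ (fun z => (w ^ i / (i.factorial : ℂ)) * (A z * g z ^ i)) 0 := fun i _ =>
    analyticAt_const.mul (hA.mul (hg.fun_pow i))
  have hrem : AnalyticAt ℂ (fun z => w ^ (n + 1) * A z * F (w * g z)) 0 :=
    (analyticAt_const.mul hA).mul hFg
  have hrem' : AnalyticAt ℂ
      (fun z => g z ^ (n + 1) * (w ^ (n + 1) * A z * F (w * g z))) 0 := (hg.fun_pow _).mul hrem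
  rw [e, taylorCoeff_add (Finset.analyticAt_fun_sum _ hterm) hrem',
    taylorCoeff_pow_mul_of_zero hg h0 hrem (Nat.lt_succ_self n), add_zero,
    taylorCoeff_sum _ hterm]
  refine Finset.sum_congr rfl fun i _ => ?_
  rw [taylorCoeff_const_mul]; ring

/-- The polynomial in `(x,t)` that is the `n`-th Taylor coefficient of `A e^{xg₁+tg₂}` when
`g₁` and `g₂` vanish at the origin. -/
def expPoly (A g₁ g₂ : ℂ → ℂ) (n : ℕ) : MvPolynomial (Fin 2) ℂ :=
  ∑ i ∈ Finset.range (n + 1), ∑ j ∈ Finset.range (n + 1),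
    MvPolynomial.C (taylorCoeff (fun z => A z * g₁ z ^ i * g₂ z ^ j) n
      / (i.factorial * j.factorial)) * (MvPolynomial.X 0 ^ i * MvPolynomial.X 1 ^ j)

theorem eval_expPoly {A g₁ g₂ : ℂ → ℂ} (hA : AnalyticAt ℂ A 0) (hg₁ : AnalyticAt ℂ g₁ 0)
    (hg₂ : AnalyticAt ℂ g₂ 0) (h₁ : g₁ 0 = 0) (h₂ : g₂ 0 = 0) (x t : ℂ) (n : ℕ) :
    MvPolynomial.eval ![x, t] (expPoly A g₁ g₂ n)
      = taylorCoeff (fun z => A z * Complex.exp (x * g₁ z + t * g₂ z)) n := by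
  have e : (fun z => A z * Complex.exp (x * g₁ z + t * g₂ z))
      = fun z => (A z * Complex.exp (t * g₂ z)) * Complex.exp (x * g₁ z) := by
    funext z; rw [Complex.exp_add]; ring
  have hA' : AnalyticAt ℂ (fun z => A z * Complex.exp (t * g₂ z)) 0 :=
    hA.mul (analyticAt_const.mul hg₂).cexp
  rw [e, taylorCoeff_mul_exp hA' hg₁ h₁]
  simp only [expPoly, map_sum, map_mul, MvPolynomial.eval_C, map_pow, MvPolynomial.eval_X,
    Matrix.cons_val_zero, Matrix.cons_val_one]
  refine Finset.sum_congr rfl fun i _ => ?_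
  have e2 : (fun z => A z * Complex.exp (t * g₂ z) * g₁ z ^ i)
      = fun z => (A z * g₁ z ^ i) * Complex.exp (t * g₂ z) := by
    funext z; ring
  have hA2 : AnalyticAt ℂ (fun z => A z * g₁ z ^ i) 0 := hA.mul (hg₁.fun_pow i)
  rw [e2, taylorCoeff_mul_exp hA2 hg₂ h₂, Finset.sum_div, Finset.sum_mul]
  refine Finset.sum_congr rfl fun j _ => ?_
  field_simp

/-- Differentiation of polynomials along the first real variable. -/
theorem hasDerivAt_eval_fst (P : MvPolynomial (Fin 2) ℂ) (x t : ℝ) :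
    HasDerivAt (fun y : ℝ => MvPolynomial.eval ![(y : ℂ), (t : ℂ)] P)
      (MvPolynomial.eval ![(x : ℂ), (t : ℂ)] (MvPolynomial.pderiv 0 P)) x := by
  induction P using MvPolynomial.induction_on with
  | C a => simpa using hasDerivAt_const x a
  | add P Q hP hQ => simp only [map_add]; exact hP.add hQ
  | mul_X P i hP =>
    have hX : HasDerivAt (fun y : ℝ => ![(y : ℂ), (t : ℂ)] i)
        (MvPolynomial.eval ![(x : ℂ), (t : ℂ)] (MvPolynomial.pderiv 0 (MvPolynomial.X i))) x := by
      fin_cases i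
      · have := Complex.ofRealCLM.hasDerivAt (x := x)
        simp only [Fin.zero_eta, MvPolynomial.pderiv_X_self, map_one]
        exact this
      · simpa [MvPolynomial.pderiv_X] using hasDerivAt_const x (t : ℂ)
    simp only [map_mul, MvPolynomial.eval_X, Derivation.leibniz, map_add, smul_eq_mul]
    refine (hP.mul hX).congr_deriv ?_
    ring

theorem smoothOn_eval (P : MvPolynomial (Fin 2) ℂ) (Ω : Set (ℝ × ℝ)) :
    SmoothOn Ω (fun x t => MvPolynomial.eval ![(x : ℂ), (t : ℂ)] P) := by
  induction P using MvPolynomial.induction_on with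
  | C a => simpa using SmoothOn.const a
  | add P Q hP hQ => simpa using hP.add hQ
  | mul_X P i hP =>
    have hX : SmoothOn Ω (fun x t : ℝ => ![(x : ℂ), (t : ℂ)] i) := by
      fin_cases i
      · exact (Complex.ofRealCLM.contDiff.comp contDiff_fst).contDiffOn
      · exact (Complex.ofRealCLM.contDiff.comp contDiff_snd).contDiffOn
    simpa using hP.mul hX

theorem pderiv_expPoly_fst {A g₁ g₂ : ℂ → ℂ} (hA : AnalyticAt ℂ A 0) (hg₁ : AnalyticAt ℂ g₁ 0)
    (hg₂ : AnalyticAt ℂ g₂ 0) (h₁ : g₁ 0 = 0) (n : ℕ) :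
    MvPolynomial.pderiv 0 (expPoly A g₁ g₂ n) = expPoly (fun z => A z * g₁ z) g₁ g₂ n := by
  simp only [expPoly, map_sum]
  refine (Finset.sum_range_succ' _ n).trans (Eq.trans ?_ (Finset.sum_range_succ _ n).symm)
  congr 1
  · refine Finset.sum_congr rfl fun i _ => Finset.sum_congr rfl fun j _ => ?_
    have e : ∀ z, A z * g₁ z ^ (i + 1) * g₂ z ^ j = A z * g₁ z * g₁ z ^ i * g₂ z ^ j :=
      fun z => by ring
    simp only [e, Derivation.leibniz, MvPolynomial.pderiv_C, Derivation.leibniz_pow,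
      MvPolynomial.pderiv_X_self, smul_eq_mul, nsmul_eq_mul]
    rw [MvPolynomial.pderiv_X_of_ne (by decide)]
    simp only [Nat.add_sub_cancel, mul_zero, add_zero, zero_add, mul_one]
    rw [Nat.factorial_succ]
    have hc : ((i + 1 : ℕ) : MvPolynomial (Fin 2) ℂ) = MvPolynomial.C ((i + 1 : ℕ) : ℂ) := by simp
    rw [hc]
    have h1 : ((i + 1 : ℕ) : ℂ) ≠ 0 := Nat.cast_ne_zero.2 (Nat.succ_ne_zero i)
    have h2 : (i.factorial : ℂ) ≠ 0 := Nat.cast_ne_zero.2 i.factorial_ne_zero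
    have h3 : (j.factorial : ℂ) ≠ 0 := Nat.cast_ne_zero.2 j.factorial_ne_zero
    have e3 : ∀ w : ℂ, w / (((i + 1) * i.factorial : ℕ) * (j.factorial : ℂ)) * ((i + 1 : ℕ) : ℂ)
        = w / (i.factorial * j.factorial) := fun w => by
      push_cast at h1 ⊢
      field_simp
    rw [← e3 (taylorCoeff _ n), MvPolynomial.C_mul]
    ring
  · have hL : ∑ j ∈ Finset.range (n + 1), MvPolynomial.pderiv (R := ℂ) (0 : Fin 2)
        (MvPolynomial.C (taylorCoeff (fun z => A z * g₁ z ^ 0 * g₂ z ^ j) n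
          / ((Nat.factorial 0 : ℂ) * j.factorial)) *
          ((MvPolynomial.X 0 : MvPolynomial (Fin 2) ℂ) ^ 0 * MvPolynomial.X 1 ^ j)) = 0 := by
      refine Finset.sum_eq_zero fun j _ => ?_
      simp only [pow_zero, one_mul, Derivation.leibniz, MvPolynomial.pderiv_C,
        Derivation.leibniz_pow]
      rw [MvPolynomial.pderiv_X_of_ne (by decide)]
      simp
    rw [hL]
    refine (Finset.sum_eq_zero fun j _ => ?_).symm
    have e : (fun z => A z * g₁ z * g₁ z ^ n * g₂ z ^ j)
        = fun z => g₁ z ^ (n + 1) * (A z * g₂ z ^ j) := by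
      funext z; ring
    have hAg : AnalyticAt ℂ (fun z => A z * g₂ z ^ j) 0 := hA.mul (hg₂.fun_pow j)
    rw [e, taylorCoeff_pow_mul_of_zero hg₁ h₁ hAg (Nat.lt_succ_self n)]
    simp

section ExpFamily

variable {A g₁ g₂ : ℂ → ℂ}

theorem analyticAt_mul_exp (hA : AnalyticAt ℂ A 0) (hg₁ : AnalyticAt ℂ g₁ 0)
    (hg₂ : AnalyticAt ℂ g₂ 0) (x t : ℂ) :
    AnalyticAt ℂ (fun z => A z * Complex.exp (x * g₁ z + t * g₂ z)) 0 :=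
  hA.mul ((analyticAt_const.mul hg₁).add (analyticAt_const.mul hg₂)).cexp

/-- The dependence of a Taylor coefficient of `A e^{xg₁+tg₂}` on `(x,t)`. -/
theorem taylorCoeff_exp_eq (hA : AnalyticAt ℂ A 0) (hg₁ : AnalyticAt ℂ g₁ 0)
    (hg₂ : AnalyticAt ℂ g₂ 0) (x t : ℂ) (n : ℕ) :
    taylorCoeff (fun z => A z * Complex.exp (x * g₁ z + t * g₂ z)) n
      = Complex.exp (x * g₁ 0 + t * g₂ 0) * MvPolynomial.eval ![x, t]
        (expPoly A (fun z => g₁ z - g₁ 0) (fun z => g₂ z - g₂ 0) n) := by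
  rw [eval_expPoly hA (hg₁.fun_sub analyticAt_const) (hg₂.fun_sub analyticAt_const)
    (sub_self _) (sub_self _), ← taylorCoeff_const_mul]
  congr 1
  funext z
  rw [mul_left_comm, ← Complex.exp_add]
  congr 2
  ring

theorem smoothOn_taylorCoeff_exp (hA : AnalyticAt ℂ A 0) (hg₁ : AnalyticAt ℂ g₁ 0)
    (hg₂ : AnalyticAt ℂ g₂ 0) (n : ℕ) (Ω : Set (ℝ × ℝ)) :
    SmoothOn Ω fun x t =>
      taylorCoeff (fun z => A z * Complex.exp ((x : ℂ) * g₁ z + (t : ℂ) * g₂ z)) n := by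
  simp only [taylorCoeff_exp_eq hA hg₁ hg₂]
  refine SmoothOn.mul ?_ (smoothOn_eval _ _)
  have h1 : ContDiff ℝ ∞ fun z : ℝ × ℝ => (z.1 : ℂ) := Complex.ofRealCLM.contDiff.comp contDiff_fst
  have h2 : ContDiff ℝ ∞ fun z : ℝ × ℝ => (z.2 : ℂ) := Complex.ofRealCLM.contDiff.comp contDiff_snd
  exact ((h1.mul contDiff_const).add (h2.mul contDiff_const)).cexp.contDiffOn

/-- Taking Taylor coefficients commutes with `∂_x`. -/
theorem hasDerivAt_taylorCoeff_exp_fst (hA : AnalyticAt ℂ A 0) (hg₁ : AnalyticAt ℂ g₁ 0)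
    (hg₂ : AnalyticAt ℂ g₂ 0) (n : ℕ) (x t : ℝ) :
    HasDerivAt (fun y : ℝ =>
        taylorCoeff (fun z => A z * Complex.exp ((y : ℂ) * g₁ z + (t : ℂ) * g₂ z)) n)
      (taylorCoeff (fun z => A z * g₁ z * Complex.exp ((x : ℂ) * g₁ z + (t : ℂ) * g₂ z)) n) x := by
  have hg₁' : AnalyticAt ℂ (fun z => g₁ z - g₁ 0) 0 := hg₁.fun_sub analyticAt_const
  have hg₂' : AnalyticAt ℂ (fun z => g₂ z - g₂ 0) 0 := hg₂.fun_sub analyticAt_const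
  have hAg : AnalyticAt ℂ (fun z => A z * (g₁ z - g₁ 0)) 0 := hA.mul hg₁'
  have h1 : HasDerivAt (fun y : ℝ => Complex.exp ((y : ℂ) * g₁ 0 + (t : ℂ) * g₂ 0))
      (Complex.exp ((x : ℂ) * g₁ 0 + (t : ℂ) * g₂ 0) * (1 * g₁ 0)) x :=
    (((Complex.ofRealCLM.hasDerivAt (x := x)).mul_const (g₁ 0)).add_const _).cexp
  have h2 := h1.mul (hasDerivAt_eval_fst
    (expPoly A (fun z => g₁ z - g₁ 0) (fun z => g₂ z - g₂ 0) n) x t)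
  rw [pderiv_expPoly_fst hA hg₁' hg₂' (sub_self _)] at h2
  have e : (fun z => A z * g₁ z * Complex.exp ((x : ℂ) * g₁ z + (t : ℂ) * g₂ z))
      = fun z => g₁ 0 * (A z * Complex.exp ((x : ℂ) * g₁ z + (t : ℂ) * g₂ z))
        + A z * (g₁ z - g₁ 0) * Complex.exp ((x : ℂ) * g₁ z + (t : ℂ) * g₂ z) := by
    funext z; ring
  have hE := analyticAt_mul_exp hA hg₁ hg₂ x t
  have hE' : AnalyticAt ℂ
      (fun z => g₁ 0 * (A z * Complex.exp ((x : ℂ) * g₁ z + (t : ℂ) * g₂ z))) 0 :=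
    analyticAt_const.mul hE
  rw [e, taylorCoeff_add hE' (analyticAt_mul_exp hAg hg₁ hg₂ x t), taylorCoeff_const_mul]
  simp only [taylorCoeff_exp_eq hA hg₁ hg₂, taylorCoeff_exp_eq hAg hg₁ hg₂]
  refine h2.congr_deriv ?_
  ring

/-- Taking Taylor coefficients commutes with `∂_t`. -/
theorem hasDerivAt_taylorCoeff_exp_snd (hA : AnalyticAt ℂ A 0) (hg₁ : AnalyticAt ℂ g₁ 0)
    (hg₂ : AnalyticAt ℂ g₂ 0) (n : ℕ) (x t : ℝ) :
    HasDerivAt (fun s : ℝ =>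
        taylorCoeff (fun z => A z * Complex.exp ((x : ℂ) * g₁ z + (s : ℂ) * g₂ z)) n)
      (taylorCoeff (fun z => A z * g₂ z * Complex.exp ((x : ℂ) * g₁ z + (t : ℂ) * g₂ z)) n) t := by
  have h := hasDerivAt_taylorCoeff_exp_fst hA hg₂ hg₁ n t x
  simpa only [add_comm] using h

end ExpFamily

end Taylor

/-! ### The plane wave seed -/

section Seed

variable {a b c ρ : ℝ} {x t : ℝ}

theorem smoothOn_seed (Ω : Set (ℝ × ℝ)) : SmoothOn Ω (seed a b c) := by
  have h1 : ContDiff ℝ ∞ fun z : ℝ × ℝ => (z.1 : ℂ) := Complex.ofRealCLM.contDiff.comp contDiff_fst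
  have h2 : ContDiff ℝ ∞ fun z : ℝ × ℝ => (z.2 : ℂ) := Complex.ofRealCLM.contDiff.comp contDiff_snd
  exact (contDiff_const.mul (contDiff_const.mul
    ((contDiff_const.mul h1).add (contDiff_const.mul h2))).cexp).contDiffOn

theorem hasDerivAt_seed_x (a b c x t : ℝ) :
    HasDerivAt (fun y => seed a b c y t) (Complex.I * a * seed a b c x t) x := by
  have h : HasDerivAt (fun y : ℝ => (y : ℂ)) 1 x := Complex.ofRealCLM.hasDerivAt
  refine ((((h.const_mul (a : ℂ)).add_const ((b : ℂ) * t)).const_mul Complex.I).cexp.const_mul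
    (c : ℂ)).congr_deriv ?_
  simp only [seed]; ring

theorem hasDerivAt_seed_t (a b c x t : ℝ) :
    HasDerivAt (fun s => seed a b c x s) (Complex.I * b * seed a b c x t) t := by
  have h : HasDerivAt (fun y : ℝ => (y : ℂ)) 1 t := Complex.ofRealCLM.hasDerivAt
  refine ((((h.const_mul (b : ℂ)).const_add ((a : ℂ) * x)).const_mul Complex.I).cexp.const_mul
    (c : ℂ)).congr_deriv ?_
  simp only [seed]; ring

theorem dx_seed : dx (seed a b c) = fun x t => Complex.I * a * seed a b c x t := by
  funext x t; exact (hasDerivAt_seed_x a b c x t).deriv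

theorem dt_seed : dt (seed a b c) = fun x t => Complex.I * b * seed a b c x t := by
  funext x t; exact (hasDerivAt_seed_t a b c x t).deriv

theorem dx_const_mul_seed (w : ℂ) :
    dx (fun x t => w * seed a b c x t) = fun x t => w * (Complex.I * a * seed a b c x t) := by
  funext x t; exact ((hasDerivAt_seed_x a b c x t).const_mul w).deriv

theorem seed_mul_refl : seed a b c x t * seed a b c (-x) (-t) = c ^ 2 := by
  simp only [seed]
  rw [mul_mul_mul_comm, ← Complex.exp_add]
  push_cast
  rw [show Complex.I * (a * x + b * t) + Complex.I * (a * -x + b * -t) = 0 by ring]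
  simp [sq]

/-- The ratio `n₁ / q` for the seed, with `n₁` as in `resN₁`. -/
def seedN₁ (a c ρ : ℝ) : ℂ := Complex.I / 2 * (2 * ρ - a - c ^ 2)

/-- The value for the seed of the coefficient `d₂` described at `resD₁`. -/
def seedD₂ (a c ρ : ℝ) : ℂ := -1 / 2 * (c ^ 4 / 4 - 2 * Complex.I * seedN₁ a c ρ * c ^ 2)

/-- The ratio `n₂ / q` for the seed, with `n₂` as in `resN₂`. -/
def seedN₂ (a c ρ : ℝ) : ℂ :=
  Complex.I / 2 * (Complex.I * a * seedN₁ a c ρ - 2 * Complex.I * ρ * seedN₁ a c ρ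
    + 2 * seedD₂ a c ρ)

theorem seed_mul_dualField : seed a b c x t * dualField (seed a b c) x t = -c ^ 2 := by
  simp only [dualField, refl]
  linear_combination -(seed_mul_refl (a := a) (b := b) (c := c) (x := x) (t := t))

theorem resD₁_seed : resD₁ (seed a b c) x t = -c ^ 2 / 2 := by
  simp only [resD₁, seed_mul_dualField]

theorem resN₁_seed : resN₁ ρ (seed a b c) = fun x t => seedN₁ a c ρ * seed a b c x t := by
  funext x t
  simp only [resN₁, dx_seed, seedN₁]
  linear_combination (Complex.I / 2 * seed a b c x t)
    * seed_mul_dualField (a := a) (b := b) (c := c) (x := x) (t := t)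
    + Complex.I / 2 * a * seed a b c x t * Complex.I_sq

theorem resD₂_seed : resD₂ ρ (seed a b c) x t = seedD₂ a c ρ := by
  have h := seed_mul_refl (a := a) (b := b) (c := c) (x := x) (t := t)
  simp only [resD₂, resO₁, resD₁_seed, resN₁_seed, seedD₂, dualField, refl]
  linear_combination Complex.I * seedN₁ a c ρ * h

theorem resN₂_seed : resN₂ ρ (seed a b c) = fun x t => seedN₂ a c ρ * seed a b c x t := by
  funext x t
  simp only [resN₂, resN₁_seed, resD₂_seed, dx_const_mul_seed, seedN₂]
  ring

/-- The ratio `flux / q` for the seed. -/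
def seedFlux (a c ρ : ℝ) : ℂ := -4 * Complex.I * seedN₂ a c ρ + 8 * Complex.I * ρ * seedN₁ a c ρ

theorem flux_seed : flux ρ (seed a b c) = fun x t => seedFlux a c ρ * seed a b c x t := by
  funext x t
  simp only [flux, resN₁_seed, resN₂_seed, seedFlux]
  ring

/-- The plane wave with the frequency `seedFrequency` solves the equation. -/
theorem isSolutionOn_seed (hb : b = seedFrequency a c ρ) :
    IsSolutionOn ρ Set.univ (seed a b c) := by
  refine ⟨isOpen_univ, fun z _ => Set.mem_univ _, smoothOn_seed _, fun z _ => ?_⟩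
  rw [equationLHS_eq isOpen_univ (fun z _ => Set.mem_univ _) (smoothOn_seed _) (Set.mem_univ _),
    flux_seed, dt_seed, dx_const_mul_seed]
  beta_reduce
  generalize seed a b c z.1 z.2 = s
  have h6 : Complex.I ^ 6 = -1 := by linear_combination Complex.I ^ 4 * Complex.I_sq - Complex.I_pow_four
  rw [hb]
  simp only [seedFlux, seedN₂, seedD₂, seedN₁, seedFrequency]
  push_cast
  ring_nf
  simp only [Complex.I_sq, Complex.I_pow_four, h6]
  ring

end Seed

/-! ### Taylor coefficients of eigenfunctions -/

/-- A germ at `z = 0` of an eigenfunction for the plane wave: `μ` is the spectral parameter, `h`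
the square root, and the first component is `e^{iθ/2} (U e^E + V e^{-E})`. The last two fields say
that `V / U` is the number `K₋` at `μ`, and `U / V` the number `K₊`. -/
structure EigenGerm (a c ρ : ℝ) where
  μ : ℂ → ℂ
  h : ℂ → ℂ
  U : ℂ → ℂ
  V : ℂ → ℂ
  μ_analytic : AnalyticAt ℂ μ 0
  h_analytic : AnalyticAt ℂ h 0
  U_analytic : AnalyticAt ℂ U 0
  V_analytic : AnalyticAt ℂ V 0
  μ_ne_zero : μ 0 ≠ 0
  rel_U : ∀ᶠ z in 𝓝 (0 : ℂ), 2 * c * μ z * V z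
    = U z * (2 * Complex.I + Complex.I * (a - 2 * ρ) * μ z ^ 2 - h z)
  rel_V : ∀ᶠ z in 𝓝 (0 : ℂ), 2 * c * μ z * U z
    = V z * (2 * Complex.I + Complex.I * (a - 2 * ρ) * μ z ^ 2 + h z)

namespace EigenGerm

variable {a b c ρ : ℝ} (G : EigenGerm a c ρ)

/-- The coefficient of `x` in the phase. -/
def vel (z : ℂ) : ℂ := -G.h z / (2 * G.μ z ^ 2)

/-- The coefficient of `t` in the phase. -/
def freq (z : ℂ) : ℂ :=
  1 / 4 * ((-3 * c ^ 4 - 6 * a * c ^ 2 + 4 * c ^ 2 * ρ - 2 * a ^ 2 + 8 * ρ ^ 2) * G.μ z ^ 4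
    + 4 * (c ^ 2 + a + 2 * ρ) * G.μ z ^ 2 - 8) * G.h z / G.μ z ^ 6

theorem vel_analytic : AnalyticAt ℂ G.vel 0 :=
  G.h_analytic.neg.div (analyticAt_const.mul (G.μ_analytic.pow 2))
    (mul_ne_zero two_ne_zero (pow_ne_zero 2 G.μ_ne_zero))

theorem freq_analytic : AnalyticAt ℂ G.freq 0 := by
  have h1 := G.μ_analytic
  have h2 := G.h_analytic
  have h3 : G.μ 0 ^ 6 ≠ 0 := pow_ne_zero 6 G.μ_ne_zero
  unfold freq
  fun_prop (disch := assumption)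

theorem phase_eq (z : ℂ) (hz : G.μ z ≠ 0) (x t : ℝ) :
    phase a c ρ (G.μ z) (G.h z) x t = x * G.vel z + t * G.freq z := by
  simp only [phase, vel, freq]
  field_simp
  ring

/-- The `n`-th Taylor coefficient of `A e^E`. -/
def plus (n : ℕ) (A : ℂ → ℂ) (x t : ℝ) : ℂ :=
  taylorCoeff (fun z => A z * Complex.exp (x * G.vel z + t * G.freq z)) n

/-- The `n`-th Taylor coefficient of `μ^m φ₁`. The exponential `e^{-E}` is `e^E` at `(-x,-t)`, hence the
arguments of the second term. -/
def coeff (b : ℝ) (n m : ℕ) (x t : ℝ) : ℂ :=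
  Complex.exp (1 / 2 * Complex.I * (a * x + b * t)) *
    (G.plus n (fun z => G.μ z ^ m * G.U z) x t
      + G.plus n (fun z => G.μ z ^ m * G.V z) (-x) (-t))

variable {n : ℕ} {A B : ℂ → ℂ} {x t : ℝ}

theorem plus_congr (h : A =ᶠ[𝓝 0] B) : G.plus n A x t = G.plus n B x t :=
  taylorCoeff_congr (h.mono fun z hz => by simp only [hz]) n

theorem plus_add (hA : AnalyticAt ℂ A 0) (hB : AnalyticAt ℂ B 0) :
    G.plus n (fun z => A z + B z) x t = G.plus n A x t + G.plus n B x t := by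
  simp only [plus, add_mul]
  exact taylorCoeff_add (analyticAt_mul_exp hA G.vel_analytic G.freq_analytic x t)
    (analyticAt_mul_exp hB G.vel_analytic G.freq_analytic x t) n

theorem plus_const_mul (w : ℂ) : G.plus n (fun z => w * A z) x t = w * G.plus n A x t := by
  simp only [plus, mul_assoc]
  exact taylorCoeff_const_mul _ _ _

theorem hasDerivAt_plus_x (hA : AnalyticAt ℂ A 0) :
    HasDerivAt (fun y => G.plus n A y t) (G.plus n (fun z => A z * G.vel z) x t) x :=
  hasDerivAt_taylorCoeff_exp_fst hA G.vel_analytic G.freq_analytic n x t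

theorem hasDerivAt_plus_t (hA : AnalyticAt ℂ A 0) :
    HasDerivAt (fun s => G.plus n A x s) (G.plus n (fun z => A z * G.freq z) x t) t :=
  hasDerivAt_taylorCoeff_exp_snd hA G.vel_analytic G.freq_analytic n x t

theorem smoothOn_plus (hA : AnalyticAt ℂ A 0) (Ω : Set (ℝ × ℝ)) : SmoothOn Ω (G.plus n A) :=
  smoothOn_taylorCoeff_exp hA G.vel_analytic G.freq_analytic n Ω

theorem pow_mul_U_analytic (m : ℕ) : AnalyticAt ℂ (fun z => G.μ z ^ m * G.U z) 0 :=
  (G.μ_analytic.fun_pow m).mul G.U_analytic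

theorem pow_mul_V_analytic (m : ℕ) : AnalyticAt ℂ (fun z => G.μ z ^ m * G.V z) 0 :=
  (G.μ_analytic.fun_pow m).mul G.V_analytic

theorem smoothOn_halfWave (a b : ℝ) (Ω : Set (ℝ × ℝ)) :
    SmoothOn Ω fun x t => Complex.exp (1 / 2 * Complex.I * (a * x + b * t)) := by
  have h1 : ContDiff ℝ ∞ fun z : ℝ × ℝ => (z.1 : ℂ) := Complex.ofRealCLM.contDiff.comp contDiff_fst
  have h2 : ContDiff ℝ ∞ fun z : ℝ × ℝ => (z.2 : ℂ) := Complex.ofRealCLM.contDiff.comp contDiff_snd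
  exact (contDiff_const.mul
    ((contDiff_const.mul h1).add (contDiff_const.mul h2))).cexp.contDiffOn

theorem smooth_coeff (b : ℝ) (n m : ℕ) : SmoothOn Set.univ (G.coeff b n m) := by
  refine (smoothOn_halfWave a b _).mul ((G.smoothOn_plus (G.pow_mul_U_analytic m) _).add ?_)
  exact (G.smoothOn_plus (G.pow_mul_V_analytic m) _).refl fun z _ => Set.mem_univ _

theorem hasDerivAt_coeff_x (b : ℝ) (n m : ℕ) (x t : ℝ) :
    HasDerivAt (fun y => G.coeff b n m y t)
      (Complex.exp (1 / 2 * Complex.I * (a * x + b * t)) *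
        (G.plus n (fun z => (Complex.I * a / 2 + G.vel z) * (G.μ z ^ m * G.U z)) x t
          + G.plus n (fun z => (Complex.I * a / 2 - G.vel z) * (G.μ z ^ m * G.V z)) (-x) (-t)))
      x := by
  have h : HasDerivAt (fun y : ℝ => (y : ℂ)) 1 x := Complex.ofRealCLM.hasDerivAt
  have hU := G.pow_mul_U_analytic m
  have hV := G.pow_mul_V_analytic m
  have hv := G.vel_analytic
  have h1 := (((h.const_mul (a : ℂ)).add_const ((b : ℂ) * t)).const_mul
    (1 / 2 * Complex.I)).cexp
  have h2 := G.hasDerivAt_plus_x (n := n) (x := x) (t := t) hU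
  have h3 := (G.hasDerivAt_plus_x (n := n) (x := -x) (t := -t) hV).scomp x (hasDerivAt_neg x)
  refine (h1.mul (h2.add h3)).congr_deriv ?_
  have e1 : G.plus n (fun z => (Complex.I * a / 2 + G.vel z) * (G.μ z ^ m * G.U z)) x t
      = Complex.I * a / 2 * G.plus n (fun z => G.μ z ^ m * G.U z) x t
        + G.plus n (fun z => G.μ z ^ m * G.U z * G.vel z) x t := by
    rw [← plus_const_mul, ← G.plus_add]
    · congr 1; funext z; ring
    · exact analyticAt_const.mul hU
    · exact hU.mul hv
  have e2 : G.plus n (fun z => (Complex.I * a / 2 - G.vel z) * (G.μ z ^ m * G.V z)) (-x) (-t)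
      = Complex.I * a / 2 * G.plus n (fun z => G.μ z ^ m * G.V z) (-x) (-t)
        + (-1) * G.plus n (fun z => G.μ z ^ m * G.V z * G.vel z) (-x) (-t) := by
    rw [← plus_const_mul, ← plus_const_mul, ← G.plus_add]
    · congr 1; funext z; ring
    · exact analyticAt_const.mul hV
    · exact analyticAt_const.mul (hV.mul hv)
  rw [e1, e2]
  simp only [Pi.add_apply, Function.comp_apply, neg_smul, one_smul]
  ring

theorem hasDerivAt_coeff_t (b : ℝ) (n m : ℕ) (x t : ℝ) :
    HasDerivAt (fun s => G.coeff b n m x s)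
      (Complex.exp (1 / 2 * Complex.I * (a * x + b * t)) *
        (G.plus n (fun z => (Complex.I * b / 2 + G.freq z) * (G.μ z ^ m * G.U z)) x t
          + G.plus n (fun z => (Complex.I * b / 2 - G.freq z) * (G.μ z ^ m * G.V z)) (-x) (-t)))
      t := by
  have h : HasDerivAt (fun y : ℝ => (y : ℂ)) 1 t := Complex.ofRealCLM.hasDerivAt
  have hU := G.pow_mul_U_analytic m
  have hV := G.pow_mul_V_analytic m
  have hv := G.freq_analytic
  have h1 := (((h.const_mul (b : ℂ)).const_add ((a : ℂ) * x)).const_mul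
    (1 / 2 * Complex.I)).cexp
  have h2 := G.hasDerivAt_plus_t (n := n) (x := x) (t := t) hU
  have h3 := (G.hasDerivAt_plus_t (n := n) (x := -x) (t := -t) hV).scomp t (hasDerivAt_neg t)
  refine (h1.mul (h2.add h3)).congr_deriv ?_
  have e1 : G.plus n (fun z => (Complex.I * b / 2 + G.freq z) * (G.μ z ^ m * G.U z)) x t
      = Complex.I * b / 2 * G.plus n (fun z => G.μ z ^ m * G.U z) x t
        + G.plus n (fun z => G.μ z ^ m * G.U z * G.freq z) x t := by
    rw [← plus_const_mul, ← G.plus_add]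
    · congr 1; funext z; ring
    · exact analyticAt_const.mul hU
    · exact hU.mul hv
  have e2 : G.plus n (fun z => (Complex.I * b / 2 - G.freq z) * (G.μ z ^ m * G.V z)) (-x) (-t)
      = Complex.I * b / 2 * G.plus n (fun z => G.μ z ^ m * G.V z) (-x) (-t)
        + (-1) * G.plus n (fun z => G.μ z ^ m * G.V z * G.freq z) (-x) (-t) := by
    rw [← plus_const_mul, ← plus_const_mul, ← G.plus_add]
    · congr 1; funext z; ring
    · exact analyticAt_const.mul hV
    · exact analyticAt_const.mul (hV.mul hv)
  rw [e1, e2]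
  simp only [Pi.add_apply, Function.comp_apply, neg_smul, one_smul]
  ring

theorem eventually_μ_ne_zero : ∀ᶠ z in 𝓝 (0 : ℂ), G.μ z ≠ 0 :=
  G.μ_analytic.continuousAt.eventually_ne G.μ_ne_zero

theorem halfWave_eq (a b c x t : ℝ) :
    seed a b c x t * Complex.exp (1 / 2 * Complex.I * (a * (-x : ℝ) + b * (-t : ℝ)))
      = c * Complex.exp (1 / 2 * Complex.I * (a * x + b * t)) := by
  rw [seed, mul_assoc, ← Complex.exp_add]
  congr 2
  push_cast
  ring

/-- The reflected eigenfunction carries the same exponentials, with `U` and `V` exchanged. -/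
theorem seed_mul_coeff_neg (m : ℕ) :
    seed a b c x t * G.coeff b n m (-x) (-t)
      = c * Complex.exp (1 / 2 * Complex.I * (a * x + b * t)) *
        (G.plus n (fun z => G.μ z ^ m * G.V z) x t
          + G.plus n (fun z => G.μ z ^ m * G.U z) (-x) (-t)) := by
  rw [coeff, ← mul_assoc, halfWave_eq, neg_neg, neg_neg, add_comm (G.plus n _ (-x) (-t))]

/-- The space part of the Lax pair. -/
theorem lax_x (x t : ℝ) :
    HasDerivAt (fun y => G.coeff b n 2 y t)
      (-Complex.I * G.coeff b n 0 x t + Complex.I * ρ * G.coeff b n 2 x t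
        + seed a b c x t * G.coeff b n 1 (-x) (-t)) x := by
  refine (G.hasDerivAt_coeff_x b n 2 x t).congr_deriv ?_
  have hU := G.pow_mul_U_analytic
  have hV := G.pow_mul_V_analytic
  have e1 : G.plus n (fun z => (Complex.I * a / 2 + G.vel z) * (G.μ z ^ 2 * G.U z)) x t
      = -Complex.I * G.plus n (fun z => G.μ z ^ 0 * G.U z) x t
        + Complex.I * ρ * G.plus n (fun z => G.μ z ^ 2 * G.U z) x t
        + c * G.plus n (fun z => G.μ z ^ 1 * G.V z) x t := by
    rw [← plus_const_mul, ← plus_const_mul, ← plus_const_mul, ← G.plus_add, ← G.plus_add]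
    · refine G.plus_congr ?_
      filter_upwards [G.eventually_μ_ne_zero, G.rel_U] with z hz h1
      have e : G.vel z * G.μ z ^ 2 = -G.h z / 2 := by rw [vel]; field_simp
      linear_combination G.U z * e - h1 / 2
    · exact (analyticAt_const.mul (hU 0)).add (analyticAt_const.mul (hU 2))
    · exact analyticAt_const.mul (hV 1)
    · exact analyticAt_const.mul (hU 0)
    · exact analyticAt_const.mul (hU 2)
  have e2 : G.plus n (fun z => (Complex.I * a / 2 - G.vel z) * (G.μ z ^ 2 * G.V z)) (-x) (-t)
      = -Complex.I * G.plus n (fun z => G.μ z ^ 0 * G.V z) (-x) (-t)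
        + Complex.I * ρ * G.plus n (fun z => G.μ z ^ 2 * G.V z) (-x) (-t)
        + c * G.plus n (fun z => G.μ z ^ 1 * G.U z) (-x) (-t) := by
    rw [← plus_const_mul, ← plus_const_mul, ← plus_const_mul, ← G.plus_add, ← G.plus_add]
    · refine G.plus_congr ?_
      filter_upwards [G.eventually_μ_ne_zero, G.rel_V] with z hz h1
      have e : G.vel z * G.μ z ^ 2 = -G.h z / 2 := by rw [vel]; field_simp
      linear_combination (-G.V z) * e - h1 / 2
    · exact (analyticAt_const.mul (hV 0)).add (analyticAt_const.mul (hV 2))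
    · exact analyticAt_const.mul (hU 1)
    · exact analyticAt_const.mul (hV 0)
    · exact analyticAt_const.mul (hV 2)
  rw [e1, e2, seed_mul_coeff_neg]
  simp only [coeff]
  ring

/-- The polynomial identity behind the time part of the Lax pair; `s` is the sign of the
exponent. -/
theorem lax_t_identity {a b c ρ : ℝ} (hb : b = seedFrequency a c ρ) (s μ h U V g : ℂ)
    (hg : g * μ ^ 6 = 1 / 4 * ((-3 * c ^ 4 - 6 * a * c ^ 2 + 4 * c ^ 2 * ρ - 2 * a ^ 2
      + 8 * ρ ^ 2) * μ ^ 4 + 4 * (c ^ 2 + a + 2 * ρ) * μ ^ 2 - 8) * h)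
    (hr : 2 * c * μ * V = U * (2 * Complex.I + Complex.I * (a - 2 * ρ) * μ ^ 2 - s * h)) :
    (Complex.I * b / 2 + s * g) * (μ ^ 6 * U)
      = (-4 * Complex.I) * (μ ^ 0 * U)
        + (-4 * Complex.I * (-c ^ 2 / 2) + 8 * Complex.I * ρ) * (μ ^ 2 * U)
        + (-4 * Complex.I * seedD₂ a c ρ + 8 * Complex.I * ρ * (-c ^ 2 / 2)) * (μ ^ 4 * U)
        + (-4 * Complex.I * ρ ^ 2) * (μ ^ 6 * U)
        + c * 4 * (μ ^ 1 * V)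
        + c * (-4 * Complex.I * seedN₁ a c ρ - 8 * ρ) * (μ ^ 3 * V)
        + c * seedFlux a c ρ * (μ ^ 5 * V) := by
  linear_combination (norm := skip) (s * U) * hg
    - (1 / 2 * (4 + (-4 * Complex.I * seedN₁ a c ρ - 8 * ρ) * μ ^ 2 + seedFlux a c ρ * μ ^ 4)) * hr
  rw [hb]
  simp only [seedFlux, seedN₂, seedD₂, seedN₁, seedFrequency]
  push_cast
  ring_nf
  simp only [Complex.I_sq, Complex.I_pow_three, Complex.I_pow_four, I_pow_five]
  ring_nf

theorem freq_mul (z : ℂ) (hz : G.μ z ≠ 0) : G.freq z * G.μ z ^ 6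
    = 1 / 4 * ((-3 * c ^ 4 - 6 * a * c ^ 2 + 4 * c ^ 2 * ρ - 2 * a ^ 2
      + 8 * ρ ^ 2) * G.μ z ^ 4 + 4 * (c ^ 2 + a + 2 * ρ) * G.μ z ^ 2 - 8) * G.h z := by
  rw [freq]; field_simp

theorem plus_sum {ι : Type*} (s : Finset ι) (w : ι → ℂ) {F : ι → ℂ → ℂ}
    (hF : ∀ i, AnalyticAt ℂ (F i) 0) :
    G.plus n (fun z => ∑ i ∈ s, w i * F i z) x t = ∑ i ∈ s, w i * G.plus n (F i) x t := by
  simp only [← plus_const_mul]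
  simp only [plus, Finset.sum_mul]
  exact taylorCoeff_sum s (fun i _ => analyticAt_mul_exp (analyticAt_const.mul (hF i))
    G.vel_analytic G.freq_analytic x t) n

/-- The time part of the Lax pair. -/
theorem lax_t (hb : b = seedFrequency a c ρ) (x t : ℝ) :
    HasDerivAt (fun s => G.coeff b n 6 x s)
      ((-4 * Complex.I) * G.coeff b n 0 x t
        + (-4 * Complex.I * resD₁ (seed a b c) x t + 8 * Complex.I * ρ) * G.coeff b n 2 x t
        + (-4 * Complex.I * resD₂ ρ (seed a b c) x t
            + 8 * Complex.I * ρ * resD₁ (seed a b c) x t) * G.coeff b n 4 x t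
        + (-4 * Complex.I * ρ ^ 2) * G.coeff b n 6 x t
        + (4 * seed a b c x t) * G.coeff b n 1 (-x) (-t)
        + (-4 * Complex.I * resN₁ ρ (seed a b c) x t - 8 * ρ * seed a b c x t)
            * G.coeff b n 3 (-x) (-t)
        + flux ρ (seed a b c) x t * G.coeff b n 5 (-x) (-t)) t := by
  refine (G.hasDerivAt_coeff_t b n 6 x t).congr_deriv ?_
  have hU := G.pow_mul_U_analytic
  have hV := G.pow_mul_V_analytic
  let w : Fin 7 → ℂ := ![-4 * Complex.I, -4 * Complex.I * (-c ^ 2 / 2) + 8 * Complex.I * ρ,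
    -4 * Complex.I * seedD₂ a c ρ + 8 * Complex.I * ρ * (-c ^ 2 / 2), -4 * Complex.I * ρ ^ 2,
    c * 4, c * (-4 * Complex.I * seedN₁ a c ρ - 8 * ρ), c * seedFlux a c ρ]
  have e1 : G.plus n (fun z => (Complex.I * b / 2 + G.freq z) * (G.μ z ^ 6 * G.U z)) x t
      = ∑ i, w i * G.plus n (![fun z => G.μ z ^ 0 * G.U z, fun z => G.μ z ^ 2 * G.U z,
        fun z => G.μ z ^ 4 * G.U z, fun z => G.μ z ^ 6 * G.U z, fun z => G.μ z ^ 1 * G.V z,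
        fun z => G.μ z ^ 3 * G.V z, fun z => G.μ z ^ 5 * G.V z] i) x t := by
    rw [← G.plus_sum]
    · refine G.plus_congr ?_
      filter_upwards [G.eventually_μ_ne_zero, G.rel_U] with z hz h1
      have := lax_t_identity hb 1 (G.μ z) (G.h z) (G.U z) (G.V z) (G.freq z) (G.freq_mul z hz)
        (by rw [h1, one_mul])
      rw [one_mul] at this
      rw [this]
      simp [Fin.sum_univ_succ, w]
      ring
    · intro i
      fin_cases i
      exacts [hU 0, hU 2, hU 4, hU 6, hV 1, hV 3, hV 5]
  have e2 : G.plus n (fun z => (Complex.I * b / 2 - G.freq z) * (G.μ z ^ 6 * G.V z)) (-x) (-t)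
      = ∑ i, w i * G.plus n (![fun z => G.μ z ^ 0 * G.V z, fun z => G.μ z ^ 2 * G.V z,
        fun z => G.μ z ^ 4 * G.V z, fun z => G.μ z ^ 6 * G.V z, fun z => G.μ z ^ 1 * G.U z,
        fun z => G.μ z ^ 3 * G.U z, fun z => G.μ z ^ 5 * G.U z] i) (-x) (-t) := by
    rw [← G.plus_sum]
    · refine G.plus_congr ?_
      filter_upwards [G.eventually_μ_ne_zero, G.rel_V] with z hz h1
      have := lax_t_identity hb (-1) (G.μ z) (G.h z) (G.V z) (G.U z) (G.freq z) (G.freq_mul z hz)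
        (by rw [h1]; ring)
      rw [neg_one_mul, ← sub_eq_add_neg] at this
      rw [this]
      simp [Fin.sum_univ_succ, w]
      ring
    · intro i
      fin_cases i
      exacts [hV 0, hV 2, hV 4, hV 6, hU 1, hU 3, hU 5]
  have n1 := G.seed_mul_coeff_neg (b := b) (n := n) (x := x) (t := t) 1
  have n3 := G.seed_mul_coeff_neg (b := b) (n := n) (x := x) (t := t) 3
  have n5 := G.seed_mul_coeff_neg (b := b) (n := n) (x := x) (t := t) 5
  rw [e1, e2, resD₁_seed, resD₂_seed, resN₁_seed, flux_seed]
  linear_combination (norm := skip) -4 * n1 - (-4 * Complex.I * seedN₁ a c ρ - 8 * ρ) * n3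
    - seedFlux a c ρ * n5
  simp only [coeff]
  simp [Fin.sum_univ_succ, w]
  ring

end EigenGerm

/-! ### Critical values and branches of the square root -/

section Critical

variable {a c ρ : ℝ} {l : ℂ}

theorem IsCriticalValue.radicand_eq_zero (ha : a ≠ 2 * ρ) (h : IsCriticalValue a c ρ l) :
    radicand a c ρ l = 0 := by
  obtain ⟨s, w, hs, hw, rfl⟩ := h
  have hd : (a - 2 * ρ : ℂ) ≠ 0 := by exact_mod_cast sub_ne_zero.2 ha
  have h4 : w ^ 4 = (2 * (-c ^ 2 + s - a + 2 * ρ)) ^ 2 := by rw [← hw]; ring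
  rw [radicand, div_pow, div_pow, h4, hw]
  field_simp
  linear_combination (-4 : ℂ) * hs

theorem radicand_conj (l : ℂ) : radicand a c ρ (conj l) = conj (radicand a c ρ l) := by
  simp only [radicand, map_sub, map_add, map_mul, map_neg, map_pow, Complex.conj_ofReal, map_ofNat]

theorem ne_zero_of_radicand (h : radicand a c ρ l = 0) : l ≠ 0 := by
  rintro rfl
  norm_num [radicand] at h

/-- A root of the radicand is not real, since the radicand is
`-((a - 2ρ)λ² + 2)² - 4c²λ²`. -/
theorem conj_ne_of_radicand (hc : c ≠ 0) (h : radicand a c ρ l = 0) : conj l ≠ l := by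
  intro hl
  obtain ⟨r, rfl⟩ := Complex.conj_eq_iff_real.1 hl
  have hr : ((a - 2 * ρ) * r ^ 2 + 2) ^ 2 + (2 * c * r) ^ 2 = 0 := by
    rw [radicand] at h
    have h' : (-4 - (a - 2 * ρ) ^ 2 * r ^ 4 + (-4 * c ^ 2 - 4 * a + 8 * ρ) * r ^ 2 : ℝ) = 0 := by
      exact_mod_cast h
    linear_combination -h'
  have h1 : (2 * c * r) ^ 2 = 0 := by
    have h3 := sq_nonneg ((a - 2 * ρ) * r ^ 2 + 2)
    have h4 := sq_nonneg (2 * c * r)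
    linarith
  have h2 : r = 0 := by
    rcases mul_eq_zero.1 (pow_eq_zero_iff two_ne_zero |>.1 h1) with h2 | h2
    · exact absurd h2 (mul_ne_zero two_ne_zero hc)
    · exact h2
  exact ne_zero_of_radicand h (by simp [h2])

/-- The quotient `radicand (l + z) / z` at a root `l` of the radicand. -/
def radicandQuot (a c ρ : ℝ) (l z : ℂ) : ℂ :=
  -(a - 2 * ρ) ^ 2 * (4 * l ^ 3 + 6 * l ^ 2 * z + 4 * l * z ^ 2 + z ^ 3)
    + (-4 * c ^ 2 - 4 * a + 8 * ρ) * (2 * l + z)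

theorem radicand_add (h : radicand a c ρ l = 0) (z : ℂ) :
    radicand a c ρ (l + z) = z * radicandQuot a c ρ l z := by
  rw [radicand] at h ⊢
  rw [radicandQuot]
  linear_combination h

theorem radicandQuot_ne_zero (hc : c ≠ 0) (ha : a ≠ 2 * ρ) (hs : c ^ 2 + 2 * a - 4 * ρ ≠ 0)
    (h : radicand a c ρ l = 0) : radicandQuot a c ρ l 0 ≠ 0 := by
  intro h0
  have hl := ne_zero_of_radicand h
  have hd : (a - 2 * ρ : ℂ) ≠ 0 := by exact_mod_cast sub_ne_zero.2 ha
  have hs' : (c ^ 2 + 2 * a - 4 * ρ : ℂ) ≠ 0 := by exact_mod_cast hs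
  have hc' : (c : ℂ) ≠ 0 := by exact_mod_cast hc
  rw [radicandQuot] at h0
  rw [radicand] at h
  have h1 : (-4 * l) * ((a - 2 * ρ) ^ 2 * l ^ 2 + 2 * (c ^ 2 + a - 2 * ρ)) = 0 := by
    linear_combination h0
  have h2 : (a - 2 * ρ : ℂ) ^ 2 * l ^ 2 + 2 * (c ^ 2 + a - 2 * ρ) = 0 :=
    (mul_eq_zero.1 h1).resolve_left (mul_ne_zero (by norm_num) hl)
  have h3 : (c : ℂ) ^ 2 * (c ^ 2 + 2 * a - 4 * ρ) = 0 := by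
    linear_combination (a - 2 * ρ : ℂ) ^ 2 / 4 * h
      + ((a - 2 * ρ : ℂ) ^ 2 * l ^ 2 / 4 + (c ^ 2 + a - 2 * ρ) / 2) * h2
  exact mul_ne_zero (pow_ne_zero 2 hc') hs' h3

/-- At a simple root `l` of the radicand, a branch is `ε` times a square root of the nonvanishing
function `radicandQuot a c ρ l (ε²)`. -/
theorem exists_isRootBranch (h : radicand a c ρ l = 0) (h' : radicandQuot a c ρ l 0 ≠ 0) :
    ∃ H, IsRootBranch a c ρ l H := by
  obtain ⟨w, hw⟩ := IsAlgClosed.exists_pow_nat_eq (radicandQuot a c ρ l 0) two_pos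
  set k : ℂ → ℂ := fun ε => radicandQuot a c ρ l (ε ^ 2) / radicandQuot a c ρ l 0 with hk
  have hka : AnalyticAt ℂ k 0 := by
    have : AnalyticAt ℂ (fun ε => radicandQuot a c ρ l (ε ^ 2)) 0 := by
      unfold radicandQuot; fun_prop
    exact this.div analyticAt_const h'
  have hk0 : k 0 = 1 := by simp [hk, h']
  have hks : k 0 ∈ Complex.slitPlane := by rw [hk0]; exact Complex.one_mem_slitPlane
  refine ⟨fun ε => ε * (w * Complex.exp (1 / 2 * Complex.log (k ε))), ?_, ?_⟩
  · exact analyticAt_id.mul (analyticAt_const.mul (analyticAt_const.mul (hka.clog hks)).cexp)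
  · filter_upwards [hka.continuousAt.eventually_ne (by rw [hk0]; exact one_ne_zero)] with ε hε
    have e : Complex.exp (1 / 2 * Complex.log (k ε)) ^ 2 = k ε := by
      rw [← Complex.exp_nat_mul]
      rw [show ((2 : ℕ) : ℂ) * (1 / 2 * Complex.log (k ε)) = Complex.log (k ε) by push_cast; ring]
      exact Complex.exp_log hε
    rw [radicand_add h, mul_pow, mul_pow, e, hw]
    simp only [hk]
    field_simp

/-- At a simple root of the radicand, every analytic branch of the square root is `ε` times an even
nonvanishing function. -/
theorem IsRootBranch.exists_eq_mul {H : ℂ → ℂ} (hH : IsRootBranch a c ρ l H)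
    (h : radicand a c ρ l = 0) (h' : radicandQuot a c ρ l 0 ≠ 0) :
    ∃ k, AnalyticAt ℂ k 0 ∧ k 0 ≠ 0 ∧ (∀ z, H z = z * k z) ∧ ∀ᶠ z in 𝓝 (0 : ℂ), k (-z) = k z := by
  have h0 : H 0 = 0 := by
    have := hH.2.self_of_nhds
    simpa [h] using this
  obtain ⟨k, hk, hHk⟩ := exists_eq_mul_of_zero hH.1 h0
  have hR : AnalyticAt ℂ (fun ε => radicandQuot a c ρ l (ε ^ 2)) 0 := by
    unfold radicandQuot; fun_prop
  have hsq : ∀ᶠ z in 𝓝 (0 : ℂ), k z ^ 2 = radicandQuot a c ρ l (z ^ 2) := by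
    refine AnalyticAt.frequently_eq_iff_eventually_eq (hk.fun_pow 2) hR |>.1 ?_
    refine Eventually.frequently ?_
    filter_upwards [hH.2.filter_mono nhdsWithin_le_nhds, self_mem_nhdsWithin] with z hz hz0
    have hz0' : z ≠ 0 := hz0
    rw [hHk, radicand_add h] at hz
    have : z ^ 2 * (k z ^ 2 - radicandQuot a c ρ l (z ^ 2)) = 0 := by linear_combination hz
    exact sub_eq_zero.1 ((mul_eq_zero.1 this).resolve_left (pow_ne_zero 2 hz0'))
  have hk0 : k 0 ≠ 0 := by
    have := hsq.self_of_nhds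
    intro h1
    rw [h1] at this
    simp at this
    exact h' this.symm
  have hneg : Tendsto (fun z : ℂ => -z) (𝓝 0) (𝓝 0) := by
    simpa using (continuous_neg (G := ℂ)).tendsto 0
  have hkneg : ContinuousAt (fun z => k (-z) + k z) 0 :=
    ContinuousAt.add (ContinuousAt.comp (f := fun z : ℂ => -z) (g := k)
      (by simpa using hk.continuousAt) continuous_neg.continuousAt) hk.continuousAt
  refine ⟨k, hk, hk0, hHk, ?_⟩
  filter_upwards [hsq, hneg.eventually hsq, hkneg.eventually_ne (y := 0)
    (by simpa [← two_mul] using hk0)] with z h1 h2 h3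
  rw [neg_sq] at h2
  have : (k (-z) + k z) * (k (-z) - k z) = 0 := by linear_combination h2 - h1
  exact sub_eq_zero.1 ((mul_eq_zero.1 this).resolve_left h3)

end Critical

/-! ### Eigenfunctions of the Lax pair -/

section Eigenfunctions

variable {a b c ρ : ℝ}

/-- The number `K₊`, the ratio of the components of the eigenfunction that carries `e^{-E}`. -/
def kPlus (a c ρ : ℝ) (l h : ℂ) : ℂ :=
  (2 * Complex.I + Complex.I * (a - 2 * ρ) * l ^ 2 + h) / (2 * l * c)

/-- The number `K₋`, the ratio of the components of the eigenfunction that carries `e^E`. -/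
def kMinus (a c ρ : ℝ) (l h : ℂ) : ℂ :=
  (2 * Complex.I + Complex.I * (a - 2 * ρ) * l ^ 2 - h) / (2 * l * c)

theorem kPlus_mul_kMinus (hc : c ≠ 0) {l h : ℂ} (hl : l ≠ 0) (hh : h ^ 2 = radicand a c ρ l) :
    kPlus a c ρ l h * kMinus a c ρ l h = 1 := by
  have hc' : (c : ℂ) ≠ 0 := by exact_mod_cast hc
  rw [radicand] at hh
  rw [kPlus, kMinus, div_mul_div_comm, div_eq_one_iff_eq (by simp [hl, hc'])]
  linear_combination -hh + (2 + (a - 2 * ρ) * l ^ 2) ^ 2 * Complex.I_sq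

theorem eigenfunction_zero (l h c₁ c₂ : ℂ) (x t : ℝ) :
    eigenfunction a b c ρ l h c₁ c₂ x t 0
      = Complex.exp (1 / 2 * Complex.I * (a * x + b * t)) *
        ((c₁ + c₂ * kPlus a c ρ l h) * Complex.exp (phase a c ρ l h x t)
          + (c₂ + c₁ * kMinus a c ρ l h) * Complex.exp (phase a c ρ l h (-x) (-t))) := by
  have e : phase a c ρ l h (-x) (-t) = -phase a c ρ l h x t := by
    simp only [phase]; push_cast; ring
  have e2 : phase a c ρ l h x t - 1 / 2 * Complex.I * (a * (-x : ℝ) + b * (-t : ℝ))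
    = phase a c ρ l h x t + 1 / 2 * Complex.I * (a * x + b * t) := by push_cast; ring
  simp only [eigenfunction, psiFst, psiSnd, e, kPlus, kMinus, Matrix.cons_val_zero, neg_neg,
    sub_eq_add_neg, Complex.exp_add]
  push_cast
  rw [show -(1 / 2 * Complex.I * (a * -x + b * -t)) = 1 / 2 * Complex.I * (a * x + b * t) by ring]
  ring

theorem eigenfunction_one (l h c₁ c₂ : ℂ) (x t : ℝ) :
    eigenfunction a b c ρ l h c₁ c₂ x t 1 = eigenfunction a b c ρ l h c₁ c₂ (-x) (-t) 0 := by
  simp only [eigenfunction, Matrix.cons_val_zero, Matrix.cons_val_one, neg_neg]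
  ring

namespace EigenGerm

/-- The germ of the superposed eigenfunction along a curve of spectral parameters. -/
def ofRoot (hc : c ≠ 0) (μ h : ℂ → ℂ) (hμ : AnalyticAt ℂ μ 0) (hh : AnalyticAt ℂ h 0)
    (h0 : μ 0 ≠ 0) (hr : ∀ᶠ z in 𝓝 (0 : ℂ), h z ^ 2 = radicand a c ρ (μ z)) (c₁ c₂ : ℂ) :
    EigenGerm a c ρ where
  μ := μ
  h := h
  U := fun z => c₁ + c₂ * kPlus a c ρ (μ z) (h z)
  V := fun z => c₂ + c₁ * kMinus a c ρ (μ z) (h z)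
  μ_analytic := hμ
  h_analytic := hh
  U_analytic := by
    have hc' : (c : ℂ) ≠ 0 := by exact_mod_cast hc
    have : 2 * μ 0 * c ≠ 0 := mul_ne_zero (mul_ne_zero two_ne_zero h0) hc'
    unfold kPlus
    fun_prop (disch := assumption)
  V_analytic := by
    have hc' : (c : ℂ) ≠ 0 := by exact_mod_cast hc
    have : 2 * μ 0 * c ≠ 0 := mul_ne_zero (mul_ne_zero two_ne_zero h0) hc'
    unfold kMinus
    fun_prop (disch := assumption)
  μ_ne_zero := h0
  rel_U := by
    have hc' : (c : ℂ) ≠ 0 := by exact_mod_cast hc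
    filter_upwards [hr, hμ.continuousAt.eventually_ne h0] with z hz hz0
    have hk := kPlus_mul_kMinus hc hz0 hz
    have e : 2 * Complex.I + Complex.I * (a - 2 * ρ) * μ z ^ 2 - h z
        = 2 * c * μ z * kMinus a c ρ (μ z) (h z) := by rw [kMinus]; field_simp
    rw [e]
    linear_combination -(2 * c * μ z * c₂) * hk
  rel_V := by
    have hc' : (c : ℂ) ≠ 0 := by exact_mod_cast hc
    filter_upwards [hr, hμ.continuousAt.eventually_ne h0] with z hz hz0
    have hk := kPlus_mul_kMinus hc hz0 hz
    have e : 2 * Complex.I + Complex.I * (a - 2 * ρ) * μ z ^ 2 + h z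
        = 2 * c * μ z * kPlus a c ρ (μ z) (h z) := by rw [kPlus]; field_simp
    rw [e]
    linear_combination -(2 * c * μ z * c₁) * hk

variable (G : EigenGerm a c ρ)

/-- The function `μ^m φ₁` of the local parameter. -/
def gen (b : ℝ) (m : ℕ) (x t : ℝ) (z : ℂ) : ℂ :=
  Complex.exp (1 / 2 * Complex.I * (a * x + b * t)) *
    (G.μ z ^ m * G.U z * Complex.exp (x * G.vel z + t * G.freq z)
      + G.μ z ^ m * G.V z * Complex.exp ((-x : ℝ) * G.vel z + (-t : ℝ) * G.freq z))

theorem gen_analytic (b : ℝ) (m : ℕ) (x t : ℝ) : AnalyticAt ℂ (G.gen b m x t) 0 :=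
  analyticAt_const.mul
    ((analyticAt_mul_exp (G.pow_mul_U_analytic m) G.vel_analytic G.freq_analytic x t).add
      (analyticAt_mul_exp (G.pow_mul_V_analytic m) G.vel_analytic G.freq_analytic _ _))

theorem coeff_eq_taylorCoeff (b : ℝ) (n m : ℕ) (x t : ℝ) :
    G.coeff b n m x t = taylorCoeff (G.gen b m x t) n := by
  unfold gen coeff plus
  rw [taylorCoeff_const_mul, taylorCoeff_add
    (analyticAt_mul_exp (G.pow_mul_U_analytic m) G.vel_analytic G.freq_analytic x t)
    (analyticAt_mul_exp (G.pow_mul_V_analytic m) G.vel_analytic G.freq_analytic _ _)]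

theorem gen_eq_pow_mul (b : ℝ) (m : ℕ) (x t : ℝ) (z : ℂ) :
    G.gen b m x t z = G.μ z ^ m * G.gen b 0 x t z := by
  simp only [gen]; ring

theorem gen_ofRoot (hc : c ≠ 0) (μ h : ℂ → ℂ) (hμ : AnalyticAt ℂ μ 0) (hh : AnalyticAt ℂ h 0)
    (h0 : μ 0 ≠ 0) (hr : ∀ᶠ z in 𝓝 (0 : ℂ), h z ^ 2 = radicand a c ρ (μ z)) (c₁ c₂ : ℂ)
    (m : ℕ) (x t : ℝ) (z : ℂ) (hz : μ z ≠ 0) :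
    (ofRoot hc μ h hμ hh h0 hr c₁ c₂).gen b m x t z
      = μ z ^ m * eigenfunction a b c ρ (μ z) (h z) c₁ c₂ x t 0 := by
  set G := ofRoot hc μ h hμ hh h0 hr c₁ c₂ with hG
  rw [eigenfunction_zero, gen_eq_pow_mul, gen]
  have e1 := G.phase_eq z hz x t
  have e2 := G.phase_eq z hz (-x) (-t)
  rw [← e1, ← e2]
  simp only [hG, ofRoot, pow_zero, one_mul]

end EigenGerm

end Eigenfunctions

/-! ### Expansions at the critical values -/

section Even

variable {f F s : ℂ → ℂ}

theorem analyticAt_hasSum_taylorCoeff (hf : AnalyticAt ℂ f 0) :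
    ∀ᶠ z in 𝓝 (0 : ℂ), HasSum (fun n => taylorCoeff f n * z ^ n) (f z) := by
  have h := hf.hasFPowerSeriesAt
  rw [hasFPowerSeriesAt_iff] at h
  filter_upwards [h] with z hz
  simpa [taylorCoeff, FormalMultilinearSeries.coeff_ofScalars, mul_comm] using hz

/-- Dividing an odd function by the variable gives an even function. -/
theorem eventually_neg (h : ∀ᶠ z in 𝓝 (0 : ℂ), F (-z) = -F z) (hf : ∀ z, F z = z * f z)
    (hfa : AnalyticAt ℂ f 0) : ∀ᶠ z in 𝓝 (0 : ℂ), f (-z) = f z := by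
  have hneg : AnalyticAt ℂ (fun z => f (-z)) 0 :=
    AnalyticAt.comp (g := f) (f := fun z : ℂ => -z) (by simpa using hfa) analyticAt_id.neg
  refine AnalyticAt.frequently_eq_iff_eventually_eq hneg hfa |>.1 (Eventually.frequently ?_)
  filter_upwards [h.filter_mono nhdsWithin_le_nhds, self_mem_nhdsWithin] with z hz hz0
  have hz0' : z ≠ 0 := hz0
  rw [hf, hf] at hz
  have : z * (f (-z) - f z) = 0 := by linear_combination -hz
  exact sub_eq_zero.1 ((mul_eq_zero.1 this).resolve_left hz0')

theorem taylorCoeff_odd_of_even (hf : ∀ᶠ z in 𝓝 (0 : ℂ), f (-z) = f z) {n : ℕ} (hn : Odd n) :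
    taylorCoeff f n = 0 := by
  have h1 : taylorCoeff (fun z => f (-z)) n = taylorCoeff f n := taylorCoeff_congr hf n
  have h2 : taylorCoeff (fun z => f (-z)) n = -taylorCoeff f n := by
    rw [taylorCoeff, taylorCoeff, iteratedDeriv_comp_neg, hn.neg_one_pow]
    simp [neg_div]
  rw [h2] at h1
  exact self_eq_neg.1 h1.symm

theorem update_limUnder (hf : AnalyticAt ℂ f 0) (h : s =ᶠ[𝓝[≠] 0] f) :
    Function.update s 0 (limUnder (𝓝[≠] (0 : ℂ)) s) =ᶠ[𝓝 0] f := by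
  have hl : limUnder (𝓝[≠] (0 : ℂ)) s = f 0 :=
    ((hf.continuousAt.tendsto.mono_left nhdsWithin_le_nhds).congr' h.symm).limUnder_eq
  rw [hl]
  rw [EventuallyEq, eventually_nhdsWithin_iff] at h
  filter_upwards [h] with z hz
  by_cases h0 : z = 0
  · rw [h0, Function.update_self]
  · rw [Function.update_of_ne h0, hz h0]

theorem evenTaylorCoeff_eq (hf : AnalyticAt ℂ f 0) (h : s =ᶠ[𝓝[≠] 0] f) (n : ℕ) :
    evenTaylorCoeff s n = taylorCoeff f (2 * n) := by
  rw [evenTaylorCoeff, (update_limUnder hf h).iteratedDeriv_eq]; rfl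

/-- An even analytic function is the sum of its expansion in even powers. -/
theorem hasSum_evenTaylorCoeff (hf : AnalyticAt ℂ f 0) (h : s =ᶠ[𝓝[≠] 0] f)
    (he : ∀ᶠ z in 𝓝 (0 : ℂ), f (-z) = f z) :
    ∀ᶠ z in 𝓝[≠] (0 : ℂ), HasSum (fun n => evenTaylorCoeff s n * z ^ (2 * n)) (s z) := by
  filter_upwards [h, (analyticAt_hasSum_taylorCoeff hf).filter_mono nhdsWithin_le_nhds] with z h1 h2
  rw [h1]
  have hinj : Function.Injective fun n : ℕ => 2 * n := fun m n h => by simpa using h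
  rw [← hinj.hasSum_iff (f := fun n => taylorCoeff f n * z ^ n)] at h2
  · simp only [evenTaylorCoeff_eq hf h]
    exact h2
  · intro n hn
    have : Odd n := by
      rw [← Nat.not_even_iff_odd]
      rintro ⟨k, rfl⟩
      exact hn ⟨k, by simp; ring⟩
    rw [taylorCoeff_odd_of_even he this, zero_mul]

end Even

/-- The setting of the degenerate transformation: two simple roots of the radicand, and branches of
the square root there. -/
structure BranchData (a c ρ : ℝ) (lam : Fin 2 → ℂ) (H : Fin 2 → ℂ → ℂ) : Prop where
  c_ne_zero : c ≠ 0
  root : ∀ j, radicand a c ρ (lam j) = 0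
  simple : ∀ j, radicandQuot a c ρ (lam j) 0 ≠ 0
  branch : ∀ j, IsRootBranch a c ρ (lam j) (H j)

namespace BranchData

variable {a b c ρ : ℝ} {lam : Fin 2 → ℂ} {H : Fin 2 → ℂ → ℂ} (D : BranchData a c ρ lam H)

theorem shift_analytic (l : ℂ) : AnalyticAt ℂ (fun ε : ℂ => l + ε ^ 2) 0 := by fun_prop

/-- The numerator of the eigenfunction with `c₁ = 1/ε`, `c₂ = -1/ε`. -/
def germ (j : Fin 2) : EigenGerm a c ρ :=
  EigenGerm.ofRoot D.c_ne_zero (fun ε => lam j + ε ^ 2) (H j) (shift_analytic _) (D.branch j).1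
    (by simpa using ne_zero_of_radicand (D.root j)) (D.branch j).2 1 (-1)

variable (j : Fin 2) (m n : ℕ) (x t : ℝ)

theorem eventually_shifted_ne_zero (D : BranchData a c ρ lam H) :
    ∀ᶠ ε in 𝓝 (0 : ℂ), lam j + ε ^ 2 ≠ 0 :=
  (shift_analytic (lam j)).continuousAt.eventually_ne
    (by simpa using ne_zero_of_radicand (D.root j))

theorem gen_germ (ε : ℂ) (hε : lam j + ε ^ 2 ≠ 0) : (D.germ j).gen b m x t ε
    = (lam j + ε ^ 2) ^ m * eigenfunction a b c ρ (lam j + ε ^ 2) (H j ε) 1 (-1) x t 0 :=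
  EigenGerm.gen_ofRoot D.c_ne_zero _ _ _ _ _ _ _ _ _ _ _ _ hε

theorem shifted_one (l : ℂ) (h : ℂ → ℂ) (ε : ℂ) :
    shifted a b c ρ l h x t 1 m ε = shifted a b c ρ l h (-x) (-t) 0 m ε := by
  rw [shifted, eigenfunction_one, shifted]

theorem shifted_zero (ε : ℂ) (hε : lam j + ε ^ 2 ≠ 0) :
    shifted a b c ρ (lam j) (H j) x t 0 m ε = (D.germ j).gen b m x t ε / ε := by
  rw [D.gen_germ j m x t ε hε, shifted, eigenfunction_zero, eigenfunction_zero]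
  ring

/-- Under `ε ↦ -ε` the square root changes sign, so that the two exponentials and the numbers `K₊`,
`K₋` are exchanged. -/
theorem gen_neg : ∀ᶠ ε in 𝓝 (0 : ℂ), (D.germ j).gen b m x t (-ε) = -(D.germ j).gen b m x t ε := by
  obtain ⟨k, hk, hk0, hH, hkn⟩ := (D.branch j).exists_eq_mul (D.root j) (D.simple j)
  filter_upwards [hkn, eventually_shifted_ne_zero j D] with ε h1 h2
  have h3 : lam j + (-ε) ^ 2 ≠ 0 := by rwa [neg_sq]
  have hn : H j (-ε) = -H j ε := by rw [hH, hH, h1]; ring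
  rw [D.gen_germ j m x t ε h2, D.gen_germ j m x t (-ε) h3, eigenfunction_zero, eigenfunction_zero,
    hn, neg_sq]
  have e1 : ∀ y s : ℝ, phase a c ρ (lam j + ε ^ 2) (-H j ε) y s
      = phase a c ρ (lam j + ε ^ 2) (H j ε) (-y) (-s) := fun y s => by
    simp only [phase]; push_cast; ring
  have e2 : kPlus a c ρ (lam j + ε ^ 2) (-H j ε) = kMinus a c ρ (lam j + ε ^ 2) (H j ε) := by
    simp only [kPlus, kMinus, sub_eq_add_neg]
  have e3 : kMinus a c ρ (lam j + ε ^ 2) (-H j ε) = kPlus a c ρ (lam j + ε ^ 2) (H j ε) := by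
    simp only [kPlus, kMinus, sub_neg_eq_add]
  rw [e1, e1, e2, e3, neg_neg, neg_neg]
  ring

/-- The removable singularity of the shifted eigenfunction is filled in by an even analytic
function. -/
theorem exists_shifted : ∃ f, AnalyticAt ℂ f 0 ∧ (∀ z, (D.germ j).gen b m x t z = z * f z) ∧
    shifted a b c ρ (lam j) (H j) x t 0 m =ᶠ[𝓝[≠] 0] f ∧ ∀ᶠ z in 𝓝 (0 : ℂ), f (-z) = f z := by
  have h0 : (D.germ j).gen b m x t 0 = 0 := by
    have := (D.gen_neg (b := b) j m x t).self_of_nhds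
    rw [neg_zero] at this
    exact self_eq_neg.1 this
  obtain ⟨f, hf, hfg⟩ := exists_eq_mul_of_zero ((D.germ j).gen_analytic b m x t) h0
  refine ⟨f, hf, hfg, ?_, eventually_neg (D.gen_neg j m x t) hfg hf⟩
  filter_upwards [(eventually_shifted_ne_zero j D).filter_mono nhdsWithin_le_nhds,
    self_mem_nhdsWithin] with z h1 h2
  have h2' : z ≠ 0 := h2
  rw [D.shifted_zero j m x t z h1, hfg, mul_div_cancel_left₀ _ h2']

theorem taylorPhi_one (l : ℂ) (h : ℂ → ℂ) :
    taylorPhi a b c ρ l h x t 1 m n = taylorPhi a b c ρ l h (-x) (-t) 0 m n := by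
  rw [taylorPhi, taylorPhi]
  congr 1
  funext ε
  exact shifted_one m x t l h ε

/-- The factor `1/ε` in the constants `c₁`, `c₂` turns the coefficient of `ε^{2n}` into the one of
`ε^{2n+1}`. -/
theorem taylorPhi_zero :
    taylorPhi a b c ρ (lam j) (H j) x t 0 m n = (D.germ j).coeff b (2 * n + 1) m x t := by
  obtain ⟨f, hf, hfg, hs, -⟩ := D.exists_shifted (b := b) j m x t
  rw [taylorPhi, evenTaylorCoeff_eq hf hs, EigenGerm.coeff_eq_taylorCoeff,
    ← taylorCoeff_pow_mul_add hf 1]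
  congr 1
  funext z
  rw [hfg, pow_one]

theorem hasSum_taylorPhi (D : BranchData a c ρ lam H) (k : Fin 2) : ∀ᶠ ε in 𝓝[≠] (0 : ℂ),
    HasSum (fun n : ℕ => taylorPhi a b c ρ (lam j) (H j) x t k m n * ε ^ (2 * n))
      (shifted a b c ρ (lam j) (H j) x t k m ε) := by
  have key : ∀ x t : ℝ, ∀ᶠ ε in 𝓝[≠] (0 : ℂ),
      HasSum (fun n : ℕ => taylorPhi a b c ρ (lam j) (H j) x t 0 m n * ε ^ (2 * n))
        (shifted a b c ρ (lam j) (H j) x t 0 m ε) := fun x t => by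
    obtain ⟨f, hf, -, hs, he⟩ := D.exists_shifted (b := b) j m x t
    exact hasSum_evenTaylorCoeff hf hs he
  fin_cases k
  · exact key x t
  · simp only [Fin.mk_one, taylorPhi_one, shifted_one]
    exact key (-x) (-t)

end BranchData

/-! ### Jordan chains of eigenfunctions -/

section

open Matrix

/-- A vector of functions whose entries satisfy the Lax pair entrywise, with powers of the spectral
matrix in place of powers of the spectral parameter. -/
theorem LaxVector.of_coeff {ι : Type*} [Fintype ι] [DecidableEq ι] {ρ : ℝ} {q : ℝ → ℝ → ℂ}
    {S : Matrix ι ι ℂ} {R : ι → ℕ → ℝ → ℝ → ℂ} (hsm : ∀ i m, SmoothOn Set.univ (R i m))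
    (hR : ∀ i m x t, R i (m + 1) x t = (S *ᵥ fun j => R j m x t) i)
    (hx : ∀ i x t, HasDerivAt (fun y => R i 2 y t)
      (-Complex.I * R i 0 x t + Complex.I * ρ * R i 2 x t + q x t * R i 1 (-x) (-t)) x)
    (ht : ∀ i x t, HasDerivAt (fun s => R i 6 x s)
      ((-4 * Complex.I) * R i 0 x t
        + (-4 * Complex.I * resD₁ q x t + 8 * Complex.I * ρ) * R i 2 x t
        + (-4 * Complex.I * resD₂ ρ q x t + 8 * Complex.I * ρ * resD₁ q x t) * R i 4 x t
        + (-4 * Complex.I * ρ ^ 2) * R i 6 x t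
        + (4 * q x t) * R i 1 (-x) (-t)
        + (-4 * Complex.I * resN₁ ρ q x t - 8 * ρ * q x t) * R i 3 (-x) (-t)
        + flux ρ q x t * R i 5 (-x) (-t)) t) :
    LaxVector ρ q S (fun x t i => R i 0 x t) := by
  have hpow : ∀ m x t, (S ^ m *ᵥ fun j => R j 0 x t) = fun j => R j m x t := fun m x t => by
    induction m with
    | zero => simp
    | succ m ih =>
      rw [pow_succ', ← Matrix.mulVec_mulVec, ih]
      funext i
      exact (hR i m x t).symm
  have h1 : ∀ x t, (S *ᵥ fun j => R j 0 x t) = fun j => R j 1 x t := fun x t => by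
    rw [← hpow 1, pow_one]
  refine ⟨fun i => hsm i 0, fun x t => ?_, fun x t => ?_⟩
  · have hd : HasDerivAt (fun y => fun i => R i 0 y t)
        (fun i => dx (fun x t => R i 0 x t) x t) x :=
      hasDerivAt_pi.2 fun i => (hsm i 0).hasDerivAt_dx isOpen_univ (Set.mem_univ _)
    have hS := hasDerivAt_mulVec (S ^ 2) hd
    simp only [hpow] at hS
    simp only [hpow, h1]
    funext i
    exact (hasDerivAt_pi.1 hS i).unique (hx i x t)
  · have hd : HasDerivAt (fun s => fun i => R i 0 x s)
        (fun i => dt (fun x t => R i 0 x t) x t) t :=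
      hasDerivAt_pi.2 fun i => (hsm i 0).hasDerivAt_dt isOpen_univ (Set.mem_univ _)
    have hS := hasDerivAt_mulVec (S ^ 6) hd
    simp only [hpow] at hS
    simp only [hpow, h1]
    funext i
    exact (hasDerivAt_pi.1 hS i).unique (ht i x t)

namespace BranchData

variable {a b c ρ : ℝ} {lam : Fin 2 → ℂ} {H : Fin 2 → ℂ → ℂ} (D : BranchData a c ρ lam H)
  {N n : ℕ} {W : WaveData N}

/-- The germ that generates row `i` of the semi-degenerate transformation. -/
def rowGerm (hW : W.Admissible a c ρ n) (i : Fin (2 * N)) : EigenGerm a c ρ :=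
  if h : (i : ℕ) < 2 * n then D.germ (Fin.ofNat 2 i)
  else EigenGerm.ofRoot D.c_ne_zero (fun _ => W.l i) (fun _ => W.h i) analyticAt_const
    analyticAt_const (hW i (not_lt.1 h)).1 (Eventually.of_forall fun _ => (hW i (not_lt.1 h)).2)
    (W.c₁ i) (W.c₂ i)

/-- The order of the Taylor coefficient in row `i`; rows of the other localized waves are values,
that is coefficients of order `0`. -/
def rowOrder (n i : ℕ) : ℕ := if i < 2 * n then 2 * (i / 2) + 1 else 0

/-- The first components of the rows of the semi-degenerate transformation. -/
def rowCoeff (hW : W.Admissible a c ρ n) (b : ℝ) (i : Fin (2 * N)) (m : ℕ) : ℝ → ℝ → ℂ :=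
  (D.rowGerm hW i).coeff b (rowOrder n i) m

/-- The eigenvalues of the spectral matrix. -/
def rowEigenvalue (lam : Fin 2 → ℂ) (n : ℕ) (W : WaveData N) (i : Fin (2 * N)) : ℂ :=
  if (i : ℕ) < 2 * n then lam (Fin.ofNat 2 i) else W.l i

/-- The spectral matrix: Taylor coefficients of different orders at the same critical value form
a Jordan chain, because `(λ + ε²) f` has the coefficients `λ fᵣ + fᵣ₋₁`. -/
def spectralMatrix (lam : Fin 2 → ℂ) (n : ℕ) (W : WaveData N) :
    Matrix (Fin (2 * N)) (Fin (2 * N)) ℂ :=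
  Matrix.of fun i j => if j = i then rowEigenvalue lam n W i
    else if (j : ℕ) + 2 = i ∧ (i : ℕ) < 2 * n then 1 else 0

theorem isUnit_det_spectralMatrix (D : BranchData a c ρ lam H) (hW : W.Admissible a c ρ n) :
    IsUnit (spectralMatrix lam n W).det := by
  rw [Matrix.det_of_isLowerTriangular]
  · refine isUnit_iff_ne_zero.2 (Finset.prod_ne_zero_iff.2 fun i _ => ?_)
    simp only [spectralMatrix, rowEigenvalue, Matrix.of_apply, if_true]
    split_ifs with h
    · exact ne_zero_of_radicand (D.root _)
    · exact (hW i (not_lt.1 h)).1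
  · intro i j hij
    have hij' : i < j := hij
    have h1 : (i : ℕ) < j := hij'
    simp only [spectralMatrix, Matrix.of_apply]
    rw [if_neg (ne_of_gt hij'), if_neg (by omega)]

theorem spectralMatrix_mulVec (v : Fin (2 * N) → ℂ) (i : Fin (2 * N)) :
    (spectralMatrix lam n W *ᵥ v) i = rowEigenvalue lam n W i * v i
      + if h : 2 ≤ (i : ℕ) ∧ (i : ℕ) < 2 * n then v ⟨i - 2, by omega⟩ else 0 := by
  have key : ∀ j, spectralMatrix lam n W i j * v j
      = (if j = i then rowEigenvalue lam n W i * v i else 0)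
        + if (j : ℕ) + 2 = i ∧ (i : ℕ) < 2 * n then v j else 0 := fun j => by
    simp only [spectralMatrix, Matrix.of_apply]
    by_cases h1 : j = i
    · subst h1
      simp
    · simp [h1]
  rw [Matrix.mulVec, dotProduct, Finset.sum_congr rfl fun j _ => key j, Finset.sum_add_distrib]
  congr 1
  · simp
  · split_ifs with h
    · rw [Finset.sum_eq_single (⟨i - 2, by omega⟩ : Fin (2 * N))]
      · rw [if_pos ⟨by simp; omega, h.2⟩]
      · intro j _ hj
        rw [if_neg]
        rintro ⟨h3, -⟩
        exact hj (Fin.ext (by simp; omega))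
      · simp
    · refine Finset.sum_eq_zero fun j _ => if_neg ?_
      omega

theorem taylorCoeff_shift_mul {f : ℂ → ℂ} (hf : AnalyticAt ℂ f 0) (l : ℂ) (n : ℕ) :
    taylorCoeff (fun z => (l + z ^ 2) * f z) n
      = l * taylorCoeff f n + if 2 ≤ n then taylorCoeff f (n - 2) else 0 := by
  have hzf : AnalyticAt ℂ (fun z => z ^ 2 * f z) 0 := (analyticAt_id.fun_pow 2).mul hf
  have hlf : AnalyticAt ℂ (fun z => l * f z) 0 := analyticAt_const.mul hf
  simp only [add_mul]
  rw [taylorCoeff_add hlf hzf, taylorCoeff_const_mul]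
  congr 1
  split_ifs with h
  · obtain ⟨k, rfl⟩ := Nat.exists_eq_add_of_le' h
    rw [taylorCoeff_pow_mul_add hf, Nat.add_sub_cancel]
  · exact taylorCoeff_pow_mul_of_lt hf (not_le.1 h)

theorem rowCoeff_succ (hW : W.Admissible a c ρ n) (i : Fin (2 * N)) (m : ℕ) (x t : ℝ) :
    D.rowCoeff hW b i (m + 1) x t
      = (spectralMatrix lam n W *ᵥ fun j => D.rowCoeff hW b j m x t) i := by
  rw [spectralMatrix_mulVec]
  simp only [rowCoeff, EigenGerm.coeff_eq_taylorCoeff]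
  by_cases hi : (i : ℕ) < 2 * n
  · have hg : D.rowGerm hW i = D.germ (Fin.ofNat 2 i) := dif_pos hi
    have e : (D.germ (Fin.ofNat 2 i)).gen b (m + 1) x t = fun z =>
        (lam (Fin.ofNat 2 i) + z ^ 2) * (D.germ (Fin.ofNat 2 i)).gen b m x t z := by
      funext z
      rw [EigenGerm.gen_eq_pow_mul, EigenGerm.gen_eq_pow_mul _ b m, pow_succ']
      simp only [germ, EigenGerm.ofRoot]
      ring
    rw [hg, e, taylorCoeff_shift_mul (EigenGerm.gen_analytic _ _ _ _ _), rowEigenvalue, if_pos hi]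
    congr 1
    by_cases h2 : 2 ≤ (i : ℕ)
    · rw [dif_pos ⟨h2, hi⟩, if_pos (by rw [rowOrder, if_pos hi]; omega)]
      have hlt : ((⟨i - 2, by omega⟩ : Fin (2 * N)) : ℕ) < 2 * n := by simp; omega
      rw [rowGerm, dif_pos hlt]
      have e3 : Fin.ofNat 2 ((⟨i - 2, by omega⟩ : Fin (2 * N)) : ℕ) = Fin.ofNat 2 (i : ℕ) :=
        Fin.ext (by simp only [Fin.val_ofNat]; omega)
      have e4 : rowOrder n ((⟨i - 2, by omega⟩ : Fin (2 * N)) : ℕ) = rowOrder n i - 2 := by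
        rw [rowOrder, rowOrder, if_pos hlt, if_pos hi]
        simp only
        omega
      rw [e3, e4]
    · rw [dif_neg (fun h => h2 h.1), if_neg (by rw [rowOrder, if_pos hi]; omega)]
  · rw [dif_neg (fun h => hi h.2), add_zero, rowOrder, if_neg hi, taylorCoeff_zero,
      taylorCoeff_zero, EigenGerm.gen_eq_pow_mul, EigenGerm.gen_eq_pow_mul _ b m, rowEigenvalue,
      if_neg hi]
    have : (D.rowGerm hW i).μ 0 = W.l i := by rw [rowGerm, dif_neg hi]; rfl
    rw [this, pow_succ']
    ring

theorem laxVector (hW : W.Admissible a c ρ n) (hb : b = seedFrequency a c ρ) :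
    LaxVector ρ (seed a b c) (spectralMatrix lam n W) (fun x t i => D.rowCoeff hW b i 0 x t) :=
  LaxVector.of_coeff (fun i m => (D.rowGerm hW i).smooth_coeff b _ m)
    (D.rowCoeff_succ hW) (fun i x t => (D.rowGerm hW i).lax_x x t)
    (fun i x t => (D.rowGerm hW i).lax_t hb x t)

theorem spectralMatrix_pow_mulVec (hW : W.Admissible a c ρ n) (m : ℕ) (x t : ℝ) :
    (spectralMatrix lam n W ^ m *ᵥ fun j => D.rowCoeff hW b j 0 x t)
      = fun j => D.rowCoeff hW b j m x t := by
  induction m with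
  | zero => simp
  | succ m ih =>
    rw [pow_succ', ← Matrix.mulVec_mulVec, ih]
    funext i
    exact (D.rowCoeff_succ hW i m x t).symm

theorem semiDegenerateRows_zero (hW : W.Admissible a c ρ n) (x t : ℝ) (i : Fin (2 * N)) (m : ℕ) :
    semiDegenerateRows a b c ρ lam H N n W x t i 0 m = D.rowCoeff hW b i m x t := by
  rw [semiDegenerateRows, rowCoeff, rowGerm, rowOrder]
  by_cases hi : (i : ℕ) < 2 * n
  · rw [if_pos hi, if_pos hi, dif_pos hi, rogueRow, D.taylorPhi_zero]
  · rw [if_neg hi, if_neg hi, dif_neg hi, EigenGerm.coeff_eq_taylorCoeff, taylorCoeff_zero,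
      EigenGerm.gen_ofRoot _ _ _ _ _ _ _ _ _ _ _ _ _ (hW i (not_lt.1 hi)).1]
    rfl

theorem semiDegenerateRows_one (x t : ℝ) (i : Fin (2 * N)) (m : ℕ) :
    semiDegenerateRows a b c ρ lam H N n W x t i 1 m
      = semiDegenerateRows a b c ρ lam H N n W (-x) (-t) i 0 m := by
  rw [semiDegenerateRows, semiDegenerateRows]
  split_ifs with hi
  · rw [rogueRow, rogueRow, taylorPhi_one]
  · rw [WaveData.phi, WaveData.phi, eigenfunction_one]

theorem semiDegenerateRows_eq_matrixRow (hW : W.Admissible a c ρ n) (x t : ℝ) :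
    semiDegenerateRows a b c ρ lam H N n W x t
      = matrixRow (spectralMatrix lam n W) (fun x t i => D.rowCoeff hW b i 0 x t) x t := by
  funext i k m
  fin_cases k
  · simp only [Fin.zero_eta, matrixRow, Matrix.cons_val_zero]
    rw [D.spectralMatrix_pow_mulVec hW, D.semiDegenerateRows_zero hW]
  · simp only [Fin.mk_one, matrixRow, Matrix.cons_val_one, Matrix.cons_val_zero]
    rw [D.spectralMatrix_pow_mulVec hW, semiDegenerateRows_one, D.semiDegenerateRows_zero hW]

/-- The dressed seed solves the equation. -/
theorem isSolutionOn_interactionWave (D : BranchData a c ρ lam H) (hN : 1 ≤ N)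
    (hW : W.Admissible a c ρ n) (hb : b = seedFrequency a c ρ) :
    IsSolutionOn ρ (regularSet (interactionDen a b c ρ lam H N n W))
      (interactionWave a b c ρ lam H N n W) := by
  have h := LaxVector.isSolutionOn hN (D.isUnit_det_spectralMatrix hW) (D.laxVector hW hb)
    (isSolutionOn_seed hb)
  simp only [← D.semiDegenerateRows_eq_matrixRow hW] at h
  exact h

theorem semiDegenerateRows_self :
    semiDegenerateRows a b c ρ lam H N N W = degenerateRows a b c ρ lam H N := by
  funext x t i k m
  rw [semiDegenerateRows, if_pos i.2, degenerateRows]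

theorem admissible_self : W.Admissible a c ρ N := fun i hi => absurd i.2 (not_lt.2 hi)

end BranchData

end

/-! ### Nonvanishing of the denominator at the origin -/

section

open Polynomial Matrix

/-- A nonzero polynomial that vanishes to prescribed orders at distinct points has large degree. -/
theorem sum_le_natDegree {ι : Type*} [Fintype ι] {p : ℂ[X]} (hp : p ≠ 0) {s : ι → ℂ}
    (hs : Function.Injective s) {k : ι → ℕ} (h : ∀ i, (X - C (s i)) ^ k i ∣ p) :
    ∑ i, k i ≤ p.natDegree := by
  have hd : ∏ i, (X - C (s i)) ^ k i ∣ p :=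
    Finset.prod_dvd_of_coprime (fun i _ j _ hij => (pairwise_coprime_X_sub_C hs hij).pow)
      fun i _ => h i
  have := natDegree_le_of_dvd hd hp
  rw [natDegree_prod_of_monic _ _ fun i _ => (monic_X_sub_C _).pow _] at this
  simpa using this

/-- Here `z f(z)` is the restriction of an eigenfunction to the origin; its simple zero at `z = 0` is
the reason for the odd orders. -/
theorem pow_dvd_of_taylorCoeff {p : ℂ[X]} (hp : p ≠ 0) {l : ℂ} {f : ℂ → ℂ}
    (hf : AnalyticAt ℂ f 0) (hf0 : f 0 ≠ 0) {n : ℕ}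
    (h : ∀ r < n, taylorCoeff (fun z => p.eval (l + z ^ 2) * (z * f z)) (2 * r + 1) = 0) :
    (X - C l) ^ n ∣ p := by
  rw [← le_rootMultiplicity_iff hp]
  by_contra! hk
  obtain ⟨q, hq, hql⟩ := exists_eq_pow_rootMultiplicity_mul_and_not_dvd p hp l
  set k := p.rootMultiplicity l with hkdef
  have hq0 : q.eval l ≠ 0 := fun h0 => hql (dvd_iff_isRoot.2 h0)
  have hqa : AnalyticAt ℂ (fun z => q.eval (l + z ^ 2)) 0 := by
    have : AnalyticAt ℂ (fun z : ℂ => l + z ^ 2) 0 := by fun_prop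
    exact this.aeval_polynomial q
  have e : (fun z => p.eval (l + z ^ 2) * (z * f z))
      = fun z => z ^ (2 * k + 1) * (q.eval (l + z ^ 2) * f z) := by
    funext z
    rw [hq]
    simp only [eval_mul, eval_pow, eval_sub, eval_X, eval_C, add_sub_cancel_left]
    ring
  have h1 := h k hk
  have hqf : AnalyticAt ℂ (fun z => q.eval (l + z ^ 2) * f z) 0 := hqa.mul hf
  have h2 := taylorCoeff_pow_mul_add hqf (2 * k + 1) 0
  rw [zero_add] at h2
  rw [e, h2, taylorCoeff_zero] at h1
  simp only [ne_eq, OfNat.ofNat_ne_zero, not_false_eq_true, zero_pow, add_zero] at h1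
  exact mul_ne_zero hq0 hf0 h1

/-- The exponent of the spectral parameter in column `j` of the denominator matrix. -/
def colExponent (N j : ℕ) : ℕ := if Even j then 2 * N - 2 - j else 2 * N - j

theorem colExponent_lt {N j : ℕ} (hj : j < 2 * N) : colExponent N j < 2 * N := by
  rw [colExponent]
  split_ifs with h
  · omega
  · have := Nat.pos_of_ne_zero (fun h0 : j = 0 => h (h0 ▸ Even.zero))
    omega

theorem colExponent_injOn {N i j : ℕ} (hi : i < 2 * N) (hj : j < 2 * N)
    (h : colExponent N i = colExponent N j) : i = j := by
  simp only [colExponent, Nat.even_iff] at h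
  split_ifs at h <;> omega

namespace EigenGerm

variable {a b c ρ : ℝ} (G : EigenGerm a c ρ)

theorem gen_origin (m : ℕ) (z : ℂ) : G.gen b m 0 0 z = G.μ z ^ m * (G.U z + G.V z) := by
  simp [gen]; ring

theorem sum_coeff_origin {ι : Type*} (s : Finset ι) (v : ι → ℂ) (e : ι → ℕ) (n : ℕ) :
    ∑ j ∈ s, v j * G.coeff b n (e j) 0 0 = taylorCoeff (fun z =>
      (∑ j ∈ s, C (v j) * X ^ e j : ℂ[X]).eval (G.μ z) * (G.U z + G.V z)) n := by
  have e1 : (fun z => (∑ j ∈ s, C (v j) * X ^ e j : ℂ[X]).eval (G.μ z) * (G.U z + G.V z))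
      = fun z => ∑ j ∈ s, v j * G.gen b (e j) 0 0 z := by
    funext z
    simp only [eval_finsetSum, eval_mul, eval_C, eval_pow, eval_X, Finset.sum_mul, gen_origin,
      mul_assoc]
  have hF : ∀ j ∈ s, AnalyticAt ℂ (fun z => v j * G.gen b (e j) 0 0 z) 0 := fun j _ =>
    analyticAt_const.mul (G.gen_analytic b (e j) 0 0)
  rw [e1, taylorCoeff_sum s hF]
  exact Finset.sum_congr rfl fun j _ => by rw [taylorCoeff_const_mul, coeff_eq_taylorCoeff]

end EigenGerm

/-- A superposed eigenfunction that vanishes at the origin vanishes identically. -/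
theorem eigenfunction_origin_ne_zero {a b c ρ : ℝ} (hc : c ≠ 0) {l h c₁ c₂ : ℂ} (hl : l ≠ 0)
    (hh : h ^ 2 = radicand a c ρ l)
    (hne : ∃ x t k, eigenfunction a b c ρ l h c₁ c₂ x t k ≠ 0) :
    (c₁ + c₂ * kPlus a c ρ l h) + (c₂ + c₁ * kMinus a c ρ l h) ≠ 0 := by
  intro h0
  have hk := kPlus_mul_kMinus hc hl hh
  have hc' : (c : ℂ) ≠ 0 := by exact_mod_cast hc
  have hz : ∀ x t, eigenfunction a b c ρ l h c₁ c₂ x t 0 = 0 := fun x t => by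
    rw [eigenfunction_zero]
    have hfac : (c₂ + c₁ * kMinus a c ρ l h) * (1 + kPlus a c ρ l h) = 0 := by
      linear_combination h0 + c₁ * hk
    rcases mul_eq_zero.1 hfac with h1 | h1
    · have h2 : c₁ + c₂ * kPlus a c ρ l h = 0 := by
        linear_combination kPlus a c ρ l h * h1 - c₁ * hk
      rw [h1, h2]; ring
    · have h2 : kMinus a c ρ l h = -1 := by linear_combination kMinus a c ρ l h * h1 - hk
      have h3 : h = 0 := by
        have h4 : kPlus a c ρ l h - kMinus a c ρ l h = 0 := by linear_combination h1 - h2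
        rw [kPlus, kMinus, ← sub_div, div_eq_zero_iff] at h4
        have h5 := h4.resolve_right (by simp [hl, hc'])
        linear_combination h5 / 2
      have hp : ∀ y s, phase a c ρ l h y s = 0 := fun y s => by rw [h3, phase, mul_zero]
      rw [hp, hp]
      linear_combination Complex.exp (1 / 2 * Complex.I * (a * x + b * t)) * Complex.exp 0 * h0
  obtain ⟨x, t, k, hk⟩ := hne
  fin_cases k
  · exact hk (hz x t)
  · refine hk ?_
    simp only [Fin.mk_one]
    rw [eigenfunction_one, hz]

namespace BranchData

variable {a b c ρ : ℝ} {lam : Fin 2 → ℂ} {H : Fin 2 → ℂ → ℂ} (D : BranchData a c ρ lam H)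
  {N n : ℕ} {W : WaveData N}

theorem exists_germ_origin (j : Fin 2) : ∃ f, AnalyticAt ℂ f 0 ∧ f 0 ≠ 0 ∧
    ∀ z, (D.germ j).U z + (D.germ j).V z = z * f z := by
  obtain ⟨k, hk, hk0, hH, -⟩ := (D.branch j).exists_eq_mul (D.root j) (D.simple j)
  have hc' : (c : ℂ) ≠ 0 := by exact_mod_cast D.c_ne_zero
  have hl : lam j + (0 : ℂ) ^ 2 ≠ 0 := by simpa using ne_zero_of_radicand (D.root j)
  have h0 : (lam j + (0 : ℂ) ^ 2) * c ≠ 0 := mul_ne_zero hl hc'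
  refine ⟨fun z => -k z / ((lam j + z ^ 2) * c), ?_, ?_, fun z => ?_⟩
  · fun_prop (disch := assumption)
  · exact div_ne_zero (neg_ne_zero.2 hk0) h0
  · simp only [germ, EigenGerm.ofRoot, kPlus, kMinus]
    rw [hH z]
    have e : ∀ A B u v : ℂ, 1 + -1 * ((A + B) / (2 * u * v)) + (-1 + 1 * ((A - B) / (2 * u * v)))
        = -B / (u * v) := fun A B u v => by
      rw [show 2 * u * v = 2 * (u * v) by ring]
      by_cases hw : u * v = 0
      · simp [hw]
      · field_simp; ring
    rw [e]
    ring

theorem interactionDen_origin_ne_zero (D : BranchData a c ρ lam H) (hlam : lam 0 ≠ lam 1)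
    (hn : n ≤ N) (hW : W.Admissible a c ρ n) (hinj : Set.InjOn W.l {i | 2 * n ≤ (i : ℕ)})
    (hlW : ∀ i : Fin (2 * N), 2 * n ≤ (i : ℕ) → ∀ j, W.l i ≠ lam j)
    (hne : ∀ i : Fin (2 * N), 2 * n ≤ (i : ℕ) → ∃ x t k, W.phi a b c ρ i x t k ≠ 0) :
    interactionDen a b c ρ lam H N n W 0 0 ≠ 0 := by
  rw [interactionDen]
  intro hdet
  obtain ⟨v, hv0, hv⟩ := Matrix.exists_mulVec_eq_zero_iff.2 hdet
  -- a vanishing combination of the columns, as a polynomial in the spectral parameter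
  set p : ℂ[X] := ∑ j : Fin (2 * N), C (v j) * X ^ colExponent N j with hp
  have hcoeff : ∀ j : Fin (2 * N), p.coeff (colExponent N j) = v j := fun j => by
    rw [hp]
    simp only [finsetSum_coeff, coeff_C_mul, coeff_X_pow]
    rw [Finset.sum_eq_single j]
    · simp
    · intro i _ hij
      rw [if_neg, mul_zero]
      exact fun h => hij (Fin.ext (colExponent_injOn i.2 j.2 h.symm))
    · simp
  have hp0 : p ≠ 0 := by
    intro h
    refine hv0 (funext fun j => ?_)
    rw [← hcoeff j, h, coeff_zero, Pi.zero_apply]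
  have hrow : ∀ i, taylorCoeff (fun z =>
      p.eval ((D.rowGerm hW i).μ z) * ((D.rowGerm hW i).U z + (D.rowGerm hW i).V z))
      (rowOrder n i) = 0 := fun i => by
    rw [hp, ← EigenGerm.sum_coeff_origin (b := b)]
    have := congrFun hv i
    rw [Matrix.mulVec, dotProduct, Pi.zero_apply] at this
    rw [← this]
    refine Finset.sum_congr rfl fun j _ => ?_
    rw [mul_comm, denMatrix, Matrix.of_apply, semiDegenerateRows_one, neg_zero,
      D.semiDegenerateRows_zero hW, D.semiDegenerateRows_zero hW, colExponent, ← apply_ite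
        (fun m => D.rowCoeff hW b i m 0 0)]
    rfl
  have hdvd : ∀ j, (X - C (lam j)) ^ n ∣ p := fun j => by
    obtain ⟨f, hf, hf0, hUV⟩ := D.exists_germ_origin j
    refine pow_dvd_of_taylorCoeff hp0 hf hf0 fun r hr => ?_
    have hlt : 2 * r + j < 2 * N := by omega
    have := hrow ⟨2 * r + j, hlt⟩
    have hi : ((⟨2 * r + j, hlt⟩ : Fin (2 * N)) : ℕ) < 2 * n := by simp only; omega
    have e1 : Fin.ofNat 2 ((⟨2 * r + j, hlt⟩ : Fin (2 * N)) : ℕ) = j :=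
      Fin.ext (by simp only [Fin.val_ofNat]; omega)
    rw [rowGerm, dif_pos hi, rowOrder, if_pos hi, e1] at this
    simp only [hUV] at this
    have e2 : (2 * r + (j : ℕ)) / 2 = r := by omega
    rw [e2] at this
    exact this
  have hroot : ∀ i : Fin (2 * N), 2 * n ≤ (i : ℕ) → (X - C (W.l i)) ^ 1 ∣ p := fun i hi => by
    rw [pow_one, dvd_iff_isRoot, IsRoot]
    have := hrow i
    rw [rowGerm, dif_neg (not_lt.2 hi), rowOrder, if_neg (not_lt.2 hi), taylorCoeff_zero] at this
    refine (mul_eq_zero.1 this).resolve_right ?_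
    exact eigenfunction_origin_ne_zero D.c_ne_zero (hW i hi).1 (hW i hi).2 (hne i hi)
  let s : Fin 2 ⊕ {i : Fin (2 * N) // 2 * n ≤ (i : ℕ)} → ℂ := Sum.elim lam fun i => W.l i.1
  let k : Fin 2 ⊕ {i : Fin (2 * N) // 2 * n ≤ (i : ℕ)} → ℕ := Sum.elim (fun _ => n) fun _ => 1
  have hs : Function.Injective s := by
    refine Function.Injective.sumElim ?_ ?_ ?_
    · intro i j hij
      fin_cases i <;> fin_cases j
      · rfl
      · exact absurd hij hlam
      · exact absurd hij.symm hlam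
      · rfl
    · exact fun i j hij => Subtype.ext (hinj i.2 j.2 hij)
    · exact fun j i => (hlW i.1 i.2 j).symm
  have hle := sum_le_natDegree hp0 hs (k := k) (by
    rintro (j | i)
    · exact hdvd j
    · exact hroot i.1 i.2)
  have hcard : Fintype.card {i : Fin (2 * N) // 2 * n ≤ (i : ℕ)} = 2 * N - 2 * n := by
    simp only [← not_lt]
    rw [Fintype.card_subtype_compl, Fintype.card_fin, Fintype.card_subtype, Fin.card_filter_val_lt]
    omega
  have hsum : ∑ i, k i = 2 * N := by
    simp only [k, Fintype.sum_sum_type, Sum.elim_inl, Sum.elim_inr, Finset.sum_const,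
      Finset.card_univ, hcard, Fintype.card_fin, smul_eq_mul]
    omega
  have hdeg : p.degree < (2 * N : ℕ) := by
    refine lt_of_le_of_lt (degree_sum_le _ _) ((Finset.sup_lt_iff (WithBot.bot_lt_coe _)).2
      fun j _ => lt_of_le_of_lt (degree_C_mul_X_pow_le _ _) ?_)
    exact_mod_cast colExponent_lt j.2
  have := (natDegree_lt_iff_degree_lt hp0).2 hdeg
  omega

end BranchData

end

/-! ### Divided differences of even functions -/

section

open Metric

/-- The `s`-th divided difference, with respect to the variable `w²`, of an even function `f` at the
nodes `e₀², …, eₛ²`, written as a contour integral. -/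
def evenDivDiff (f : ℂ → ℂ) (R : ℝ) (e : ℕ → ℂ) (s : ℕ) : ℂ :=
  (2 * Real.pi * Complex.I)⁻¹ *
    ∮ w in C(0, R), f w * w / ∏ u ∈ Finset.range (s + 1), (w ^ 2 - e u ^ 2)

theorem two_pi_I_ne_zero' : (2 * Real.pi * Complex.I : ℂ) ≠ 0 := by
  simp [Real.pi_ne_zero, Complex.I_ne_zero]

section DivDiff

variable {f : ℂ → ℂ} {R : ℝ}

theorem sq_sub_sq_ne_zero {w v : ℂ} (hw : w ∈ sphere (0 : ℂ) R) (hv : ‖v‖ < R) :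
    w ^ 2 - v ^ 2 ≠ 0 := by
  have hw' : ‖w‖ = R := by simpa using hw
  intro h
  have : ‖w‖ ^ 2 = ‖v‖ ^ 2 := by rw [← norm_pow, ← norm_pow, sub_eq_zero.1 h]
  rw [hw'] at this
  have h0 := norm_nonneg v
  nlinarith

/-- The contour integral formula for an even function, in terms of squares. -/
theorem even_cauchy (hf : DifferentiableOn ℂ f (closedBall 0 R)) {v : ℂ} (hv : ‖v‖ < R)
    (he : f (-v) = f v) :
    ∮ w in C(0, R), f w * w / (w ^ 2 - v ^ 2) = 2 * Real.pi * Complex.I * f v := by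
  have hR : 0 ≤ R := (norm_nonneg v).trans hv.le
  have hc : ContinuousOn f (sphere 0 R) := hf.continuousOn.mono sphere_subset_closedBall
  have h1 := hf.circleIntegral_sub_inv_smul (w := v) (by simpa using hv)
  have h2 := hf.circleIntegral_sub_inv_smul (w := -v) (by simpa using hv)
  have hint : ∀ u : ℂ, ‖u‖ < R → CircleIntegrable (fun w => (w - u)⁻¹ • f w) 0 R := fun u hu => by
    have hsub : ContinuousOn (fun w : ℂ => w - u) (sphere 0 R) := by fun_prop
    refine ContinuousOn.circleIntegrable hR (ContinuousOn.smul (hsub.inv₀ ?_) hc)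
    intro w hw h
    have hw' : ‖w‖ = R := by simpa using hw
    rw [sub_eq_zero.1 h] at hw'
    exact hu.ne hw'
  have h3 := circleIntegral.integral_add (hint v hv) (hint (-v) (by simpa using hv))
  rw [h1, h2, he] at h3
  have h4 : (∮ w in C(0, R), f w * w / (w ^ 2 - v ^ 2))
      = ∮ w in C(0, R), (1 / 2 : ℂ) * ((w - v)⁻¹ • f w + (w - -v)⁻¹ • f w) := by
    refine circleIntegral.integral_congr hR fun w hw => ?_
    have h5 := sq_sub_sq_ne_zero hw hv
    rw [sq_sub_sq, mul_ne_zero_iff] at h5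
    have h6 : w - v ≠ 0 := h5.2
    have h7 : w - -v ≠ 0 := by rw [sub_neg_eq_add]; exact h5.1
    simp only [smul_eq_mul]
    rw [sq_sub_sq]
    rw [sub_neg_eq_add] at h7 ⊢
    field_simp
    ring
  rw [h4, circleIntegral.integral_const_mul, h3]
  simp only [smul_eq_mul]
  ring

/-- Newton's partial fraction expansion with remainder. -/
theorem newton_partial_fractions (W v : ℂ) (e : ℕ → ℂ) (m : ℕ) (hv : W - v ≠ 0)
    (he : ∀ u, W - e u ≠ 0) :
    1 / (W - v) = ∑ s ∈ Finset.range m,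
        (∏ u ∈ Finset.range s, (v - e u)) / ∏ u ∈ Finset.range (s + 1), (W - e u)
      + (∏ u ∈ Finset.range m, (v - e u)) / ((∏ u ∈ Finset.range m, (W - e u)) * (W - v)) := by
  induction m with
  | zero => simp
  | succ m ih =>
    rw [ih, Finset.sum_range_succ, add_assoc]
    congr 1
    have h1 : ∏ u ∈ Finset.range m, (W - e u) ≠ 0 := Finset.prod_ne_zero_iff.2 fun u _ => he u
    have h2 := he m
    rw [Finset.prod_range_succ, Finset.prod_range_succ]
    field_simp
    ring

/-- Newton interpolation at the nodes. -/
theorem eq_sum_evenDivDiff (hf : DifferentiableOn ℂ f (closedBall 0 R))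
    (he : ∀ v, ‖v‖ < R → f (-v) = f v) {e : ℕ → ℂ} (hn : ∀ u, ‖e u‖ < R) (r : ℕ) :
    f (e r) = ∑ s ∈ Finset.range (r + 1),
      (∏ u ∈ Finset.range s, (e r ^ 2 - e u ^ 2)) * evenDivDiff f R e s := by
  have hR : 0 ≤ R := (norm_nonneg (e r)).trans (hn r).le
  have hc : ContinuousOn f (sphere 0 R) := hf.continuousOn.mono sphere_subset_closedBall
  have hp : ∀ w ∈ sphere (0 : ℂ) R, ∀ s, ∏ u ∈ Finset.range s, (w ^ 2 - e u ^ 2) ≠ 0 :=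
    fun w hw s => Finset.prod_ne_zero_iff.2 fun u _ => sq_sub_sq_ne_zero hw (hn u)
  have h1 := even_cauchy hf (hn r) (he _ (hn r))
  have h2 : (∮ w in C(0, R), f w * w / (w ^ 2 - e r ^ 2)) = ∮ w in C(0, R),
      ∑ s ∈ Finset.range (r + 1), (∏ u ∈ Finset.range s, (e r ^ 2 - e u ^ 2))
        * (f w * w / ∏ u ∈ Finset.range (s + 1), (w ^ 2 - e u ^ 2)) := by
    refine circleIntegral.integral_congr hR fun w hw => ?_
    have h3 := newton_partial_fractions (w ^ 2) (e r ^ 2) (fun u => e u ^ 2) (r + 1)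
      (sq_sub_sq_ne_zero hw (hn r)) fun u => sq_sub_sq_ne_zero hw (hn u)
    have h0 : ∏ u ∈ Finset.range (r + 1), (e r ^ 2 - e u ^ 2) = 0 :=
      Finset.prod_eq_zero (Finset.self_mem_range_succ r) (sub_self _)
    rw [h0, zero_div, add_zero] at h3
    rw [div_eq_mul_one_div, h3, Finset.mul_sum]
    refine Finset.sum_congr rfl fun s _ => ?_
    ring
  have hint : ∀ s ∈ Finset.range (r + 1), CircleIntegrable (fun w =>
      (∏ u ∈ Finset.range s, (e r ^ 2 - e u ^ 2))
        * (f w * w / ∏ u ∈ Finset.range (s + 1), (w ^ 2 - e u ^ 2))) 0 R := fun s _ =>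
    ContinuousOn.circleIntegrable hR (continuousOn_const.mul
      ((hc.mul continuousOn_id).div (by fun_prop) fun w hw => hp w hw (s + 1)))
  rw [h2, circleIntegral.integral_fun_sum hint] at h1
  rw [← mul_right_inj' two_pi_I_ne_zero', ← h1, Finset.mul_sum]
  refine Finset.sum_congr rfl fun s _ => ?_
  rw [circleIntegral.integral_const_mul, evenDivDiff]
  have := two_pi_I_ne_zero'
  field_simp

/-- As the nodes tend to the origin, divided differences tend to Taylor coefficients. -/
theorem tendsto_evenDivDiff {α : Type*} [PseudoMetricSpace α] [LocallyCompactSpace α]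
    (hR : 0 < R) (hf : DifferentiableOn ℂ f (closedBall 0 R)) {node : ℕ → α → ℂ}
    (hnode : ∀ u, Continuous (node u)) {a₀ : α} (h0 : ∀ u, node u a₀ = 0) (s : ℕ) :
    Tendsto (fun a => evenDivDiff f R (fun u => node u a) s) (𝓝 a₀)
      (𝓝 (taylorCoeff f (2 * s))) := by
  have hc : ContinuousOn f (sphere 0 R) := hf.continuousOn.mono sphere_subset_closedBall
  have hlim : taylorCoeff f (2 * s) = evenDivDiff f R (fun u => node u a₀) s := by
    have h1 := (hf.mono closure_ball_subset_closedBall).diffContOnCl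
      |>.circleIntegral_one_div_sub_center_pow_smul hR (2 * s)
    have h2 : (∮ w in C(0, R), f w * w / ∏ u ∈ Finset.range (s + 1), (w ^ 2 - node u a₀ ^ 2))
        = ∮ w in C(0, R), (1 / (w - 0) ^ (2 * s + 1)) • f w := by
      refine circleIntegral.integral_congr hR.le fun w hw => ?_
      have hw0 : w ≠ 0 := ne_zero_of_mem_sphere hR.ne' ⟨w, hw⟩
      simp only [h0, sub_zero, smul_eq_mul, ne_eq, OfNat.ofNat_ne_zero, not_false_eq_true,
        zero_pow, Finset.prod_const, Finset.card_range]
      field_simp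
      ring
    rw [evenDivDiff, h2, h1, taylorCoeff, smul_eq_mul]
    have := two_pi_I_ne_zero'
    field_simp
  rw [hlim]
  refine Tendsto.const_mul _ ?_
  have hopen : {a | ∀ u ∈ Finset.range (s + 1), ‖node u a‖ < R} ∈ 𝓝 a₀ := by
    refine (Finset.eventually_all _).2 fun u _ => ?_
    have : ContinuousAt (fun a => ‖node u a‖) a₀ := (hnode u).norm.continuousAt
    exact this.eventually_lt continuousAt_const (by simpa [h0] using hR)
  obtain ⟨K, hK, hKs, hKc⟩ := local_compact_nhds hopen
  have hcont : ContinuousOn (fun p : α × ℂ => f p.2 * p.2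
      / ∏ u ∈ Finset.range (s + 1), (p.2 ^ 2 - node u p.1 ^ 2)) (K ×ˢ sphere 0 R) := by
    refine ContinuousOn.div ?_ ?_ ?_
    · exact (hc.comp continuousOn_snd fun p hp => hp.2).mul continuousOn_snd
    · refine Continuous.continuousOn ?_
      refine continuous_finsetProd _ fun u _ => ?_
      exact (continuous_snd.pow 2).sub (((hnode u).comp continuous_fst).pow 2)
    · rintro ⟨a, w⟩ ⟨ha, hw⟩
      exact Finset.prod_ne_zero_iff.2 fun u hu => sq_sub_sq_ne_zero hw (hKs ha u hu)
  have hu := (hKc.prod (isCompact_sphere (0 : ℂ) R)).uniformContinuousOn_of_continuous hcont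
  have ht := UniformContinuousOn.tendstoUniformlyOn (F := fun a w => f w * w
      / ∏ u ∈ Finset.range (s + 1), (w ^ 2 - node u a ^ 2)) hu (mem_of_mem_nhds hK)
  rw [nhdsWithin_eq_nhds.2 hK] at ht
  refine ht.tendsto_circleIntegral_of_continuousOn hR.le ?_
  filter_upwards [hK] with a ha
  exact hcont.comp (f := fun w => (a, w)) (by fun_prop) fun w hw => ⟨ha, hw⟩

end DivDiff

end

/-! ### Degeneration of the Darboux transformation -/

section

open Matrix Metric

section RowOperations

variable {N : ℕ}

theorem denMatrix_rowOperation (L : Matrix (Fin (2 * N)) (Fin (2 * N)) ℂ)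
    (row : Fin (2 * N) → Fin 2 → ℕ → ℂ) :
    denMatrix N (fun i k m => ∑ j, L i j * row j k m) = L * denMatrix N row := by
  ext i j
  simp only [denMatrix, Matrix.of_apply, Matrix.mul_apply]
  split_ifs <;> rfl

theorem numMatrix_rowOperation (L : Matrix (Fin (2 * N)) (Fin (2 * N)) ℂ)
    (row : Fin (2 * N) → Fin 2 → ℕ → ℂ) :
    numMatrix N (fun i k m => ∑ j, L i j * row j k m) = L * numMatrix N row := by
  ext i j
  rw [numMatrix, denMatrix_rowOperation, Matrix.of_apply]
  simp only [numMatrix, Matrix.of_apply, Matrix.mul_apply]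
  split_ifs
  · simp
  · rfl

theorem darbouxA_rowOperation {L : Matrix (Fin (2 * N)) (Fin (2 * N)) ℂ} (hL : L.det ≠ 0)
    (row : Fin (2 * N) → Fin 2 → ℕ → ℂ) :
    darbouxA N (fun i k m => ∑ j, L i j * row j k m) = darbouxA N row := by
  rw [darbouxA, denMatrix_rowOperation, numMatrix_rowOperation, Matrix.det_mul, Matrix.det_mul,
    mul_div_mul_left _ _ hL, darbouxA]

theorem tendsto_darbouxA {α : Type*} {l : Filter α} {row : α → Fin (2 * N) → Fin 2 → ℕ → ℂ}
    {row₀ : Fin (2 * N) → Fin 2 → ℕ → ℂ}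
    (h : ∀ i k m, Tendsto (fun a => row a i k m) l (𝓝 (row₀ i k m)))
    (hd : (denMatrix N row₀).det ≠ 0) :
    Tendsto (fun a => darbouxA N (row a)) l (𝓝 (darbouxA N row₀)) := by
  have hdet : ∀ {M : α → Matrix (Fin (2 * N)) (Fin (2 * N)) ℂ}
      {M₀ : Matrix (Fin (2 * N)) (Fin (2 * N)) ℂ},
      (∀ i j, Tendsto (fun a => M a i j) l (𝓝 (M₀ i j))) →
      Tendsto (fun a => (M a).det) l (𝓝 M₀.det) := fun hM =>
    (continuous_id.matrix_det.tendsto _).comp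
      (tendsto_pi_nhds.2 fun i => tendsto_pi_nhds.2 fun j => hM i j)
  have hden : ∀ i j, Tendsto (fun a => denMatrix N (row a) i j) l (𝓝 (denMatrix N row₀ i j)) := by
    intro i j
    simp only [denMatrix, Matrix.of_apply]
    split_ifs
    exacts [h _ _ _, h _ _ _]
  refine (hdet fun i j => ?_).div (hdet hden) hd
  simp only [numMatrix, Matrix.of_apply]
  split_ifs
  exacts [(h _ _ _).neg, hden i j]

end RowOperations

/-- The shift with index `2u + p`, the `u`-th one at the critical value number `p`. -/
def shiftNode {N : ℕ} (p u : ℕ) (ε : Fin (2 * N) → ℂ) : ℂ :=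
  if h : 2 * u + p < 2 * N then ε ⟨2 * u + p, h⟩ else 0

theorem continuous_shiftNode {N : ℕ} (p u : ℕ) :
    Continuous (shiftNode (N := N) p u) := by
  unfold shiftNode
  split_ifs
  exacts [continuous_apply _, continuous_const]

theorem norm_shiftNode_lt {N : ℕ} (p u : ℕ) {ε : Fin (2 * N) → ℂ} {R : ℝ} (h : ‖ε‖ < R) :
    ‖shiftNode p u ε‖ < R := by
  unfold shiftNode
  split_ifs
  · exact (norm_le_pi_norm ε _).trans_lt h
  · rw [norm_zero]; exact (norm_nonneg ε).trans_lt h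

theorem shiftNode_self {N : ℕ} (ε : Fin (2 * N) → ℂ) (i : Fin (2 * N)) :
    shiftNode ((i : ℕ) % 2) ((i : ℕ) / 2) ε = ε i := by
  have : 2 * ((i : ℕ) / 2) + (i : ℕ) % 2 = i := Nat.div_add_mod _ 2
  simp only [shiftNode, this, i.2, dif_pos, Fin.eta]

/-- The lower triangular matrix of Newton's interpolation formula. -/
def newtonMatrix {N : ℕ} (n : ℕ) (ε : Fin (2 * N) → ℂ) :
    Matrix (Fin (2 * N)) (Fin (2 * N)) ℂ :=
  Matrix.of fun i j =>
    if (i : ℕ) < 2 * n then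
      if (j : ℕ) ≤ i ∧ (j : ℕ) % 2 = (i : ℕ) % 2 then
        ∏ u ∈ Finset.range ((j : ℕ) / 2), (ε i ^ 2 - shiftNode ((i : ℕ) % 2) u ε ^ 2)
      else 0
    else if j = i then 1 else 0

theorem det_newtonMatrix_ne_zero {N n : ℕ} {ε : Fin (2 * N) → ℂ} (hε : ε ∈ genericShifts N n) :
    (newtonMatrix n ε).det ≠ 0 := by
  rw [Matrix.det_of_isLowerTriangular]
  · refine Finset.prod_ne_zero_iff.2 fun i _ => ?_
    simp only [newtonMatrix, Matrix.of_apply]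
    split_ifs with h h2
    · refine Finset.prod_ne_zero_iff.2 fun u hu => sub_ne_zero.2 ?_
      have hu' := Finset.mem_range.1 hu
      have hlt : 2 * u + (i : ℕ) % 2 < 2 * N := by omega
      rw [shiftNode, dif_pos hlt]
      refine hε.2 i ⟨_, hlt⟩ h (by simp only; omega) (fun h4 => ?_) (by simp only; omega)
      have := congrArg Fin.val h4
      simp only at this
      omega
    · exact absurd ⟨le_refl _, trivial⟩ h2
    · exact one_ne_zero
  · intro i j hij
    have h1 : (i : ℕ) < j := hij
    simp only [newtonMatrix, Matrix.of_apply]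
    split_ifs with h h2 h3
    · omega
    · rfl
    · rw [h3] at h1; omega
    · rfl

/-- Row `i` of the Newton matrix only involves the rows `j ≤ i` of the same parity, which are
enumerated by `j / 2`. -/
theorem sum_newtonMatrix_mul {N n : ℕ} (ε : Fin (2 * N) → ℂ) (i : Fin (2 * N))
    (hi : (i : ℕ) < 2 * n) (v : ℕ → ℂ) (g : Fin (2 * N) → ℂ)
    (hg : ∀ j : Fin (2 * N), (j : ℕ) ≤ i → (j : ℕ) % 2 = (i : ℕ) % 2 → g j = v ((j : ℕ) / 2)) :
    ∑ j, newtonMatrix n ε i j * g j = ∑ s ∈ Finset.range ((i : ℕ) / 2 + 1),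
      (∏ u ∈ Finset.range s, (ε i ^ 2 - shiftNode ((i : ℕ) % 2) u ε ^ 2)) * v s := by
  symm
  refine Finset.sum_of_injOn
    (fun s => if h : 2 * s + (i : ℕ) % 2 < 2 * N then ⟨2 * s + (i : ℕ) % 2, h⟩ else i) ?_ ?_ ?_ ?_
  · intro s hs s' hs' h
    have h1 : s < (i : ℕ) / 2 + 1 := by simpa using hs
    have h2 : s' < (i : ℕ) / 2 + 1 := by simpa using hs'
    have h3 : 2 * s + (i : ℕ) % 2 < 2 * N := by omega
    have h4 : 2 * s' + (i : ℕ) % 2 < 2 * N := by omega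
    simp only [dif_pos h3, dif_pos h4, Fin.mk.injEq] at h
    omega
  · exact fun s _ => Finset.mem_coe.2 (Finset.mem_univ _)
  · intro j _ hj
    simp only [newtonMatrix, Matrix.of_apply, if_pos hi]
    rw [if_neg, zero_mul]
    rintro ⟨h1, h2⟩
    refine hj ⟨(j : ℕ) / 2, by simp; omega, ?_⟩
    have h3 : 2 * ((j : ℕ) / 2) + (i : ℕ) % 2 = j := by omega
    simp only [h3, j.2, dif_pos, Fin.eta]
  · intro s hs
    have h1 : s < (i : ℕ) / 2 + 1 := by simpa using hs
    have h3 : 2 * s + (i : ℕ) % 2 < 2 * N := by omega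
    have h4 : (2 * s + (i : ℕ) % 2) / 2 = s := by omega
    simp only [dif_pos h3]
    rw [hg ⟨_, h3⟩ (by simp only; omega) (by simp only; omega)]
    simp only [newtonMatrix, Matrix.of_apply, if_pos hi]
    rw [if_pos ⟨by omega, by omega⟩, h4]

namespace BranchData

variable {a b c ρ : ℝ} {lam : Fin 2 → ℂ} {H : Fin 2 → ℂ → ℂ}
  {N n : ℕ} {W : WaveData N}

theorem exists_shifted_component (D : BranchData a c ρ lam H) (x t : ℝ) (j k : Fin 2) :
    ∃ f, AnalyticAt ℂ f 0 ∧ shifted a b c ρ (lam j) (H j) x t k 0 =ᶠ[𝓝[≠] 0] f ∧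
      ∀ᶠ z in 𝓝 (0 : ℂ), f (-z) = f z := by
  fin_cases k
  · obtain ⟨f, h1, -, h2, h3⟩ := D.exists_shifted (b := b) j 0 x t
    exact ⟨f, h1, h2, h3⟩
  · obtain ⟨f, h1, -, h2, h3⟩ := D.exists_shifted (b := b) j 0 (-x) (-t)
    refine ⟨f, h1, ?_, h3⟩
    have e : shifted a b c ρ (lam j) (H j) x t 1 0 = shifted a b c ρ (lam j) (H j) (-x) (-t) 0 0 :=
      funext fun ε => shifted_one 0 x t _ _ ε
    simpa only [Fin.mk_one, e] using h2

theorem shifted_eq_pow_mul (l : ℂ) (h : ℂ → ℂ) (x t : ℝ) (k : Fin 2) (m : ℕ) (ε : ℂ) :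
    shifted a b c ρ l h x t k m ε = (l + ε ^ 2) ^ m * shifted a b c ρ l h x t k 0 ε := by
  rw [shifted, shifted, pow_zero, one_mul]

/-- The coefficient of the degenerate transformation is the limit of the coefficients of
transformations with distinct spectral parameters: the rows at distinct parameters are invertible
combinations of divided differences, which tend to Taylor coefficients. -/
theorem tendsto_interactionA (D : BranchData a c ρ lam H) (x t : ℝ)
    (hd : interactionDen a b c ρ lam H N n W x t ≠ 0) :
    Tendsto (fun ε => darbouxA N (semiPerturbedRows a b c ρ lam H N n W ε x t))
      (𝓝[genericShifts N n] 0) (𝓝 (interactionA a b c ρ lam H N n W x t)) := by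
  -- on a common disc, all entries of the rows are even analytic functions of the shifts
  choose f hfa hfs hfe using D.exists_shifted_component (b := b) x t
  obtain ⟨R, hR, hball⟩ : ∃ R : ℝ, 0 < R ∧ ∀ z ∈ closedBall (0 : ℂ) R, ∀ j k,
      AnalyticAt ℂ (f j k) z ∧ f j k (-z) = f j k z ∧
        (z ≠ 0 → shifted a b c ρ (lam j) (H j) x t k 0 z = f j k z) := by
    have hev : ∀ᶠ z in 𝓝 (0 : ℂ), ∀ j k, AnalyticAt ℂ (f j k) z ∧ f j k (-z) = f j k z ∧
        (z ≠ 0 → shifted a b c ρ (lam j) (H j) x t k 0 z = f j k z) := by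
      refine eventually_all.2 fun j => eventually_all.2 fun k => ?_
      exact (hfa j k).eventually_analyticAt.and
        ((hfe j k).and (eventually_nhdsWithin_iff.1 (hfs j k)))
    exact nhds_basis_closedBall.mem_iff.1 hev
  let F : Fin 2 → Fin 2 → ℕ → ℂ → ℂ := fun j k m z => (lam j + z ^ 2) ^ m * f j k z
  have hFa : ∀ j k m, ∀ z ∈ closedBall (0 : ℂ) R, AnalyticAt ℂ (F j k m) z := fun j k m z hz => by
    have h1 := (hball z hz j k).1
    simp only [F]
    fun_prop
  have hFd : ∀ j k m, DifferentiableOn ℂ (F j k m) (closedBall 0 R) := fun j k m z hz =>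
    (hFa j k m z hz).differentiableAt.differentiableWithinAt
  have hFe : ∀ j k m v, ‖v‖ < R → F j k m (-v) = F j k m v := fun j k m v hv => by
    simp only [F]
    rw [(hball v (by simpa using hv.le) j k).2.1, neg_sq]
  have hFs : ∀ j k m v, ‖v‖ < R → v ≠ 0 → shifted a b c ρ (lam j) (H j) x t k m v = F j k m v :=
    fun j k m v hv hv0 => by
      rw [shifted_eq_pow_mul, (hball v (by simpa using hv.le) j k).2.2 hv0]
  have hFt : ∀ j k m r, taylorPhi a b c ρ (lam j) (H j) x t k m r = taylorCoeff (F j k m) (2 * r) :=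
    fun j k m r => by
      refine evenTaylorCoeff_eq (hFa j k m 0 (by simpa using hR.le)) ?_ r
      filter_upwards [hfs j k] with z hz
      rw [shifted_eq_pow_mul, hz]
  let G : (Fin (2 * N) → ℂ) → Fin (2 * N) → Fin 2 → ℕ → ℂ := fun ε i k m =>
    if (i : ℕ) < 2 * n then evenDivDiff (F (Fin.ofNat 2 i) k m) R
      (fun u => shiftNode ((i : ℕ) % 2) u ε) ((i : ℕ) / 2)
    else W.l i ^ m * W.phi a b c ρ i x t k
  have hG : Tendsto (fun ε => darbouxA N (G ε)) (𝓝 0)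
      (𝓝 (interactionA a b c ρ lam H N n W x t)) := by
    refine tendsto_darbouxA (fun i k m => ?_) hd
    simp only [G, semiDegenerateRows]
    split_ifs with hi
    · rw [rogueRow, hFt]
      refine tendsto_evenDivDiff hR (hFd _ _ _) (fun u => continuous_shiftNode _ u) (fun u => ?_) _
      unfold shiftNode
      split_ifs <;> rfl
    · exact tendsto_const_nhds
  refine (hG.mono_left nhdsWithin_le_nhds).congr' ?_
  have hsmall : ∀ᶠ ε in 𝓝[genericShifts N n] (0 : Fin (2 * N) → ℂ), ‖ε‖ < R :=
    (continuous_norm.tendsto' _ _ norm_zero |>.eventually (gt_mem_nhds hR)).filter_mono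
      nhdsWithin_le_nhds
  filter_upwards [self_mem_nhdsWithin, hsmall] with ε hε hεR
  rw [← darbouxA_rowOperation (det_newtonMatrix_ne_zero hε)]
  congr 1
  funext i k m
  rw [semiPerturbedRows]
  split_ifs with hi
  · rw [shiftedRow, hFs _ _ _ _ ((norm_le_pi_norm ε i).trans_lt hεR) (hε.1 i hi)]
    have h1 := eq_sum_evenDivDiff (hFd (Fin.ofNat 2 i) k m) (hFe _ _ _)
      (fun u => norm_shiftNode_lt ((i : ℕ) % 2) u hεR) ((i : ℕ) / 2)
    rw [shiftNode_self] at h1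
    rw [h1]
    refine sum_newtonMatrix_mul ε i hi (fun s => evenDivDiff (F (Fin.ofNat 2 i) k m) R
      (fun u => shiftNode ((i : ℕ) % 2) u ε) s) (fun j => G ε j k m) fun j hj hp => ?_
    have e1 : Fin.ofNat 2 (j : ℕ) = Fin.ofNat 2 (i : ℕ) :=
      Fin.ext (by simp only [Fin.val_ofNat]; exact hp)
    simp only [G]
    rw [if_pos (by omega), e1, hp]
  · simp only [newtonMatrix, Matrix.of_apply, if_neg hi, ite_mul, one_mul, zero_mul,
      Finset.sum_ite_eq', Finset.mem_univ, if_true, G]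

theorem semiPerturbedRows_self (ε : Fin (2 * N) → ℂ) (x t : ℝ) :
    semiPerturbedRows a b c ρ lam H N N W ε x t = perturbedRows a b c ρ lam H N ε x t := by
  funext i k m
  rw [semiPerturbedRows, if_pos i.2, perturbedRows]

end BranchData

end

/-! ### Rationality of rogue waves -/

section

open Matrix

theorem prod_alternating {N : ℕ} {w : ℂ} (hw : w ≠ 0) :
    ∏ j : Fin (2 * N), (if Even (j : ℕ) then w else w⁻¹) = 1 := by
  rw [Fin.prod_univ_eq_prod_range (fun j => if Even j then w else w⁻¹)]
  induction N with
  | zero => simp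
  | succ N ih =>
    rw [show 2 * (N + 1) = 2 * N + 1 + 1 by ring, Finset.prod_range_succ, Finset.prod_range_succ, ih]
    have : ¬Even (2 * N + 1) := by simp
    rw [if_pos (even_two_mul N), if_neg this, one_mul, mul_inv_cancel₀ hw]

/-- The columns belong alternately to the two components, so that inverse factors of the components
cancel. -/
theorem det_denMatrix_scale {N : ℕ} {w : ℂ} (hw : w ≠ 0) (row : Fin (2 * N) → Fin 2 → ℕ → ℂ) :
    (denMatrix N fun i k m => ![w, w⁻¹] k * row i k m).det = (denMatrix N row).det := by
  have e : (denMatrix N fun i k m => ![w, w⁻¹] k * row i k m)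
      = Matrix.of fun i (j : Fin (2 * N)) =>
        (if Even (j : ℕ) then w else w⁻¹) * denMatrix N row i j := by
    ext i j
    simp only [denMatrix, Matrix.of_apply]
    split_ifs <;> simp
  rw [e, Matrix.det_mul_row, prod_alternating hw, one_mul]

/-- The second column of the numerator belongs to the first component instead of the second, which
leaves a factor `w / w⁻¹`. -/
theorem det_numMatrix_scale {N : ℕ} (hN : 1 ≤ N) {w : ℂ} (hw : w ≠ 0)
    (row : Fin (2 * N) → Fin 2 → ℕ → ℂ) :
    (numMatrix N fun i k m => ![w, w⁻¹] k * row i k m).det = w ^ 2 * (numMatrix N row).det := by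
  let v : Fin (2 * N) → ℂ := fun j =>
    (if (j : ℕ) = 1 then w ^ 2 else 1) * (if Even (j : ℕ) then w else w⁻¹)
  have e : (numMatrix N fun i k m => ![w, w⁻¹] k * row i k m)
      = Matrix.of fun i j => v j * numMatrix N row i j := by
    ext i j
    simp only [numMatrix, denMatrix, Matrix.of_apply, v]
    by_cases h1 : (j : ℕ) = 1
    · rw [if_pos h1, if_pos h1, if_pos h1, if_neg (by rw [h1]; decide)]
      simp only [Matrix.cons_val_zero]
      field_simp
    · rw [if_neg h1, if_neg h1, if_neg h1, one_mul]
      split_ifs <;> simp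
  have hv : ∏ j, v j = w ^ 2 := by
    simp only [v, Finset.prod_mul_distrib]
    rw [prod_alternating hw, mul_one, Finset.prod_eq_single ⟨1, by omega⟩]
    · simp
    · exact fun j _ hj => if_neg fun h => hj (Fin.ext h)
    · simp
  rw [e, Matrix.det_mul_row, hv]

/-- The polynomial whose values are the determinant of the denominator matrix with polynomial
rows. -/
def denPoly (N : ℕ) (row : Fin (2 * N) → Fin 2 → ℕ → MvPolynomial (Fin 2) ℂ) :
    MvPolynomial (Fin 2) ℂ :=
  Matrix.det (Matrix.of fun i j : Fin (2 * N) =>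
    if Even (j : ℕ) then row i 0 (2 * N - 2 - j) else row i 1 (2 * N - j))

/-- The polynomial whose values are the determinant of the numerator matrix with polynomial
rows. -/
def numPoly (N : ℕ) (row : Fin (2 * N) → Fin 2 → ℕ → MvPolynomial (Fin 2) ℂ) :
    MvPolynomial (Fin 2) ℂ :=
  Matrix.det (Matrix.of fun i j : Fin (2 * N) =>
    if (j : ℕ) = 1 then -row i 0 (2 * N)
    else if Even (j : ℕ) then row i 0 (2 * N - 2 - j) else row i 1 (2 * N - j))

theorem eval_denPoly {N : ℕ} (row : Fin (2 * N) → Fin 2 → ℕ → MvPolynomial (Fin 2) ℂ)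
    (z : Fin 2 → ℂ) : MvPolynomial.eval z (denPoly N row)
      = (denMatrix N fun i k m => MvPolynomial.eval z (row i k m)).det := by
  rw [denPoly, RingHom.map_det]
  congr 1
  ext i j
  simp only [RingHom.mapMatrix_apply, Matrix.map_apply, Matrix.of_apply, denMatrix]
  split_ifs <;> rfl

theorem eval_numPoly {N : ℕ} (row : Fin (2 * N) → Fin 2 → ℕ → MvPolynomial (Fin 2) ℂ)
    (z : Fin 2 → ℂ) : MvPolynomial.eval z (numPoly N row)
      = (numMatrix N fun i k m => MvPolynomial.eval z (row i k m)).det := by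
  rw [numPoly, RingHom.map_det]
  congr 1
  ext i j
  simp only [RingHom.mapMatrix_apply, Matrix.map_apply, Matrix.of_apply, numMatrix, denMatrix]
  split_ifs <;> simp

namespace EigenGerm

variable {a b c ρ : ℝ} (G : EigenGerm a c ρ)

/-- The polynomial parts of the Taylor coefficients of both components of an eigenfunction, when
the phase vanishes at the centre of the expansion. -/
def coeffPoly (n : ℕ) (k : Fin 2) (m : ℕ) : MvPolynomial (Fin 2) ℂ :=
  ![expPoly (fun z => G.μ z ^ m * G.U z) G.vel G.freq n
      + expPoly (fun z => G.μ z ^ m * G.V z) (fun z => -G.vel z) (fun z => -G.freq z) n,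
    expPoly (fun z => G.μ z ^ m * G.U z) (fun z => -G.vel z) (fun z => -G.freq z) n
      + expPoly (fun z => G.μ z ^ m * G.V z) G.vel G.freq n] k

variable {A : ℂ → ℂ} {n : ℕ}

theorem plus_eq_eval (hA : AnalyticAt ℂ A 0) (hh : G.h 0 = 0) (x t : ℝ) :
    G.plus n A x t = MvPolynomial.eval ![(x : ℂ), (t : ℂ)] (expPoly A G.vel G.freq n) := by
  rw [eval_expPoly hA G.vel_analytic G.freq_analytic (by simp [vel, hh]) (by simp [freq, hh])]
  rfl

theorem plus_neg_eq_eval (hA : AnalyticAt ℂ A 0) (hh : G.h 0 = 0) (x t : ℝ) :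
    G.plus n A (-x) (-t) = MvPolynomial.eval ![(x : ℂ), (t : ℂ)]
      (expPoly A (fun z => -G.vel z) (fun z => -G.freq z) n) := by
  rw [eval_expPoly hA G.vel_analytic.fun_neg G.freq_analytic.fun_neg (by simp [vel, hh])
    (by simp [freq, hh]), plus]
  congr 1
  funext z
  push_cast
  ring_nf

theorem coeff_eq_eval (hh : G.h 0 = 0) (m : ℕ) (x t : ℝ) :
    G.coeff b n m x t = Complex.exp (1 / 2 * Complex.I * (a * x + b * t))
      * MvPolynomial.eval ![(x : ℂ), (t : ℂ)] (G.coeffPoly n 0 m) := by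
  rw [coeff, G.plus_eq_eval (G.pow_mul_U_analytic m) hh,
    G.plus_neg_eq_eval (G.pow_mul_V_analytic m) hh]
  simp [coeffPoly]

theorem coeff_neg_eq_eval (hh : G.h 0 = 0) (m : ℕ) (x t : ℝ) :
    G.coeff b n m (-x) (-t) = (Complex.exp (1 / 2 * Complex.I * (a * x + b * t)))⁻¹
      * MvPolynomial.eval ![(x : ℂ), (t : ℂ)] (G.coeffPoly n 1 m) := by
  rw [coeff, neg_neg, neg_neg, G.plus_eq_eval (G.pow_mul_V_analytic m) hh,
    G.plus_neg_eq_eval (G.pow_mul_U_analytic m) hh, ← Complex.exp_neg]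
  simp only [coeffPoly, Matrix.cons_val_one, Matrix.cons_val_zero, map_add]
  congr 2
  push_cast
  ring

end EigenGerm

namespace BranchData

variable {a b c ρ : ℝ} {lam : Fin 2 → ℂ} {H : Fin 2 → ℂ → ℂ} (D : BranchData a c ρ lam H)

/-- The polynomial parts of the rows of the degenerate transformation. -/
def rowPoly (N : ℕ) (i : Fin (2 * N)) (k : Fin 2) (m : ℕ) : MvPolynomial (Fin 2) ℂ :=
  (D.germ (Fin.ofNat 2 i)).coeffPoly (2 * ((i : ℕ) / 2) + 1) k m

theorem degenerateRows_eq_eval (N : ℕ) (x t : ℝ) :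
    degenerateRows a b c ρ lam H N x t = fun i k m =>
      ![Complex.exp (1 / 2 * Complex.I * (a * x + b * t)),
        (Complex.exp (1 / 2 * Complex.I * (a * x + b * t)))⁻¹] k
        * MvPolynomial.eval ![(x : ℂ), (t : ℂ)] (D.rowPoly N i k m) := by
  have hh : ∀ j, (D.germ j).h 0 = 0 := fun j => by
    obtain ⟨k, -, -, hH, -⟩ := (D.branch j).exists_eq_mul (D.root j) (D.simple j)
    exact (hH 0).trans (zero_mul _)
  funext i k m
  rw [degenerateRows, rogueRow]
  fin_cases k
  · simp only [Fin.zero_eta, Matrix.cons_val_zero]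
    rw [D.taylorPhi_zero, EigenGerm.coeff_eq_eval _ (hh _), rowPoly]
  · simp only [Fin.mk_one, Matrix.cons_val_one, Matrix.cons_val_zero]
    rw [taylorPhi_one, D.taylorPhi_zero, EigenGerm.coeff_neg_eq_eval _ (hh _), rowPoly]

theorem rogueDen_eq_eval (N : ℕ) (x t : ℝ) : rogueDen a b c ρ lam H N x t
    = MvPolynomial.eval ![(x : ℂ), (t : ℂ)] (denPoly N (D.rowPoly N)) := by
  rw [rogueDen, D.degenerateRows_eq_eval, det_denMatrix_scale (Complex.exp_ne_zero _), eval_denPoly]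

theorem rogueA_eq_eval {N : ℕ} (hN : 1 ≤ N) (x t : ℝ) : rogueA a b c ρ lam H N x t
    = Complex.exp (Complex.I * (a * x + b * t))
      * (MvPolynomial.eval ![(x : ℂ), (t : ℂ)] (numPoly N (D.rowPoly N))
        / MvPolynomial.eval ![(x : ℂ), (t : ℂ)] (denPoly N (D.rowPoly N))) := by
  rw [rogueA, darbouxA, D.degenerateRows_eq_eval, det_denMatrix_scale (Complex.exp_ne_zero _),
    det_numMatrix_scale hN (Complex.exp_ne_zero _), eval_denPoly, eval_numPoly, mul_div_assoc,
    ← Complex.exp_nat_mul]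
  congr 2
  push_cast
  ring

theorem rogueWave_rational (D : BranchData a c ρ lam H) {N : ℕ} (hN : 1 ≤ N) :
    ∃ P Q : MvPolynomial (Fin 2) ℂ,
      (∀ x t : ℝ, rogueDen a b c ρ lam H N x t = MvPolynomial.eval ![(x : ℂ), (t : ℂ)] Q) ∧
      ∀ x t : ℝ, rogueDen a b c ρ lam H N x t ≠ 0 →
        rogueWave a b c ρ lam H N x t = Complex.exp (Complex.I * (a * x + b * t))
          * (MvPolynomial.eval ![(x : ℂ), (t : ℂ)] P
            / MvPolynomial.eval ![(x : ℂ), (t : ℂ)] Q ^ 2) := by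
  set Q := denPoly N (D.rowPoly N) with hQ
  set P := numPoly N (D.rowPoly N) with hP
  refine ⟨MvPolynomial.C (c : ℂ) * Q ^ 2
    + MvPolynomial.C (Complex.I * a - 2 * Complex.I * ρ) * P * Q
    + MvPolynomial.pderiv 0 P * Q - P * MvPolynomial.pderiv 0 Q, Q, D.rogueDen_eq_eval N,
    fun x t hne => ?_⟩
  rw [D.rogueDen_eq_eval, ← hQ] at hne
  have hexp : HasDerivAt (fun y : ℝ => Complex.exp (Complex.I * (a * y + b * t)))
      (Complex.exp (Complex.I * (a * x + b * t)) * (Complex.I * (a * 1))) x :=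
    ((((Complex.ofRealCLM.hasDerivAt (x := x)).const_mul (a : ℂ)).add_const
      ((b : ℂ) * t)).const_mul Complex.I).cexp
  have hA := hexp.mul ((hasDerivAt_eval_fst P x t).div (hasDerivAt_eval_fst Q x t) hne)
  have hdx : dx (rogueA a b c ρ lam H N) x t = _ :=
    (congrArg (fun f => deriv f x) (funext fun y => D.rogueA_eq_eval hN y t)).trans hA.deriv
  rw [rogueWave, dressed, hdx, D.rogueA_eq_eval hN, ← hP, ← hQ, seed]
  simp only [map_add, map_sub, map_mul, map_pow, MvPolynomial.eval_C, Pi.div_apply]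
  field_simp
  ring

end BranchData

end

end NonlocalNLS

end

open NonlocalNLS in
theorem mainTheorem4 (a b c ρ : ℝ) (hc : c ≠ 0) (ha : a ≠ 2 * ρ)
    (hs : c ^ 2 + 2 * a - 4 * ρ ≠ 0) (hb : b = seedFrequency a c ρ)
    (l₁ : ℂ) (hl : IsCriticalValue a c ρ l₁) :
    -- the seed is a solution, and analytic branches of `H` exist at `λ₁` and `λ₂ = λ₁^*`
    IsSolutionOn ρ Set.univ (seed a b c) ∧
    (∃ H : Fin 2 → ℂ → ℂ, ∀ j, IsRootBranch a c ρ (conjPair l₁ j) (H j)) ∧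
    ∀ H : Fin 2 → ℂ → ℂ, (∀ j, IsRootBranch a c ρ (conjPair l₁ j) (H j)) →
      -- the Taylor expansions in `ε²`
      (∀ (j k : Fin 2) (m : ℕ) (x t : ℝ), ∀ᶠ ε in 𝓝[≠] (0 : ℂ),
        HasSum (fun n : ℕ => taylorPhi a b c ρ (conjPair l₁ j) (H j) x t k m n * ε ^ (2 * n))
          (shifted a b c ρ (conjPair l₁ j) (H j) x t k m ε)) ∧
      -- the `N`-order rogue wave
      (∀ N : ℕ, 1 ≤ N →
        rogueDen a b c ρ (conjPair l₁) H N 0 0 ≠ 0 ∧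
        IsSolutionOn ρ (regularSet (rogueDen a b c ρ (conjPair l₁) H N))
          (rogueWave a b c ρ (conjPair l₁) H N) ∧
        (∃ P Q : MvPolynomial (Fin 2) ℂ,
          (∀ x t : ℝ, rogueDen a b c ρ (conjPair l₁) H N x t =
            MvPolynomial.eval ![(x : ℂ), (t : ℂ)] Q) ∧
          ∀ x t : ℝ, rogueDen a b c ρ (conjPair l₁) H N x t ≠ 0 →
            rogueWave a b c ρ (conjPair l₁) H N x t =
              Complex.exp (Complex.I * (a * x + b * t))
                * (MvPolynomial.eval ![(x : ℂ), (t : ℂ)] P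
                  / MvPolynomial.eval ![(x : ℂ), (t : ℂ)] Q ^ 2)) ∧
        ∀ x t : ℝ, rogueDen a b c ρ (conjPair l₁) H N x t ≠ 0 →
          Tendsto (fun ε => darbouxA N (perturbedRows a b c ρ (conjPair l₁) H N ε x t))
            (𝓝[genericShifts N N] 0) (𝓝 (rogueA a b c ρ (conjPair l₁) H N x t))) ∧
      -- the interaction of an `n`-order rogue wave with other localized waves
      (∀ N n : ℕ, 1 ≤ n → n < N → ∀ W : WaveData N, W.Admissible a c ρ n →
        (Set.InjOn W.l {i | 2 * n ≤ (i : ℕ)} →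
          (∀ i : Fin (2 * N), 2 * n ≤ (i : ℕ) → ∀ j, W.l i ≠ conjPair l₁ j) →
          (∀ i : Fin (2 * N), 2 * n ≤ (i : ℕ) → ∃ x t k, W.phi a b c ρ i x t k ≠ 0) →
          interactionDen a b c ρ (conjPair l₁) H N n W 0 0 ≠ 0) ∧
        IsSolutionOn ρ (regularSet (interactionDen a b c ρ (conjPair l₁) H N n W))
          (interactionWave a b c ρ (conjPair l₁) H N n W) ∧
        ∀ x t : ℝ, interactionDen a b c ρ (conjPair l₁) H N n W x t ≠ 0 →
          Tendsto
            (fun ε => darbouxA N (semiPerturbedRows a b c ρ (conjPair l₁) H N n W ε x t))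
            (𝓝[genericShifts N n] 0)
            (𝓝 (interactionA a b c ρ (conjPair l₁) H N n W x t))) := by
  have hr₁ : radicand a c ρ l₁ = 0 := hl.radicand_eq_zero ha
  have hroot : ∀ j, radicand a c ρ (conjPair l₁ j) = 0 := fun j => by
    fin_cases j
    · exact hr₁
    · exact (radicand_conj l₁).trans (by rw [hr₁, map_zero])
  have hsimple : ∀ j, radicandQuot a c ρ (conjPair l₁ j) 0 ≠ 0 := fun j =>
    radicandQuot_ne_zero hc ha hs (hroot j)
  refine ⟨isSolutionOn_seed hb, ?_, fun H hH => ?_⟩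
  · choose H hH using fun j => exists_isRootBranch (hroot j) (hsimple j)
    exact ⟨H, hH⟩
  have D : BranchData a c ρ (conjPair l₁) H := ⟨hc, hroot, hsimple, hH⟩
  have hne : conjPair l₁ 0 ≠ conjPair l₁ 1 := (conj_ne_of_radicand hc hr₁).symm
  refine ⟨fun j k m x t => D.hasSum_taylorPhi j m x t k, fun N hN => ?_, fun N n _ hnN W hW => ?_⟩
  · -- the rogue wave is the case `n = N` of the interaction, in which no other waves are left
    let W : WaveData N := ⟨0, 0, 0, 0⟩
    have hW : W.Admissible a c ρ N := BranchData.admissible_self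
    have hlast : ∀ i : Fin (2 * N), ¬2 * N ≤ (i : ℕ) := fun i => not_le.2 i.2
    have hrows := BranchData.semiDegenerateRows_self (a := a) (b := b) (c := c) (ρ := ρ)
      (lam := conjPair l₁) (H := H) (W := W)
    have hden : interactionDen a b c ρ (conjPair l₁) H N N W
        = rogueDen a b c ρ (conjPair l₁) H N := by
      funext x t; rw [interactionDen, hrows, rogueDen]
    have hA : interactionA a b c ρ (conjPair l₁) H N N W = rogueA a b c ρ (conjPair l₁) H N := by
      funext x t; rw [interactionA, hrows, rogueA]
    refine ⟨?_, ?_, D.rogueWave_rational hN, fun x t h => ?_⟩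
    · rw [← hden]
      exact D.interactionDen_origin_ne_zero hne le_rfl hW
        (fun i hi => absurd hi (hlast i)) (fun i hi => absurd hi (hlast i))
        fun i hi => absurd hi (hlast i)
    · have h := D.isSolutionOn_interactionWave hN hW hb
      rwa [hden, interactionWave, hA] at h
    · rw [← hden] at h
      have h' := D.tendsto_interactionA x t h
      rw [hA] at h'
      simpa only [BranchData.semiPerturbedRows_self] using h'
  · exact ⟨D.interactionDen_origin_ne_zero hne hnN.le hW,
      D.isSolutionOn_interactionWave (by omega) hW hb, D.tendsto_interactionA⟩
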